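/- Let $m\ge 0$, $N\in\mathbb N$ with $N\ge 2$, $\nu\ge -1$, and $\mathbb R_+=(0,\infty)$. Let $V=(V_{ij})_{i,j=1,2}:\mathbb R_+\to\mathbb C^{2\times2}$ with $V_{11},V_{22}\in W^{N+1,2}_{\rm loc}(\mathbb R_+)$, $V_{12},V_{21}\in W^{N,2}_{\rm loc}(\mathbb R_+)$ (continuous representatives), and let $H_V$ be the maximal Dirac operator in $L^2(\mathbb R_+)\oplus L^2(\mathbb R_+)$, $$H_Vf=\begin{pmatrix}(-i\partial_x+V_{12})f_2+(V_{11}+m)f_1\\(-i\partial_x+V_{21})f_1+(V_{22}-m)f_2\end{pmatrix},\qquad \mathcal D(H_V)=\{f\in L^2(\mathbb R_+)^2: H_Vf\in L^2(\mathbb R_+)^2\},$$ the action being understood in the sense of distributions. Assume: (1) $\operatorname{Im}V_{11}=\operatorname{Im}V_{22}=:\mathcal V$ is strictly increasing on $\mathbb R_+$, $\mathcal V(x)\to+\infty$ as $x\to+\infty$, and there are $\varepsilon_1,p,a_0,x_0>0$ such that for all $x\ge x_0$ $$\mathcal V'(x)\ge a_0\,x^{2\nu+\varepsilon_1},\qquad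 \mathcal V'(x)\ge a_0\,|\mathcal V''(x)|\,x^{-\nu},\qquad \mathcal V'(x)\ge a_0\,\mathcal V(x)^p x^{2\nu};$$ (2) $\operatorname{Im}V_{12}(x)+\operatorname{Im}V_{21}(x)=o(x^{-\nu}\mathcal V'(x))$ as $x\to+\infty$; (3) as $x\to+\infty$ (almost everywhere), $|V_{ii}^{(n)}(x)|=\mathcal O(x^{n\nu}|V_{ii}(x)|)$ for $i\in\{1,2\}$, $1\le n\le N+1$, and $|(V_{21}-V_{12})^{(n)}(x)|=\mathcal O(x^{(n+1)\nu})$ for $0\le n\le N$. For large $\beta>0$ let $x_\beta>0$ be the turning point, $\mathcal V(x_\beta)=\beta$, and put $$\delta_\beta=\tfrac12x_\beta^{-\nu},\quad J_\beta=(x_\beta-\delta_\beta,x_\beta+\delta_\beta),\quad F(x_\beta,x)=\int_{x_\beta}^x(\mathcal V(t)-\beta)\,dt,$$ $$\kappa(\beta,c)=\exp\!\big(-cF(x_\beta,x_\beta-\tfrac{\delta_\beta}2)\big)+\exp\!\big(-cF(x_\beta,x_\beta+\tfrac{\delta_\beta}2)\big).$$ Given a function $\alpha=\alpha(\beta)\in\mathbb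 R$, put $\lambda=\alpha+i\beta$ and $$\sigma^{(N)}(\beta)=\sum_{\ell=-1}^{N-2}\frac{x_\beta^{(N+\ell+2)\nu}}{|\alpha|^{N+\ell+1}}\Big(1+\frac{\beta}{|\alpha|}\Big)^{N+\ell+2}.$$ Given also smooth cut-offs $\xi=\xi_\beta\in C_0^\infty(\mathbb R_+;[0,1])$ with $\xi=1$ on $(x_\beta-\frac{\delta_\beta}2,x_\beta+\frac{\delta_\beta}2)$, $\xi=0$ off $J_\beta$ and $\|\xi^{(j)}\|_\infty\le M\delta_\beta^{-j}$ ($j=1,2$) for large $\beta$, with $M$ independent of $\beta$, define $$k_1=e^{-i\int_{x_\beta}^xV_{21}},\quad k_2=e^{-i\int_{x_\beta}^xV_{12}},\quad V_\lambda=(\lambda-m-V_{11})(\lambda+m-V_{22}),\quad K_\lambda=\frac{k_1}{k_2}\,\frac1{\lambda+m-V_{22}},$$ $$\psi_{-1}'=\pm i\lambda^{-1}V_\lambda^{1/2},\qquad \psi_{\ell+1}'=\frac1{2\psi_{-1}'}\Big(\psi_\ell''+\frac{K_\lambda'}{K_\lambda}\psi_\ell'-\sum_{j=0}^{\ell}\psi_j'\psi_{\ell-j}'\Big)\quad(-1\le\ell\le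 N-2)$$ (principal square root; sign $+$ if $\alpha-m-\operatorname{Re}V_{11}>0$ on $J_\beta$, sign $-$ if $\alpha-m-\operatorname{Re}V_{11}<0$ on $J_\beta$), and $$\Psi_{\lambda,N}=\begin{pmatrix}k_1u\\k_2v\end{pmatrix},\qquad u=\xi\exp\Big(-\sum_{k=-1}^{N-1}\int_{x_\beta}^x\lambda^{-k}\psi_k'(t)\,dt\Big),\qquad v=\frac{k_1}{k_2}\,\frac{-i\,\partial_xu}{\lambda+m-V_{22}}.$$ Then: (a) For every $c\in(0,1)$, $\kappa(\beta,c)\to0$ as $\beta\to+\infty$. (b) For all $a,b>0$ there is $C>0$ with the following property. Let $\alpha=\alpha(\beta)$ be such that, for all large $\beta$ and all $x\in J_\beta$, $$(\alpha-m-\operatorname{Re}V_{11}(x))(\alpha+m-\operatorname{Re}V_{22}(x))>0,$$ $$a|\alpha|\le|\alpha-m-\operatorname{Re}V_{11}(x)|\le b|\alpha|,\qquad a|\alpha|\le|\alpha+m-\operatorname{Re}V_{22}(x)|\le b|\alpha|,$$ and, as $\beta\to+\infty$: if $\nu\le0$, $$\frac{\beta^{2/3}x_\beta^{\frac{N+1}{2N-1}\nu}}{\mathcal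 V'(x_\beta)^{1/(2N-1)}}=o(|\alpha|);$$ if $\nu>0$, $$\frac{x_\beta^{3\nu}}{\mathcal V'(x_\beta)^{1/(N-1)}}=o(|\alpha|)\quad\text{and}\quad\frac{\beta^{2/3}x_\beta^{\nu}}{\mathcal V'(x_\beta)^{1/(2N-1)}}=o(|\alpha|).$$ Let $(\xi_\beta)$ be any family of cut-offs as above. Then for every $c\in(0,1)$ there is $\beta_0>0$ such that for all $\beta>\beta_0$ one has $0\ne\Psi_{\lambda,N}\in\mathcal D(H_V)$ and $$\frac{\|(H_V-\lambda)\Psi_{\lambda,N}\|}{\|\Psi_{\lambda,N}\|}\le\kappa(\beta,c)+C\,\sigma^{(N)}(\beta).$$ -/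

import Mathlib

open Set Filter Topology MeasureTheory Asymptotics
open scoped ContDiff

namespace DiracPseudomode

noncomputable section

/-! ### Weak derivatives and local Sobolev spaces on the half-line `(0, ∞)` -/

/-- `g` is the weak (distributional) derivative of `f` on `(0, ∞)`, both being locally integrable
there. -/
def HasWeakDeriv (f g : ℝ → ℂ) : Prop :=
  LocallyIntegrableOn f (Ioi 0) ∧ LocallyIntegrableOn g (Ioi 0) ∧
    ∀ φ : ℝ → ℝ, ContDiff ℝ ∞ φ → HasCompactSupport φ → tsupport φ ⊆ Ioi 0 →
      ∫ x in Ioi 0, deriv φ x • f x = - ∫ x in Ioi 0, φ x • g x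

/-- `f ∈ L²_loc(0, ∞)`. -/
def MemL2loc (f : ℝ → ℂ) : Prop :=
  ∀ K : Set ℝ, IsCompact K → K ⊆ Ioi 0 → MemLp f 2 (volume.restrict K)

/-- `f` is the continuous representative of an element of `W^{n,2}_loc(0, ∞)` (it is used for
`n ≥ 1`): there are weak derivatives up to order `n`, all of them in `L²_loc(0, ∞)`.
For such an `f`, `iteratedDeriv k f` is the classical derivative for `k < n`, and
`iteratedDeriv n f` exists almost everywhere and is the weak derivative of order `n`. -/
def MemW2loc (n : ℕ) (f : ℝ → ℂ) : Prop :=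
  ContinuousOn f (Ioi 0) ∧ ∃ D : ℕ → ℝ → ℂ, D 0 = f ∧ (∀ k ≤ n, MemL2loc (D k)) ∧
    ∀ k < n, HasWeakDeriv (D k) (D (k + 1))

/-! ### The maximal Dirac operator on `L²(0, ∞) ⊕ L²(0, ∞)` -/

/-- The Hilbert space `L²(0, ∞) ⊕ L²(0, ∞)`. -/
abbrev Spinors : Type := Lp (EuclideanSpace ℂ (Fin 2)) 2 (volume.restrict (Ioi (0 : ℝ)))

/-- In the sense of distributions on `(0, ∞)`,
`-i f₂' + V₁₂ f₂ + (V₁₁ + m) f₁ = g₁` and `-i f₁' + V₂₁ f₁ + (V₂₂ - m) f₂ = g₂`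
(each equation being solved for the derivative). -/
def IsDiracImage (m : ℝ) (V : ℝ → Matrix (Fin 2) (Fin 2) ℂ)
    (f g : ℝ → EuclideanSpace ℂ (Fin 2)) : Prop :=
  HasWeakDeriv (fun x => f x 1)
      (fun x => Complex.I * (g x 0 - (V x 0 1 * f x 1 + (V x 0 0 + m) * f x 0))) ∧
    HasWeakDeriv (fun x => f x 0)
      (fun x => Complex.I * (g x 1 - (V x 1 0 * f x 0 + (V x 1 1 - m) * f x 1)))

theorem HasWeakDeriv.ae_congr {f f' g g' : ℝ → ℂ} (h : HasWeakDeriv f g)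
    (hf : f =ᵐ[volume.restrict (Ioi 0)] f') (hg : g =ᵐ[volume.restrict (Ioi 0)] g') :
    HasWeakDeriv f' g' := by
  have key : ∀ {u w : ℝ → ℂ}, u =ᵐ[volume.restrict (Ioi 0)] w →
      LocallyIntegrableOn u (Ioi 0) → LocallyIntegrableOn w (Ioi 0) := by
    intro u w huw hu
    rw [locallyIntegrableOn_iff isOpen_Ioi.isLocallyClosed] at hu ⊢
    intro k hk hkc
    exact (hu k hk hkc).congr (ae_restrict_of_ae_restrict_of_subset hk huw)
  refine ⟨key hf h.1, key hg h.2.1, fun φ h1 h2 h3 => ?_⟩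
  have e1 : ∫ x in Ioi 0, deriv φ x • f' x = ∫ x in Ioi 0, deriv φ x • f x :=
    integral_congr_ae (by filter_upwards [hf] with x hx; rw [hx])
  have e2 : ∫ x in Ioi 0, φ x • g' x = ∫ x in Ioi 0, φ x • g x :=
    integral_congr_ae (by filter_upwards [hg] with x hx; rw [hx])
  rw [e1, e2]
  exact h.2.2 φ h1 h2 h3

theorem integrableOn_smul_of_test {f : ℝ → ℂ} (hf : LocallyIntegrableOn f (Ioi 0))
    {φ : ℝ → ℝ} (h1 : Continuous φ) (h2 : HasCompactSupport φ) (h3 : tsupport φ ⊆ Ioi 0) :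
    IntegrableOn (fun x => φ x • f x) (Ioi 0) := by
  have h := (hf.integrableOn_compact_subset h3 h2).continuousOn_smul h1.continuousOn h2
  have h' : IntegrableOn (fun x => φ x • f x) univ := by
    refine h.of_forall_sdiff_eq_zero MeasurableSet.univ ?_
    intro x hx
    simp [image_eq_zero_of_notMem_tsupport hx.2]
  exact h'.mono_set (subset_univ _)

theorem HasWeakDeriv.add {f f' g g' : ℝ → ℂ} (h : HasWeakDeriv f g) (h' : HasWeakDeriv f' g') :
    HasWeakDeriv (fun x => f x + f' x) (fun x => g x + g' x) := by
  refine ⟨h.1.add h'.1, h.2.1.add h'.2.1, fun φ h1 h2 h3 => ?_⟩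
  have hd : Continuous (deriv φ) := h1.continuous_deriv (by simp)
  have hds : tsupport (deriv φ) ⊆ Ioi 0 :=
    (closure_minimal (support_deriv_subset) (isClosed_tsupport φ)).trans h3
  simp only [smul_add]
  rw [integral_add (integrableOn_smul_of_test h.1 hd h2.deriv hds)
      (integrableOn_smul_of_test h'.1 hd h2.deriv hds),
    integral_add (integrableOn_smul_of_test h.2.1 h1.continuous h2 h3)
      (integrableOn_smul_of_test h'.2.1 h1.continuous h2 h3),
    h.2.2 φ h1 h2 h3, h'.2.2 φ h1 h2 h3]
  ring

theorem HasWeakDeriv.const_mul {f g : ℝ → ℂ} (h : HasWeakDeriv f g) (c : ℂ) :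
    HasWeakDeriv (fun x => c * f x) (fun x => c * g x) := by
  refine ⟨h.1.smul c, h.2.1.smul c, fun φ h1 h2 h3 => ?_⟩
  simp only [← mul_smul_comm]
  rw [integral_const_mul, integral_const_mul, h.2.2 φ h1 h2 h3]
  ring

theorem HasWeakDeriv.unique {f g g' : ℝ → ℂ} (h : HasWeakDeriv f g) (h' : HasWeakDeriv f g') :
    g =ᵐ[volume.restrict (Ioi 0)] g' := by
  have hs : LocallyIntegrableOn (fun x => g x - g' x) (Ioi 0) := h.2.1.sub h'.2.1
  have := isOpen_Ioi.ae_eq_zero_of_integral_contDiff_smul_eq_zero hs ?_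
  · rw [EventuallyEq, ae_restrict_iff' measurableSet_Ioi]
    filter_upwards [this] with x hx hx0
    exact sub_eq_zero.mp (hx hx0)
  · intro φ h1 h2 h3
    have e : ∫ x in Ioi 0, φ x • (g x - g' x) = 0 := by
      simp only [smul_sub]
      rw [integral_sub (integrableOn_smul_of_test h.2.1 h1.continuous h2 h3)
        (integrableOn_smul_of_test h'.2.1 h1.continuous h2 h3)]
      have a := h.2.2 φ h1 h2 h3
      have b := h'.2.2 φ h1 h2 h3
      rw [a] at b
      rw [neg_inj.mp b, sub_self]
    rw [← e]
    refine (setIntegral_eq_integral_of_forall_compl_eq_zero ?_).symm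
    intro x hx
    simp [image_eq_zero_of_notMem_tsupport fun hh => hx (h3 hh)]

theorem IsDiracImage.add {m : ℝ} {V : ℝ → Matrix (Fin 2) (Fin 2) ℂ} {f f' g g' : Spinors}
    (h : IsDiracImage m V f g) (h' : IsDiracImage m V f' g') :
    IsDiracImage m V ↑(f + f') ↑(g + g') := by
  refine ⟨(h.1.add h'.1).ae_congr ?_ ?_, (h.2.add h'.2).ae_congr ?_ ?_⟩ <;>
    filter_upwards [Lp.coeFn_add f f', Lp.coeFn_add g g'] with x hx hy <;>
    simp only [hx, hy, Pi.add_apply, PiLp.add_apply] <;> ring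

theorem IsDiracImage.smul {m : ℝ} {V : ℝ → Matrix (Fin 2) (Fin 2) ℂ} {f g : Spinors}
    (h : IsDiracImage m V f g) (c : ℂ) : IsDiracImage m V ↑(c • f) ↑(c • g) := by
  refine ⟨(h.1.const_mul c).ae_congr ?_ ?_, (h.2.const_mul c).ae_congr ?_ ?_⟩ <;>
    filter_upwards [Lp.coeFn_smul c f, Lp.coeFn_smul c g] with x hx hy <;>
    simp only [hx, hy, Pi.smul_apply, PiLp.smul_apply, smul_eq_mul] <;> ring

theorem IsDiracImage.unique {m : ℝ} {V : ℝ → Matrix (Fin 2) (Fin 2) ℂ} {f g g' : Spinors}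
    (h : IsDiracImage m V f g) (h' : IsDiracImage m V f g') : g = g' := by
  refine Lp.ext ?_
  filter_upwards [h.1.unique h'.1, h.2.unique h'.2] with x h0 h1
  have h0' := mul_left_cancel₀ Complex.I_ne_zero h0
  have h1' := mul_left_cancel₀ Complex.I_ne_zero h1
  ext i
  fin_cases i
  · simpa using h0'
  · simpa using h1'

theorem IsDiracImage.zero {m : ℝ} {V : ℝ → Matrix (Fin 2) (Fin 2) ℂ} :
    IsDiracImage m V ((0 : Spinors) : ℝ → EuclideanSpace ℂ (Fin 2)) ((0 : Spinors) :) := by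
  have z : HasWeakDeriv (fun _ => 0) (fun _ => 0) :=
    ⟨locallyIntegrableOn_zero, locallyIntegrableOn_zero, by simp⟩
  have h0 := Lp.coeFn_zero (EuclideanSpace ℂ (Fin 2)) 2 (volume.restrict (Ioi (0 : ℝ)))
  refine ⟨z.ae_congr ?_ ?_, z.ae_congr ?_ ?_⟩ <;>
    filter_upwards [h0] with x hx <;> rw [hx] <;> simp

/-- The maximal Dirac operator `H_V` in `L²(0, ∞) ⊕ L²(0, ∞)`: its domain consists of all `f` for
which the distribution `H_V f` belongs to `L²(0, ∞) ⊕ L²(0, ∞)`. -/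
def diracOp (m : ℝ) (V : ℝ → Matrix (Fin 2) (Fin 2) ℂ) : Spinors →ₗ.[ℂ] Spinors where
  domain :=
    { carrier := {f | ∃ g : Spinors, IsDiracImage m V f g}
      add_mem' := fun ⟨_, h⟩ ⟨_, h'⟩ => ⟨_, h.add h'⟩
      zero_mem' := ⟨0, IsDiracImage.zero⟩
      smul_mem' := fun c _ ⟨_, h⟩ => ⟨_, h.smul c⟩ }
  toFun :=
    { toFun := fun f => f.2.choose
      map_add' := fun f f' =>
        (f + f').2.choose_spec.unique (f.2.choose_spec.add f'.2.choose_spec)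
      map_smul' := fun c f => (c • f).2.choose_spec.unique (f.2.choose_spec.smul c) }

/-! ### The class of potentials -/

/-- `𝒱 = Im V₁₁`. -/
def imDiag (V : ℝ → Matrix (Fin 2) (Fin 2) ℂ) (x : ℝ) : ℝ := (V x 0 0).im

/-- The class of potentials, with regularity index `N` and exponent `ν`. The filter
`atTop ⊓ ae volume` is "`x → ∞`, up to a null set"; the null set matters only for the derivatives
of highest order, which exist almost everywhere. -/
structure AdmissiblePotential (N : ℕ) (ν : ℝ) (V : ℝ → Matrix (Fin 2) (Fin 2) ℂ) : Prop where
  memW_diag : ∀ i, MemW2loc (N + 1) (fun x => V x i i)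
  memW_12 : MemW2loc N (fun x => V x 0 1)
  memW_21 : MemW2loc N (fun x => V x 1 0)
  im_eq : ∀ x > 0, (V x 0 0).im = (V x 1 1).im
  strictMono : StrictMonoOn (imDiag V) (Ioi 0)
  tendsto : Tendsto (imDiag V) atTop atTop
  growth : ∃ ε₁ > (0 : ℝ), ∃ p > (0 : ℝ), ∃ a > (0 : ℝ), ∃ x₀ > (0 : ℝ), ∀ x ≥ x₀,
    a * x ^ (2 * ν + ε₁) ≤ deriv (imDiag V) x ∧
    a * (|iteratedDeriv 2 (imDiag V) x| * x ^ (-ν)) ≤ deriv (imDiag V) x ∧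
    a * (imDiag V x ^ p * x ^ (2 * ν)) ≤ deriv (imDiag V) x
  offDiag : (fun x => (V x 0 1).im + (V x 1 0).im) =o[atTop]
    fun x => x ^ (-ν) * deriv (imDiag V) x
  deriv_diag : ∀ i, ∀ n ∈ Finset.Icc 1 (N + 1),
    iteratedDeriv n (fun x => V x i i) =O[atTop ⊓ ae volume]
      fun x => x ^ (n * ν) * ‖V x i i‖
  deriv_offDiag : ∀ n ∈ Finset.Icc 0 N,
    iteratedDeriv n (fun x => V x 1 0 - V x 0 1) =O[atTop ⊓ ae volume]
      fun x => x ^ ((n + 1) * ν)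

/-! ### The turning point, the cut-off functions and the pseudomode -/

/-- The turning point `x_β > 0`, the solution of `𝒱(x_β) = β`. -/
def turningPoint (V : ℝ → Matrix (Fin 2) (Fin 2) ℂ) (β : ℝ) : ℝ :=
  Function.invFunOn (imDiag V) (Ioi 0) β

/-- `δ_β = x_β^{-ν} / 2`. -/
def width (ν : ℝ) (V : ℝ → Matrix (Fin 2) (Fin 2) ℂ) (β : ℝ) : ℝ :=
  turningPoint V β ^ (-ν) / 2

/-- `J_β = (x_β - δ_β, x_β + δ_β)`. -/
def window (ν : ℝ) (V : ℝ → Matrix (Fin 2) (Fin 2) ℂ) (β : ℝ) : Set ℝ :=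
  Ioo (turningPoint V β - width ν V β) (turningPoint V β + width ν V β)

/-- A `β`-dependent cut-off `ξ_β`, equal to `1` on the half-size window and to `0` off `J_β`, with
`‖ξ_β^{(j)}‖_∞ ≲ δ_β^{-j}` for `j = 1, 2`. -/
def IsCutoffFamily (ν : ℝ) (V : ℝ → Matrix (Fin 2) (Fin 2) ℂ) (ξ : ℝ → ℝ → ℝ) : Prop :=
  ∃ M : ℝ, ∀ᶠ β in atTop,
    ContDiff ℝ ∞ (ξ β) ∧ HasCompactSupport (ξ β) ∧ tsupport (ξ β) ⊆ Ioi 0 ∧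
    (∀ x, 0 ≤ ξ β x ∧ ξ β x ≤ 1) ∧
    (∀ x ∈ Ioo (turningPoint V β - width ν V β / 2) (turningPoint V β + width ν V β / 2),
      ξ β x = 1) ∧
    (∀ x ∉ window ν V β, ξ β x = 0) ∧
    ∀ j ∈ Finset.Icc 1 2, ∀ x, |iteratedDeriv j (ξ β) x| ≤ M * (width ν V β)⁻¹ ^ j

section Pseudomode

variable (m : ℝ) (V : ℝ → Matrix (Fin 2) (Fin 2) ℂ) (xb : ℝ) (lam : ℂ)

def k1 (x : ℝ) : ℂ := Complex.exp (-Complex.I * ∫ t in xb..x, V t 1 0)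

def k2 (x : ℝ) : ℂ := Complex.exp (-Complex.I * ∫ t in xb..x, V t 0 1)

/-- `V_λ = (λ - m - V₁₁)(λ + m - V₂₂)`. -/
def Vlam (x : ℝ) : ℂ := (lam - m - V x 0 0) * (lam + m - V x 1 1)

/-- `K_λ = (k₁ / k₂) / (λ + m - V₂₂)`. -/
def Klam (x : ℝ) : ℂ := k1 V xb x / k2 V xb x * (1 / (lam + m - V x 1 1))

/-- The solutions of the eikonal and transport equations, with the index shifted by one:
`psi m V xb lam s k` is `ψ_{k-1}'`, and `s = ±1` is the sign in `ψ_{-1}' = ± i λ⁻¹ V_λ^{1/2}`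
(principal square root). -/
def psi (s : ℂ) : ℕ → ℝ → ℂ
  | 0 => fun x => s * Complex.I * lam⁻¹ * Vlam m V lam x ^ (1 / 2 : ℂ)
  | k + 1 => fun x =>
      1 / (2 * psi s 0 x) *
        (deriv (psi s k) x + deriv (Klam m V xb lam) x / Klam m V xb lam x * psi s k x
          - ∑ j : Fin k, psi s (j + 1) x * psi s (k - j) x)
  termination_by n => n
  decreasing_by all_goals omega

/-- `P_{λ,n}(x) = ∑_{k=-1}^{n-1} ∫_{x_β}^x λ^{-k} ψ_k'(t) dt`. -/
def phase (s : ℂ) (n : ℕ) (x : ℝ) : ℂ :=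
  ∑ k ∈ Finset.range (n + 1), ∫ t in xb..x, lam ^ (1 - (k : ℤ)) * psi m V xb lam s k t

/-- `u_{λ,n} = ξ exp(-P_{λ,n})`. -/
def modeU (s : ℂ) (n : ℕ) (ξ : ℝ → ℝ) (x : ℝ) : ℂ :=
  ξ x * Complex.exp (-phase m V xb lam s n x)

/-- `v_{λ,n} = (k₁ / k₂) (-i ∂ₓ u_{λ,n}) / (λ + m - V₂₂)`. -/
def modeV (s : ℂ) (n : ℕ) (ξ : ℝ → ℝ) (x : ℝ) : ℂ :=
  k1 V xb x / k2 V xb x *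
    (-Complex.I * deriv (modeU m V xb lam s n ξ) x / (lam + m - V x 1 1))

/-- `Ψ_{λ,n} = (k₁ u_{λ,n}, k₂ v_{λ,n})`. -/
def mode (s : ℂ) (n : ℕ) (ξ : ℝ → ℝ) (x : ℝ) : EuclideanSpace ℂ (Fin 2) :=
  !₂[k1 V xb x * modeU m V xb lam s n ξ x, k2 V xb x * modeV m V xb lam s n ξ x]

end Pseudomode

/-- The pseudomode for `λ = α + iβ` centred at the turning point `x_β`; the sign of `ψ_{-1}'` is
that of `α - m - Re V₁₁` (which does not change on `J_β` where it is used). -/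
def pseudomode (m : ℝ) (V : ℝ → Matrix (Fin 2) (Fin 2) ℂ) (N : ℕ) (ξ : ℝ → ℝ) (α β : ℝ) :
    ℝ → EuclideanSpace ℂ (Fin 2) :=
  mode m V (turningPoint V β) (α + β * Complex.I)
    (if 0 < α - m - (V (turningPoint V β) 0 0).re then 1 else -1) N ξ

/-! ### Conditions on `α = α(β)`, and the rates -/

/-- For large `β` and all `x ∈ J_β`: `α - m - Re V₁₁(x)` and `α + m - Re V₂₂(x)` have the same
sign, and their moduli lie between `a |α|` and `b |α|`. -/
def IsComparable (m ν : ℝ) (V : ℝ → Matrix (Fin 2) (Fin 2) ℂ) (a b : ℝ) (α : ℝ → ℝ) : Prop :=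
  ∀ᶠ β in atTop, ∀ x ∈ window ν V β,
    0 < (α β - m - (V x 0 0).re) * (α β + m - (V x 1 1).re) ∧
    a * |α β| ≤ |α β - m - (V x 0 0).re| ∧ |α β - m - (V x 0 0).re| ≤ b * |α β| ∧
    a * |α β| ≤ |α β + m - (V x 1 1).re| ∧ |α β + m - (V x 1 1).re| ≤ b * |α β|

/-- The lower bounds on the growth of `|α|`, separately for `ν ≤ 0` and `ν > 0`. -/
def HasLowerGrowth (N : ℕ) (ν : ℝ) (V : ℝ → Matrix (Fin 2) (Fin 2) ℂ) (α : ℝ → ℝ) : Prop :=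
  (ν ≤ 0 →
    (fun β => β ^ (2 / 3 : ℝ) * turningPoint V β ^ (((N : ℝ) + 1) / (2 * N - 1) * ν) /
      deriv (imDiag V) (turningPoint V β) ^ (1 / (2 * (N : ℝ) - 1))) =o[atTop]
        fun β => |α β|) ∧
  (0 < ν →
    (fun β => turningPoint V β ^ (3 * ν) /
      deriv (imDiag V) (turningPoint V β) ^ (1 / ((N : ℝ) - 1))) =o[atTop]
        (fun β => |α β|) ∧
    (fun β => β ^ (2 / 3 : ℝ) * turningPoint V β ^ ν /
      deriv (imDiag V) (turningPoint V β) ^ (1 / (2 * (N : ℝ) - 1))) =o[atTop]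
        fun β => |α β|)

/-- `F(x_β, x) = ∫_{x_β}^x (𝒱(t) - β) dt`. -/
def Fint (V : ℝ → Matrix (Fin 2) (Fin 2) ℂ) (β x : ℝ) : ℝ :=
  ∫ t in turningPoint V β..x, (imDiag V t - β)

/-- `κ(β, c)`. -/
def kappa (ν : ℝ) (V : ℝ → Matrix (Fin 2) (Fin 2) ℂ) (β c : ℝ) : ℝ :=
  Real.exp (-c * Fint V β (turningPoint V β - width ν V β / 2)) +
    Real.exp (-c * Fint V β (turningPoint V β + width ν V β / 2))

/-- `σ^{(N)}(β)` for `α = α(β)`; the summation index is `ℓ + 1`, where `-1 ≤ ℓ ≤ N - 2`. -/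
def sigma (N : ℕ) (ν : ℝ) (V : ℝ → Matrix (Fin 2) (Fin 2) ℂ) (α β : ℝ) : ℝ :=
  ∑ i ∈ Finset.range N,
    turningPoint V β ^ ((N + i + 1) * ν) / |α| ^ (N + i) * (1 + β / |α|) ^ (N + i + 1)

end

end DiracPseudomode

open DiracPseudomode

namespace DiracPseudomode

/-! ### Absolutely continuous functions and weak derivatives -/

/-! Put A = λ - m - V₁₁, B = λ + m - V₂₂ and κ = K_λ'/K_λ. The choice of v makes the second
component of (H_V - λ)Ψ vanish identically, and the first one becomes -(k₁/B)(u'' + κu' + ABu). With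
u = ξ e^{-P} and p_k = λ^{1-k} ψ_{k-1}', so that P' = p_0 + ... + p_N, the terms without derivatives
of ξ contain the factor (P')² + AB - P'' - κP'. The eikonal equation p_0² = -AB and the transport
equations cancel everything in it except a tail of products and the last terms p_N' and κp_N
(`wkb_remainder_eq`).

The tail is measured by a symbol calculus on an interval U around the closed window. With r = |α|
and μ = x_β^ν(1 + β/|α|), the derivatives of A and B are O(rμ^j), while A and B are at least of
order r. Hence p_{k+1} = O(μ^{k+1}/r^k), each further derivative costing a factor μ
(`SymbolOn.exists_transport`). Summing the tail and dividing by B gives a multiple of σ^{(N)}. The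
last derivative p_N' exists only almost everywhere, which is why symbols are Lipschitz at top order
and the domain statement rests on absolute continuity.

The terms with derivatives of ξ live on the two outer parts of the window, so the modulus of
k₁e^{-P} has to be compared there and near x_β. The term p_1 integrates exactly
(`WindowData.exp_neg_integral_phaseDeriv_one`), and the square of the modulus becomes |k₁k₂| times a
bounded-type ratio times exp(-2 Re ∫p_0) times the contribution of p_2, ..., p_N. Since A and B have
the same imaginary part β - 𝒱, the arithmetic-geometric mean inequality gives Re p_0 = θ(𝒱 - β) with
1 ≤ θ ≤ C (`WindowData.re_phaseDeriv_zero`). So Re ∫p_0 ≥ F with constant exactly 1, which is what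
permits every c < 1.

The large parameter is Φ = 𝒱'(x_β)x_β^{-2ν}. On the window 𝒱' is comparable to 𝒱'(x_β), so F is at
least a multiple of Φ at distance δ_β/2; this already proves that κ(β,c) tends to 0. Powers of x_β,
β and 1/|α| are subexponential in Φ, |k₁k₂| is at most e^{εΦ} by the assumption on Im V₁₂ + Im V₂₁,
and the lower bounds on |α| make the integrals of p_2, ..., p_N at most εΦ. All these losses fit
into the surplus e^{(1-c)F}.

For ν ≤ 0 the crude μ may be too large for that last point. In the remaining case 𝒱' ≤ x_β^ν|α|, and
Landau's interpolation inequality improves the first derivatives of V_ii, so that the symbol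
estimates hold with the smaller scale x_β^ν √(1 + β/|α|). This scale serves only in the bounds for
the modulus. -/

theorem absolutelyContinuousOnInterval_primitive {f : ℝ → ℂ} {a b : ℝ}
    (h : IntervalIntegrable f volume a b) :
    AbsolutelyContinuousOnInterval (fun x => ∫ t in a..x, f t) a b := by
  have hre : IntervalIntegrable (fun t => (f t).re) volume a b := ⟨h.1.re, h.2.re⟩
  have him : IntervalIntegrable (fun t => (f t).im) volume a b := ⟨h.1.im, h.2.im⟩
  have cst : ∀ c : ℂ, AbsolutelyContinuousOnInterval (fun _ : ℝ => c) a b := fun c =>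
    (LipschitzWith.const c).lipschitzOnWith.absolutelyContinuousOnInterval
  have key := ((hre.absolutelyContinuousOnInterval_intervalIntegral left_mem_uIcc).smul
      (cst 1)).add
    ((him.absolutelyContinuousOnInterval_intervalIntegral left_mem_uIcc).smul (cst Complex.I))
  have e : ∀ x ∈ uIcc a b, (∫ t in a..x, f t) =
      ((fun x => ∫ t in a..x, (f t).re) • (fun _ : ℝ => (1 : ℂ)) +
        (fun x => ∫ t in a..x, (f t).im) • (fun _ : ℝ => Complex.I)) x := by
    intro x hx
    have hs : uIcc a x ⊆ uIcc a b := uIcc_subset_uIcc_left hx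
    have h' := h.mono_set hs
    have r1 : (∫ t in a..x, f t).re = ∫ t in a..x, (f t).re :=
      (Complex.reCLM.intervalIntegral_comp_comm h').symm
    have r2 : (∫ t in a..x, f t).im = ∫ t in a..x, (f t).im :=
      (Complex.imCLM.intervalIntegral_comp_comm h').symm
    apply Complex.ext <;> simp [r1, r2]
  rw [absolutelyContinuousOnInterval_iff] at key ⊢
  intro ε hε
  obtain ⟨δ, hδ, H⟩ := key ε hε
  refine ⟨δ, hδ, fun E hE hl => ?_⟩
  convert H E hE hl using 2 with i hi
  have hm := hE.1 i hi
  rw [e _ hm.1, e _ hm.2]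

/-- Subtracting the primitive of f' leaves an absolutely continuous function with derivative zero
almost everywhere, hence a constant. -/
theorem integral_eq_sub_of_ae_hasDerivAt {f f' : ℝ → ℂ} {a b : ℝ}
    (hf : AbsolutelyContinuousOnInterval f a b) (hi : IntervalIntegrable f' volume a b)
    (h : ∀ᵐ x, x ∈ uIcc a b → HasDerivAt f (f' x) x) :
    ∫ x in a..b, f' x = f b - f a := by
  obtain ⟨C, hC⟩ := (hf.sub (absolutelyContinuousOnInterval_primitive hi)).const_of_ae_hasDerivAt_zero
    (by
      filter_upwards [h, hi.ae_hasDerivAt_integral] with x h1 h2 hx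
      have := (h1 hx).sub (h2 hx a left_mem_uIcc)
      rwa [sub_self] at this)
  have e1 := hC a left_mem_uIcc
  have e2 := hC b right_mem_uIcc
  simp only [Pi.sub_apply, intervalIntegral.integral_same, sub_zero] at e1 e2
  rw [e1, ← e2]
  ring

theorem exists_Icc_of_isCompact_subset_Ioi {K : Set ℝ} (hK : IsCompact K) (h : K ⊆ Ioi 0) :
    ∃ a b : ℝ, 0 < a ∧ a ≤ b ∧ K ⊆ Ioo a b := by
  rcases K.eq_empty_or_nonempty with rfl | hne
  · exact ⟨1, 1, one_pos, le_rfl, empty_subset _⟩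
  · obtain ⟨p, hp, hp'⟩ := hK.exists_isMinOn hne continuousOn_id
    obtain ⟨q, hq, hq'⟩ := hK.exists_isMaxOn hne continuousOn_id
    have hp0 : 0 < p := h hp
    have hpq : p ≤ q := hp' hq
    refine ⟨p / 2, q + 1, by linarith, by linarith, fun x hx => ⟨?_, ?_⟩⟩
    · have : p ≤ x := hp' hx
      linarith
    · have : x ≤ q := hq' hx
      linarith

theorem intervalIntegrable_of_locallyIntegrableOn {g : ℝ → ℂ}
    (hg : LocallyIntegrableOn g (Ioi 0)) {a b : ℝ} (ha : 0 < a) (hb : 0 < b) :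
    IntervalIntegrable g volume a b := by
  apply IntegrableOn.intervalIntegrable
  refine hg.integrableOn_compact_subset (fun x hx => ?_) isCompact_uIcc
  exact lt_of_lt_of_le (lt_min ha hb) hx.1

theorem setIntegral_Ioi_eq_intervalIntegral {f : ℝ → ℂ} {a b : ℝ} (ha : 0 < a) (hab : a ≤ b)
    (h : ∀ x ∉ Ioo a b, f x = 0) : ∫ x in Ioi 0, f x = ∫ x in a..b, f x := by
  rw [intervalIntegral.integral_of_le hab, setIntegral_eq_integral_of_forall_compl_eq_zero,
    setIntegral_eq_integral_of_forall_compl_eq_zero]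
  · exact fun x hx => h x fun h' => hx ⟨h'.1, h'.2.le⟩
  · exact fun x hx => h x fun h' => hx (ha.trans h'.1)

/-- A function that is absolutely continuous on the compact intervals of `(0, ∞)` has its
almost everywhere derivative as weak derivative. -/
theorem hasWeakDeriv_of_ae_hasDerivAt {f g : ℝ → ℂ}
    (hf : ∀ a b : ℝ, 0 < a → a ≤ b → AbsolutelyContinuousOnInterval f a b)
    (hg : LocallyIntegrableOn g (Ioi 0)) (h : ∀ᵐ x, 0 < x → HasDerivAt f (g x) x) :
    HasWeakDeriv f g := by
  have hfc : ContinuousOn f (Ioi 0) := by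
    intro x hx
    have hx0 : (0 : ℝ) < x := hx
    have hc := (hf (x / 2) (x + 1) (by linarith) (by linarith)).continuousOn
    rw [uIcc_of_le (by linarith)] at hc
    exact (hc.continuousAt (Icc_mem_nhds (by linarith) (by linarith))).continuousWithinAt
  refine ⟨hfc.locallyIntegrableOn measurableSet_Ioi, hg, fun φ h1 h2 h3 => ?_⟩
  obtain ⟨a, b, ha, hab, hK⟩ := exists_Icc_of_isCompact_subset_Ioi h2 h3
  have z1 : ∀ x ∉ Ioo a b, φ x = 0 := fun x hx =>
    image_eq_zero_of_notMem_tsupport fun h' => hx (hK h')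
  have z2 : ∀ x ∉ Ioo a b, deriv φ x = 0 := fun x hx => by
    by_contra h'
    exact hx (hK (support_deriv_subset h'))
  have hd : Continuous (deriv φ) := h1.continuous_deriv (by simp)
  have hfi : IntervalIntegrable f volume a b :=
    (hf a b ha hab).continuousOn.intervalIntegrable
  have hgi := intervalIntegrable_of_locallyIntegrableOn hg ha (ha.trans_le hab)
  have i1 : IntervalIntegrable (fun x => deriv φ x • f x) volume a b :=
    hfi.continuousOn_smul hd.continuousOn
  have i2 : IntervalIntegrable (fun x => φ x • g x) volume a b :=
    hgi.continuousOn_smul h1.continuous.continuousOn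
  rw [setIntegral_Ioi_eq_intervalIntegral ha hab fun x hx => by rw [z2 x hx, zero_smul],
    setIntegral_Ioi_eq_intervalIntegral ha hab fun x hx => by rw [z1 x hx, zero_smul],
    eq_neg_iff_add_eq_zero, ← intervalIntegral.integral_add i1 i2,
    integral_eq_sub_of_ae_hasDerivAt (f := φ • f) _ (i1.add i2)]
  · simp [z1 a (by simp), z1 b (by simp)]
  · filter_upwards [h] with x hx hxm
    rw [uIcc_of_le hab] at hxm
    have := ((h1.differentiable (by simp)) x).hasDerivAt.smul (hx (ha.trans_le hxm.1))
    convert! this using 1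
    rw [add_comm]
  · have : AbsolutelyContinuousOnInterval φ a b :=
      (h1.contDiffOn.of_le (by simp)).absolutelyContinuousOnInterval
    exact this.smul (hf a b ha hab)

/-- The constancy theorem (du Bois-Reymond). -/
theorem exists_ae_eq_const_of_hasWeakDeriv_zero {h : ℝ → ℂ} (H : HasWeakDeriv h (fun _ => 0)) :
    ∃ c : ℂ, h =ᵐ[volume.restrict (Ioi 0)] fun _ => c := by
  let B : ContDiffBump (1 : ℝ) := ⟨1 / 4, 1 / 2, by norm_num, by norm_num⟩
  let ρ : ℝ → ℝ := B.normed volume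
  have hρ : ContDiff ℝ ∞ ρ := B.contDiff_normed
  have hρc : HasCompactSupport ρ := B.hasCompactSupport_normed
  have hρs : tsupport ρ ⊆ Ioi 0 := by
    rw [B.tsupport_normed_eq]
    intro x hx
    rw [Metric.mem_closedBall, Real.dist_eq, abs_le] at hx
    have : B.rOut = 1 / 2 := rfl
    rw [this] at hx
    simp only [mem_Ioi]
    linarith [hx.1]
  have hρ1 : ∫ x, ρ x = 1 := B.integral_normed
  set c : ℂ := ∫ x in Ioi 0, ρ x • h x with hc
  refine ⟨c, ?_⟩
  have hs : LocallyIntegrableOn (fun x => h x - c) (Ioi 0) :=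
    H.1.sub ((locallyIntegrable_const c).locallyIntegrableOn _)
  have key := isOpen_Ioi.ae_eq_zero_of_integral_contDiff_smul_eq_zero hs ?_
  · rw [EventuallyEq, ae_restrict_iff' measurableSet_Ioi]
    filter_upwards [key] with x hx hx0
    exact sub_eq_zero.mp (hx hx0)
  intro η h1 h2 h3
  have hηi : Integrable η := h1.continuous.integrable_of_hasCompactSupport h2
  have hρi : Integrable ρ := hρ.continuous.integrable_of_hasCompactSupport hρc
  set s : ℝ := ∫ x, η x with hsd
  -- Removing the multiple s of ρ gives ψ mean zero, so its primitive φ is again a test function.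
  -- Testing h against φ' = ψ yields ∫ ηh = s c.
  let ψ : ℝ → ℝ := fun x => η x - s * ρ x
  have hψ : ContDiff ℝ ∞ ψ := h1.sub (contDiff_const.mul hρ)
  have hψc : Continuous ψ := hψ.continuous
  obtain ⟨a, b, ha, hab, hK⟩ := exists_Icc_of_isCompact_subset_Ioi (h2.union hρc)
    (union_subset h3 hρs)
  have zη : ∀ x ∉ Ioo a b, η x = 0 := fun x hx =>
    image_eq_zero_of_notMem_tsupport fun h' => hx (hK (Or.inl h'))
  have zρ : ∀ x ∉ Ioo a b, ρ x = 0 := fun x hx =>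
    image_eq_zero_of_notMem_tsupport fun h' => hx (hK (Or.inr h'))
  have zψ : ∀ x ∉ Ioo a b, ψ x = 0 := fun x hx => by simp [ψ, zη x hx, zρ x hx]
  let φ : ℝ → ℝ := fun x => ∫ t in a..x, ψ t
  have hφd : ∀ x, HasDerivAt φ (ψ x) x := fun x =>
    intervalIntegral.integral_hasDerivAt_right (hψc.intervalIntegrable _ _)
      (hψc.stronglyMeasurableAtFilter _ _) hψc.continuousAt
  have hφ' : deriv φ = ψ := funext fun x => (hφd x).deriv
  have hφ : ContDiff ℝ ∞ φ := by
    rw [contDiff_infty_iff_deriv, hφ']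
    exact ⟨fun x => (hφd x).differentiableAt, hψ⟩
  have hψi : ∫ t in a..b, ψ t = 0 := by
    rw [intervalIntegral.integral_of_le hab, setIntegral_eq_integral_of_forall_compl_eq_zero
      fun x (hx : x ∉ Ioc a b) => zψ x fun h' => hx ⟨h'.1, h'.2.le⟩]
    simp only [ψ]
    rw [integral_sub hηi (hρi.const_mul s), integral_const_mul, hρ1, hsd]
    ring
  have zφ : ∀ x ∉ Icc a b, φ x = 0 := by
    intro x hx
    rcases lt_or_ge x a with h' | h'
    · simp only [φ]
      rw [intervalIntegral.integral_symm, intervalIntegral.integral_of_le h'.le,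
        setIntegral_eq_zero_of_forall_eq_zero, neg_zero]
      exact fun t ht => zψ t fun h'' => absurd h''.1 (not_lt.mpr ht.2)
    · have hbx : b < x := by
        by_contra h''
        exact hx ⟨h', not_lt.mp h''⟩
      simp only [φ]
      rw [← intervalIntegral.integral_add_adjacent_intervals (hψc.intervalIntegrable a b)
        (hψc.intervalIntegrable b x), hψi, intervalIntegral.integral_of_le hbx.le,
        setIntegral_eq_zero_of_forall_eq_zero, add_zero]
      exact fun t ht => zψ t fun h'' => absurd ht.1 (not_lt.mpr h''.2.le)
  have tφ : tsupport φ ⊆ Icc a b := closure_minimal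
    (fun x hx => by_contra fun h' => hx (zφ x h')) isClosed_Icc
  have := H.2.2 φ hφ (HasCompactSupport.intro isCompact_Icc zφ)
    (tφ.trans fun x hx => ha.trans_le hx.1)
  rw [hφ'] at this
  simp only [smul_zero, integral_zero, neg_zero, ψ, sub_smul, mul_smul] at this
  have iη := integrableOn_smul_of_test H.1 h1.continuous h2 h3
  have iρ := integrableOn_smul_of_test H.1 hρ.continuous hρc hρs
  rw [integral_sub (g := fun x => s • ρ x • h x) iη (iρ.smul s), integral_smul, ← hc] at this
  have e : ∫ x, η x • (h x - c) = ∫ x in Ioi 0, η x • (h x - c) := by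
    refine (setIntegral_eq_integral_of_forall_compl_eq_zero fun x hx => ?_).symm
    rw [image_eq_zero_of_notMem_tsupport fun hh => hx (h3 hh), zero_smul]
  have e2 : ∫ x in Ioi 0, η x • c = s • c := by
    rw [setIntegral_eq_integral_of_forall_compl_eq_zero fun x hx => by
      rw [image_eq_zero_of_notMem_tsupport fun hh => hx (h3 hh), zero_smul], integral_smul_const]
  rw [e]
  simp only [smul_sub]
  rw [integral_sub iη (hηi.integrableOn.smul_const c), e2, this]

theorem HasWeakDeriv.exists_ae_eq_primitive {f g : ℝ → ℂ} (h : HasWeakDeriv f g) :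
    ∃ c : ℂ, f =ᵐ[volume.restrict (Ioi 0)] fun x => c + ∫ t in (1 : ℝ)..x, g t := by
  have hi : ∀ {a b : ℝ}, 0 < a → 0 < b → IntervalIntegrable g volume a b := fun ha hb =>
    intervalIntegrable_of_locallyIntegrableOn h.2.1 ha hb
  have hG : HasWeakDeriv (fun x => ∫ t in (1 : ℝ)..x, g t) g := by
    refine hasWeakDeriv_of_ae_hasDerivAt (fun a b ha hab => ?_) h.2.1 ?_
    · have hb := ha.trans_le hab
      have h1 := absolutelyContinuousOnInterval_primitive (hi ha hb)
      have h2 : AbsolutelyContinuousOnInterval (fun _ : ℝ => ∫ t in (1 : ℝ)..a, g t) a b :=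
        (LipschitzWith.const _).lipschitzOnWith.absolutelyContinuousOnInterval
      have h3 := h2.add h1
      rw [absolutelyContinuousOnInterval_iff] at h3 ⊢
      intro ε hε
      obtain ⟨δ, hδ, H⟩ := h3 ε hε
      refine ⟨δ, hδ, fun E hE hl => ?_⟩
      convert H E hE hl using 2 with i hi'
      have hm := hE.1 i hi'
      have ee : ∀ x ∈ uIcc a b, (∫ t in (1 : ℝ)..x, g t) =
          (∫ t in (1 : ℝ)..a, g t) + ∫ t in a..x, g t := fun x hx =>
        (intervalIntegral.integral_add_adjacent_intervals (hi one_pos ha)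
          (hi ha ((lt_min ha hb).trans_le hx.1))).symm
      simp only [Pi.add_apply]
      rw [ee _ hm.1, ee _ hm.2]
    -- Lebesgue differentiation on the compact intervals [1/(n+1), n+1], which exhaust the
    -- half-line, and a countable union of null sets.
    · have : ∀ n : ℕ, ∀ᵐ x, x ∈ uIcc ((n : ℝ) + 1)⁻¹ (n + 1) →
          HasDerivAt (fun x => ∫ t in (1 : ℝ)..x, g t) (g x) x := fun n => by
        have hn : (0 : ℝ) < n + 1 := by positivity
        filter_upwards [(hi (inv_pos.mpr hn) hn).ae_hasDerivAt_integral] with x hx hxm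
        refine hx hxm 1 ?_
        have : (1 : ℝ) ≤ n + 1 := by linarith [(Nat.cast_nonneg n : (0 : ℝ) ≤ n)]
        rw [uIcc_of_le ((inv_le_one_of_one_le₀ this).trans this)]
        exact ⟨inv_le_one_of_one_le₀ this, this⟩
      filter_upwards [ae_all_iff.mpr this] with x hx hx0
      obtain ⟨n, hn⟩ := exists_nat_gt (max x x⁻¹)
      refine hx n ?_
      have h1 : x ≤ n + 1 := ((le_max_left _ _).trans hn.le).trans (by linarith)
      have h2 : x⁻¹ ≤ n + 1 := ((le_max_right _ _).trans hn.le).trans (by linarith)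
      have hn0 : ((n : ℝ) + 1)⁻¹ ≤ x := inv_le_of_inv_le₀ hx0 h2
      rw [uIcc_of_le (hn0.trans h1)]
      exact ⟨hn0, h1⟩
  have h0 : HasWeakDeriv (fun x => f x - ∫ t in (1 : ℝ)..x, g t) (fun _ => 0) := by
    have := h.add (hG.const_mul (-1))
    refine this.ae_congr (Eventually.of_forall fun x => ?_) (Eventually.of_forall fun x => ?_) <;>
      simp only [] <;> ring
  obtain ⟨c, hc⟩ := exists_ae_eq_const_of_hasWeakDeriv_zero h0
  refine ⟨c, ?_⟩
  filter_upwards [hc] with x hx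
  rw [← hx]
  ring
/-! ### Classical derivatives of locally Sobolev functions -/

/-- `f` is `n` times differentiable on `(0, ∞)`, and its `n`-th derivative is a continuous primitive
of a locally integrable function. -/
def IsIteratedPrimitive : ℕ → (ℝ → ℂ) → Prop
  | 0, f => ∃ g : ℝ → ℂ, LocallyIntegrableOn g (Ioi 0) ∧
      ∀ a > 0, ∀ b > 0, f b - f a = ∫ t in a..b, g t
  | n + 1, f => (∀ x > 0, DifferentiableAt ℝ f x) ∧ IsIteratedPrimitive n (deriv f)

theorem IsIteratedPrimitive.congr {n : ℕ} : ∀ {f g : ℝ → ℂ}, IsIteratedPrimitive n f →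
    EqOn f g (Ioi 0) → IsIteratedPrimitive n g := by
  induction n with
  | zero =>
    rintro f g ⟨k, hk, h⟩ e
    exact ⟨k, hk, fun a ha b hb => by rw [← h a ha b hb, e ha, e hb]⟩
  | succ n ih =>
    rintro f g ⟨h1, h2⟩ e
    have ee : ∀ x > 0, f =ᶠ[𝓝 x] g := fun x hx => e.eventuallyEq_of_mem (Ioi_mem_nhds hx)
    exact ⟨fun x hx => (ee x hx).differentiableAt_iff.mp (h1 x hx),
      ih h2 fun x hx => (ee x hx).deriv_eq⟩

theorem IsIteratedPrimitive.sub {n : ℕ} : ∀ {f g : ℝ → ℂ}, IsIteratedPrimitive n f →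
    IsIteratedPrimitive n g → IsIteratedPrimitive n (fun x => f x - g x) := by
  induction n with
  | zero =>
    rintro f g ⟨k, hk, h⟩ ⟨k', hk', h'⟩
    refine ⟨fun x => k x - k' x, hk.sub hk', fun a ha b hb => ?_⟩
    rw [intervalIntegral.integral_sub (intervalIntegrable_of_locallyIntegrableOn hk ha hb)
      (intervalIntegrable_of_locallyIntegrableOn hk' ha hb), ← h a ha b hb, ← h' a ha b hb]
    ring
  | succ n ih =>
    rintro f g ⟨h1, h2⟩ ⟨h1', h2'⟩
    exact ⟨fun x hx => (h1 x hx).sub (h1' x hx),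
      (ih h2 h2').congr fun x hx => (deriv_fun_sub (h1 x hx) (h1' x hx)).symm⟩

theorem HasWeakDeriv.exists_continuousOn_primitive {f g : ℝ → ℂ} (h : HasWeakDeriv f g) :
    ∃ F : ℝ → ℂ, ContinuousOn F (Ioi 0) ∧ f =ᵐ[volume.restrict (Ioi 0)] F ∧
      ∀ a > 0, ∀ b > 0, F b - F a = ∫ t in a..b, g t := by
  obtain ⟨c, hc⟩ := h.exists_ae_eq_primitive
  have hi : ∀ {a b : ℝ}, 0 < a → 0 < b → IntervalIntegrable g volume a b := fun ha hb =>
    intervalIntegrable_of_locallyIntegrableOn h.2.1 ha hb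
  refine ⟨_, ?_, hc, fun a ha b hb => ?_⟩
  · intro x hx
    have hx0 : (0 : ℝ) < x := hx
    have h1 : (0 : ℝ) < min 1 x / 2 := by positivity
    have h2 : (0 : ℝ) < max 1 x + 1 := by positivity
    have hle : min 1 x / 2 < min 1 x := by linarith
    have := intervalIntegral.continuousOn_primitive_interval' (hi h1 h2) (a := 1) (by
      rw [uIcc_of_le]
      · exact ⟨(hle.trans_le (min_le_left _ _)).le, by linarith [le_max_left 1 x]⟩
      · linarith [min_le_left 1 x, le_max_left 1 x])
    rw [uIcc_of_le (by linarith [min_le_left 1 x, le_max_left 1 x])] at this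
    exact (continuousAt_const.add (this.continuousAt (Icc_mem_nhds
      (hle.trans_le (min_le_right _ _)) (by linarith [le_max_right 1 x])))).continuousWithinAt
  · have := intervalIntegral.integral_add_adjacent_intervals (hi one_pos ha) (hi ha hb)
    rw [← this]
    ring

theorem eqOn_Ioi_of_ae_eq {f g : ℝ → ℂ} (hf : ContinuousOn f (Ioi 0))
    (hg : ContinuousOn g (Ioi 0)) (h : f =ᵐ[volume.restrict (Ioi 0)] g) : EqOn f g (Ioi 0) :=
  Measure.eqOn_open_of_ae_eq h isOpen_Ioi hf hg

/-- The first weak derivative has a continuous representative G. As f is a primitive of it, f is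
differentiable everywhere with derivative G, and G lies in the Sobolev space of order one less. -/
theorem MemW2loc.isIteratedPrimitive {n : ℕ} : ∀ {f : ℝ → ℂ}, MemW2loc (n + 1) f →
    IsIteratedPrimitive n f := by
  induction n with
  | zero =>
    rintro f ⟨hf, D, rfl, -, h⟩
    have h0 := h 0 (by omega)
    obtain ⟨F, hF, e, hp⟩ := h0.exists_continuousOn_primitive
    have e' := eqOn_Ioi_of_ae_eq hf hF e
    exact ⟨D 1, h0.2.1, fun a ha b hb => by rw [e' ha, e' hb, hp a ha b hb]⟩
  | succ n ih =>
    rintro f ⟨hf, D, rfl, hm, h⟩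
    have h0 := h 0 (by omega)
    obtain ⟨F, hF, e, hp⟩ := h0.exists_continuousOn_primitive
    have e' := eqOn_Ioi_of_ae_eq hf hF e
    have h1 := h 1 (by omega)
    obtain ⟨G, hG, eG, -⟩ := h1.exists_continuousOn_primitive
    have hd : ∀ x > 0, HasDerivAt (D 0) (G x) x := by
      intro x hx
      have hi : ∀ {b : ℝ}, 0 < b → (∫ t in x..b, G t) = ∫ t in x..b, D 1 t := fun {b} hb => by
        refine intervalIntegral.integral_congr_ae ?_
        rw [EventuallyEq, ae_restrict_iff' measurableSet_Ioi] at eG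
        filter_upwards [eG] with t ht htm
        exact (ht ((lt_min hx hb).trans htm.1)).symm
      have hGx : ContinuousAt G x := hG.continuousAt (Ioi_mem_nhds hx)
      have key : HasDerivAt (fun y => D 0 x + ∫ t in x..y, G t) (G x) x := by
        refine (intervalIntegral.integral_hasDerivAt_right ?_ ?_ hGx).const_add _
        · simp
        · exact hG.stronglyMeasurableAtFilter isOpen_Ioi x hx
      refine key.congr_of_eventuallyEq ?_
      filter_upwards [Ioi_mem_nhds hx] with y hy
      rw [hi hy, ← hp x hx y hy, e' hx, e' hy]
      ring
    -- The chain of weak derivatives of G is the shifted one, with D 1 replaced by its continuous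
    -- representative.
    have hW : MemW2loc (n + 1) G := by
      refine ⟨hG, fun k => if k = 0 then G else D (k + 1), by simp, fun k hk => ?_, fun k hk => ?_⟩
      · rcases Nat.eq_zero_or_pos k with rfl | hk0
        · intro K hK hK0
          have := hm 1 (by omega) K hK hK0
          simp only [if_true]
          exact this.ae_eq (ae_restrict_of_ae_restrict_of_subset hK0 eG)
        · simp only [hk0.ne', if_false]
          exact hm (k + 1) (by omega)
      · rcases Nat.eq_zero_or_pos k with rfl | hk0
        · simpa using h1.ae_congr eG (ae_eq_refl _)
        · simpa [hk0.ne'] using h (k + 1) (by omega)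
    exact ⟨fun x hx => (hd x hx).differentiableAt,
      (ih hW).congr fun x hx => (hd x hx).deriv.symm⟩

/-! ### Symbol estimates on an interval -/

/-- On the set `U`, the function `f` is `n` times differentiable, `‖f^(j)‖ ≤ M μ ^ j` for `j ≤ n`,
and `f^(n)` is Lipschitz with constant `M μ ^ (n + 1)`. -/
def SymbolOn (U : Set ℝ) (μ : ℝ) : ℕ → ℝ → (ℝ → ℂ) → Prop
  | 0, M, f => (∀ x ∈ U, ‖f x‖ ≤ M) ∧ ∀ x ∈ U, ∀ y ∈ U, ‖f y - f x‖ ≤ M * μ * |y - x|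
  | n + 1, M, f => (∀ x ∈ U, ‖f x‖ ≤ M) ∧ (∀ x ∈ U, DifferentiableAt ℝ f x) ∧
      SymbolOn U μ n (M * μ) (deriv f)

namespace SymbolOn

variable {U : Set ℝ} {μ : ℝ} {n : ℕ} {M M' : ℝ} {f g : ℝ → ℂ}

theorem norm_le (h : SymbolOn U μ n M f) {x : ℝ} (hx : x ∈ U) : ‖f x‖ ≤ M := by
  cases n with
  | zero => exact h.1 x hx
  | succ n => exact h.1 x hx

theorem mono (hμ : 0 ≤ μ) (h : SymbolOn U μ n M f) (hM : M ≤ M') : SymbolOn U μ n M' f := by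
  induction n generalizing f M M' with
  | zero => exact ⟨fun x hx => (h.1 x hx).trans hM, fun x hx y hy =>
      (h.2 x hx y hy).trans (by gcongr)⟩
  | succ n ih => exact ⟨fun x hx => (h.1 x hx).trans hM, h.2.1, ih h.2.2 (by gcongr)⟩

theorem congr (hU : IsOpen U) (h : SymbolOn U μ n M f) (e : EqOn f g U) : SymbolOn U μ n M g := by
  induction n generalizing f g M with
  | zero => exact ⟨fun x hx => by rw [← e hx]; exact h.1 x hx,
      fun x hx y hy => by rw [← e hx, ← e hy]; exact h.2 x hx y hy⟩
  | succ n ih =>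
    have ee : ∀ x ∈ U, f =ᶠ[𝓝 x] g := fun x hx => e.eventuallyEq_of_mem (hU.mem_nhds hx)
    exact ⟨fun x hx => by rw [← e hx]; exact h.1 x hx,
      fun x hx => (ee x hx).differentiableAt_iff.mp (h.2.1 x hx),
      ih h.2.2 fun x hx => (ee x hx).deriv_eq⟩

theorem lipschitz (hc : Convex ℝ U) (h : SymbolOn U μ n M f) {x y : ℝ}
    (hx : x ∈ U) (hy : y ∈ U) : ‖f y - f x‖ ≤ M * μ * |y - x| := by
  cases n with
  | zero => exact h.2 x hx y hy
  | succ n =>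
    exact hc.norm_image_sub_le_of_norm_deriv_le (fun z hz => h.2.1 z hz)
      (fun z hz => h.2.2.norm_le hz) hx hy

theorem of_succ (hc : Convex ℝ U) (h : SymbolOn U μ (n + 1) M f) :
    SymbolOn U μ n M f := by
  induction n generalizing f M with
  | zero => exact ⟨h.1, fun x hx y hy => h.lipschitz hc hx hy⟩
  | succ n ih => exact ⟨h.1, h.2.1, ih h.2.2⟩

theorem of_le (hc : Convex ℝ U) {k : ℕ} (hk : k ≤ n) (h : SymbolOn U μ n M f) :
    SymbolOn U μ k M f := by
  induction n with
  | zero => rwa [Nat.le_zero.mp hk]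
  | succ n ih =>
    rcases hk.lt_or_eq with h' | rfl
    · exact ih (by omega) (h.of_succ hc)
    · exact h

theorem continuousOn (hc : Convex ℝ U) (h : SymbolOn U μ n M f) :
    ContinuousOn f U := by
  refine LipschitzOnWith.continuousOn (K := (M * μ).toNNReal) ?_
  refine LipschitzOnWith.of_dist_le_mul fun x hx y hy => ?_
  rw [dist_eq_norm, Real.dist_eq]
  exact (h.lipschitz hc hy hx).trans
    (mul_le_mul_of_nonneg_right (Real.le_coe_toNNReal _) (abs_nonneg _))

theorem add (h : SymbolOn U μ n M f) (h' : SymbolOn U μ n M' g) (hU : IsOpen U) :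
    SymbolOn U μ n (M + M') (fun x => f x + g x) := by
  induction n generalizing f g M M' with
  | zero =>
    refine ⟨fun x hx => (norm_add_le _ _).trans (add_le_add (h.1 x hx) (h'.1 x hx)),
      fun x hx y hy => ?_⟩
    have e : f y + g y - (f x + g x) = (f y - f x) + (g y - g x) := by ring
    rw [e]
    refine (norm_add_le _ _).trans ((add_le_add (h.2 x hx y hy) (h'.2 x hx y hy)).trans_eq ?_)
    ring
  | succ n ih =>
    refine ⟨fun x hx => (norm_add_le _ _).trans (add_le_add (h.1 x hx) (h'.1 x hx)),
      fun x hx => (h.2.1 x hx).add (h'.2.1 x hx), ?_⟩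
    rw [add_mul]
    exact (ih h.2.2 h'.2.2).congr hU fun x hx =>
      (deriv_fun_add (h.2.1 x hx) (h'.2.1 x hx)).symm

theorem const_mul (h : SymbolOn U μ n M f) (c : ℂ) :
    SymbolOn U μ n (‖c‖ * M) (fun x => c * f x) := by
  induction n generalizing f M with
  | zero =>
    refine ⟨fun x hx => ?_, fun x hx y hy => ?_⟩
    · rw [norm_mul]
      exact mul_le_mul_of_nonneg_left (h.1 x hx) (norm_nonneg _)
    · rw [← mul_sub, norm_mul, mul_assoc, mul_assoc]
      refine mul_le_mul_of_nonneg_left ?_ (norm_nonneg _)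
      rw [← mul_assoc]
      exact h.2 x hx y hy
  | succ n ih =>
    refine ⟨fun x hx => ?_, fun x hx => (h.2.1 x hx).const_mul c, ?_⟩
    · rw [norm_mul]
      exact mul_le_mul_of_nonneg_left (h.1 x hx) (norm_nonneg _)
    · rw [deriv_const_mul_field' c, mul_assoc]
      exact ih h.2.2

theorem neg (h : SymbolOn U μ n M f) : SymbolOn U μ n M (fun x => -f x) := by
  simpa using h.const_mul (-1)

theorem sub (h : SymbolOn U μ n M f) (h' : SymbolOn U μ n M' g) (hU : IsOpen U) :
    SymbolOn U μ n (M + M') (fun x => f x - g x) := by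
  simpa only [sub_eq_add_neg] using h.add h'.neg hU

theorem zero (hμ : 0 ≤ μ) (hM : 0 ≤ M) : SymbolOn U μ n M (fun _ => 0) := by
  induction n generalizing M with
  | zero => exact ⟨fun _ _ => by simpa, fun x _ y _ => by
      simp only [sub_zero, norm_zero]; positivity⟩
  | succ n ih =>
    refine ⟨fun _ _ => by simpa, fun _ _ => differentiableAt_const _, ?_⟩
    rw [deriv_const']
    exact ih (by positivity)

theorem sum {ι : Type*} (s : Finset ι) {M : ι → ℝ} {f : ι → ℝ → ℂ} (hU : IsOpen U) (hμ : 0 ≤ μ)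
    (h : ∀ i ∈ s, SymbolOn U μ n (M i) (f i)) :
    SymbolOn U μ n (∑ i ∈ s, M i) (fun x => ∑ i ∈ s, f i x) := by
  classical
  induction s using Finset.induction_on with
  | empty => simpa using zero hμ le_rfl
  | insert a s ha ih =>
    simp only [Finset.sum_insert ha]
    exact (h a (Finset.mem_insert_self _ _)).add
      (ih fun i hi => h i (Finset.mem_insert_of_mem hi)) hU

/-- Leibniz rule: every differentiation splits the product into two terms of the same type, which
accounts for the powers of 2. -/
theorem mul (h : SymbolOn U μ n M f) (h' : SymbolOn U μ n M' g) (hU : IsOpen U)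
    (hc : Convex ℝ U) (hM : 0 ≤ M) (hM' : 0 ≤ M') (hμ : 0 ≤ μ) :
    SymbolOn U μ n (2 ^ (n + 1) * (M * M')) (fun x => f x * g x) := by
  have hb : ∀ k : ℕ, ∀ x ∈ U, ‖f x * g x‖ ≤ 2 ^ (k + 1) * (M * M') := fun k x hx => by
    rw [norm_mul]
    have h1 : ‖f x‖ * ‖g x‖ ≤ M * M' :=
      mul_le_mul (h.norm_le hx) (h'.norm_le hx) (norm_nonneg _) hM
    have h2 : (1 : ℝ) ≤ 2 ^ (k + 1) := one_le_pow₀ (by norm_num)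
    nlinarith [mul_nonneg hM hM']
  induction n generalizing f g M M' with
  | zero =>
    refine ⟨hb 0, fun x hx y hy => ?_⟩
    have e : f y * g y - f x * g x = (f y - f x) * g y + f x * (g y - g x) := by ring
    rw [e]
    refine (norm_add_le _ _).trans ?_
    rw [norm_mul, norm_mul]
    have h1 := mul_le_mul (h.2 x hx y hy) (h'.1 y hy) (norm_nonneg _) (by positivity)
    have h2 := mul_le_mul (h.1 x hx) (h'.2 x hx y hy) (norm_nonneg _) hM
    calc _ ≤ _ := add_le_add h1 h2
      _ = _ := by ring
  | succ n ih =>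
    refine ⟨hb (n + 1), fun x hx => (h.2.1 x hx).mul (h'.2.1 x hx), ?_⟩
    have hb' : ∀ {M M' : ℝ} {f g : ℝ → ℂ}, SymbolOn U μ n M f → SymbolOn U μ n M' g → 0 ≤ M →
        0 ≤ M' → ∀ k : ℕ, ∀ x ∈ U, ‖f x * g x‖ ≤ 2 ^ (k + 1) * (M * M') := by
      intro M M' f g h h' hM hM' k x hx
      rw [norm_mul]
      have h1 : ‖f x‖ * ‖g x‖ ≤ M * M' :=
        mul_le_mul (h.norm_le hx) (h'.norm_le hx) (norm_nonneg _) hM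
      have h2 : (1 : ℝ) ≤ 2 ^ (k + 1) := one_le_pow₀ (by norm_num)
      nlinarith [mul_nonneg hM hM']
    have hMμ : 0 ≤ M * μ := by positivity
    have hMμ' : 0 ≤ M' * μ := by positivity
    have f0 := h.of_succ hc
    have g0 := h'.of_succ hc
    have h1 := ih h.2.2 g0 hMμ hM' (hb' h.2.2 g0 hMμ hM')
    have h2 := ih f0 h'.2.2 hM hMμ' (hb' f0 h'.2.2 hM hMμ')
    have h3 := (h1.add h2 hU).congr hU fun x hx =>
      (deriv_fun_mul (h.2.1 x hx) (h'.2.1 x hx)).symm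
    have e : 2 ^ (n + 1) * (M * μ * M') + 2 ^ (n + 1) * (M * (M' * μ)) =
      2 ^ (n + 1 + 1) * (M * M') * μ := by ring
    rwa [e] at h3

/-- A solution of `h' = h q` inherits the symbol estimates of the logarithmic derivative `q`. -/
theorem exists_of_hasDerivAt_mul (n : ℕ) (C : ℝ) (hC : 0 ≤ C) : ∃ C' : ℝ, 1 ≤ C' ∧
    ∀ {U : Set ℝ} {μ M : ℝ} {h q : ℝ → ℂ}, IsOpen U → Convex ℝ U → 0 ≤ μ → 0 ≤ M →
      SymbolOn U μ n (C * μ) q → (∀ x ∈ U, ‖h x‖ ≤ M) →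
      (∀ x ∈ U, HasDerivAt h (h x * q x) x) → SymbolOn U μ (n + 1) (C' * M) h := by
  -- Bootstrap in the order k, with q fixed at order n: control of h at order k controls the product
  -- h' = h q at order k, hence h at order k + 1.
  suffices H : ∀ k ≤ n + 1, ∃ C' : ℝ, 1 ≤ C' ∧
    ∀ {U : Set ℝ} {μ M : ℝ} {h q : ℝ → ℂ}, IsOpen U → Convex ℝ U → 0 ≤ μ → 0 ≤ M →
      SymbolOn U μ n (C * μ) q → (∀ x ∈ U, ‖h x‖ ≤ M) →
      (∀ x ∈ U, HasDerivAt h (h x * q x) x) → SymbolOn U μ k (C' * M) h from H _ le_rfl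
  intro k
  induction k with
  | zero =>
    intro _
    refine ⟨1 + C, by linarith, fun {U μ M h q} hU hc hμ hM hq hb hd => ⟨fun x hx => ?_, ?_⟩⟩
    · nlinarith [hb x hx]
    · intro x hx y hy
      have := hc.norm_image_sub_le_of_norm_hasDerivWithin_le (C := M * (C * μ))
        (fun z hz => (hd z hz).hasDerivWithinAt) (fun z hz => by
          rw [norm_mul]
          exact mul_le_mul (hb z hz) (hq.norm_le hz) (norm_nonneg _) hM) hx hy
      refine this.trans ?_
      rw [Real.norm_eq_abs]
      refine mul_le_mul_of_nonneg_right ?_ (abs_nonneg _)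
      nlinarith [mul_nonneg hM hμ]
  | succ k ih =>
    intro hk
    obtain ⟨C', hC', H⟩ := ih (by omega)
    refine ⟨1 + 2 ^ (k + 1) * (C' * C), by
      have : 0 ≤ 2 ^ (k + 1) * (C' * C) := by positivity
      linarith, fun {U μ M h q} hU hc hμ hM hq hb hd => ⟨fun x hx => ?_, fun x hx =>
        (hd x hx).differentiableAt, ?_⟩⟩
    · have : 0 ≤ 2 ^ (k + 1) * (C' * C) * M := by positivity
      linarith [hb x hx]
    · have h1 := H hU hc hμ hM hq hb hd
      have h2 := h1.mul (hq.of_le hc (by omega : k ≤ n)) hU hc (by positivity) (by positivity) hμ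
      refine (h2.mono (M' := (1 + 2 ^ (k + 1) * (C' * C)) * M * μ) hμ ?_).congr hU
        fun x hx => (hd x hx).deriv.symm
      nlinarith [mul_nonneg hM hμ]

/-- The reciprocal of a function bounded below, with symbol estimates for the derivative. -/
theorem exists_inv (n : ℕ) (C : ℝ) (hC : 0 ≤ C) : ∃ C' : ℝ, 1 ≤ C' ∧
    ∀ {U : Set ℝ} {μ r : ℝ} {f : ℝ → ℂ}, IsOpen U → Convex ℝ U → 0 ≤ μ → 0 < r →
      SymbolOn U μ n (C * r * μ) (deriv f) → (∀ x ∈ U, DifferentiableAt ℝ f x) →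
      (∀ x ∈ U, f x ≠ 0) → (∀ x ∈ U, ‖(f x)⁻¹‖ ≤ C / r) →
      SymbolOn U μ (n + 1) (C' / r) (fun x => (f x)⁻¹) := by
  have hd : ∀ {U : Set ℝ} {f : ℝ → ℂ}, (∀ x ∈ U, DifferentiableAt ℝ f x) →
      (∀ x ∈ U, f x ≠ 0) → ∀ x ∈ U, HasDerivAt (fun x => (f x)⁻¹)
        ((f x)⁻¹ * (deriv f x * -(f x)⁻¹)) x := by
    intro U f h h0 x hx
    convert! (h x hx).hasDerivAt.inv (h0 x hx) using 1
    field_simp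
  -- Same bootstrap, through (1/f)' = -(1/f) f' (1/f).
  suffices H : ∀ k ≤ n + 1, ∃ C' : ℝ, 1 ≤ C' ∧
    ∀ {U : Set ℝ} {μ r : ℝ} {f : ℝ → ℂ}, IsOpen U → Convex ℝ U → 0 ≤ μ → 0 < r →
      SymbolOn U μ n (C * r * μ) (deriv f) → (∀ x ∈ U, DifferentiableAt ℝ f x) →
      (∀ x ∈ U, f x ≠ 0) → (∀ x ∈ U, ‖(f x)⁻¹‖ ≤ C / r) →
      SymbolOn U μ k (C' / r) (fun x => (f x)⁻¹) from H _ le_rfl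
  intro k
  induction k with
  | zero =>
    intro _
    refine ⟨1 + C + C ^ 3, by nlinarith [pow_nonneg hC 3],
      fun {U μ r f} hU hc hμ hr hf hfd hf0 hb => ⟨fun x hx => (hb x hx).trans ?_, ?_⟩⟩
    · gcongr
      linarith [pow_nonneg hC 3]
    · intro x hx y hy
      have := hc.norm_image_sub_le_of_norm_hasDerivWithin_le (C := C / r * (C * r * μ * (C / r)))
        (fun z hz => (hd hfd hf0 z hz).hasDerivWithinAt) (fun z hz => by
          rw [norm_mul, norm_mul, norm_neg]
          have := hb z hz
          have := hf.norm_le hz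
          gcongr) hx hy
      refine this.trans ?_
      rw [Real.norm_eq_abs]
      refine mul_le_mul_of_nonneg_right ?_ (abs_nonneg _)
      have e : C / r * (C * r * μ * (C / r)) = C ^ 3 / r * μ := by field_simp
      rw [e]
      gcongr
      linarith
  | succ k ih =>
    intro hk
    obtain ⟨C', hC', H⟩ := ih (by omega)
    set K : ℝ := 2 ^ (k + 1) * (C' * (2 ^ (k + 1) * (C * C'))) with hK
    have hK0 : 0 ≤ K := by positivity
    refine ⟨1 + C + K, by linarith,
      fun {U μ r f} hU hc hμ hr hf hfd hf0 hb => ⟨fun x hx => (hb x hx).trans ?_, fun x hx =>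
        (hd hfd hf0 x hx).differentiableAt, ?_⟩⟩
    · gcongr
      linarith
    · have h1 := H hU hc hμ hr hf hfd hf0 hb
      have h2 := (hf.of_le hc (by omega : k ≤ n)).mul h1.neg hU hc (by positivity)
        (by positivity) hμ
      have h3 := h1.mul h2 hU hc (by positivity) (by positivity) hμ
      refine (h3.mono (M' := (1 + C + K) / r * μ) hμ ?_).congr hU
        fun x hx => (hd hfd hf0 x hx).deriv.symm
      have e : 2 ^ (k + 1) * (C' / r * (2 ^ (k + 1) * (C * r * μ * (C' / r)))) = K / r * μ := by
        rw [hK]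
        field_simp
      rw [e]
      gcongr
      linarith

end SymbolOn

/-- By continuity the set where the bound fails is open, and an open null set is empty. The
derivative bounds on the potential are assumed only almost everywhere, so this recovers pointwise
bounds below the top order. -/
theorem norm_le_of_ae_norm_le {U : Set ℝ} (hU : IsOpen U) {f : ℝ → ℂ} (hf : ContinuousOn f U)
    {M : ℝ} (h : ∀ᵐ x, x ∈ U → ‖f x‖ ≤ M) : ∀ x ∈ U, ‖f x‖ ≤ M := by
  have ho : IsOpen (U ∩ (fun x => ‖f x‖) ⁻¹' Ioi M) :=
    hf.norm.isOpen_inter_preimage hU isOpen_Ioi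
  have h0 : volume (U ∩ (fun x => ‖f x‖) ⁻¹' Ioi M) = 0 := by
    refine measure_mono_null (fun x hx => ?_) h
    exact fun h' => absurd (h' hx.1) (not_le.mpr hx.2)
  have he := (ho.measure_eq_zero_iff volume).mp h0
  intro x hx
  by_contra h'
  exact (he ▸ (⟨hx, not_le.mp h'⟩ : x ∈ U ∩ (fun x => ‖f x‖) ⁻¹' Ioi M) : x ∈ (∅ : Set ℝ))

theorem IsIteratedPrimitive.continuousOn {n : ℕ} {f : ℝ → ℂ} (h : IsIteratedPrimitive n f) :
    ContinuousOn f (Ioi 0) := by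
  cases n with
  | succ n => exact fun x hx => (h.1 x hx).continuousAt.continuousWithinAt
  | zero =>
    obtain ⟨g, hg, h⟩ := h
    intro x hx
    have hx0 : (0 : ℝ) < x := hx
    have h1 : (0 : ℝ) < x / 2 := by positivity
    have h2 : (0 : ℝ) < x + 1 := by positivity
    have := intervalIntegral.continuousOn_primitive_interval'
      (intervalIntegrable_of_locallyIntegrableOn hg h1 h2) (a := x) (by
        rw [uIcc_of_le (by linarith)]
        exact ⟨by linarith, by linarith⟩)
    rw [uIcc_of_le (by linarith)] at this
    have h3 := (continuousAt_const (y := f x)).add (this.continuousAt (Icc_mem_nhds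
      (by linarith : x / 2 < x) (by linarith)))
    refine (h3.congr ?_).continuousWithinAt
    filter_upwards [Ioi_mem_nhds hx0] with y hy
    rw [Pi.add_apply, ← h x hx0 y hy]
    ring

/-- Almost everywhere bounds for the derivatives of a locally Sobolev function give symbol
estimates. -/
theorem IsIteratedPrimitive.symbolOn {U : Set ℝ} (hU : IsOpen U) (hc : Convex ℝ U)
    (h0 : U ⊆ Ioi 0) {μ : ℝ} (n : ℕ) {f : ℝ → ℂ} {M : ℝ}
    (hf : IsIteratedPrimitive n f)
    (h : ∀ j ≤ n + 1, ∀ᵐ x, x ∈ U → ‖iteratedDeriv j f x‖ ≤ M * μ ^ j) : SymbolOn U μ n M f := by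
  have hb : ∀ x ∈ U, ‖f x‖ ≤ M :=
    norm_le_of_ae_norm_le hU (hf.continuousOn.mono h0) (by simpa using h 0 (by omega))
  induction n generalizing f M with
  | zero =>
    refine ⟨hb, fun x hx y hy => ?_⟩
    obtain ⟨g, hg, H⟩ := hf
    rw [H x (h0 hx) y (h0 hy)]
    refine intervalIntegral.norm_integral_le_of_norm_le_const_ae ?_
    have h1 := (intervalIntegrable_of_locallyIntegrableOn hg (h0 hx)
      (h0 hy)).ae_hasDerivAt_integral
    -- Almost everywhere g is the derivative of f, so the bound on f' passes to g and integrates to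
    -- the Lipschitz constant.
    filter_upwards [h1, h 1 (by omega)] with t ht1 ht2 htm
    have htU : t ∈ U := hc.ordConnected.uIcc_subset hx hy (uIoc_subset_uIcc htm)
    have ht3 := ht1 (uIoc_subset_uIcc htm) x left_mem_uIcc
    have ht4 : HasDerivAt f (g t) t := by
      refine (ht3.const_add (f x)).congr_of_eventuallyEq ?_
      filter_upwards [Ioi_mem_nhds (h0 htU)] with z hz
      rw [← H x (h0 hx) z hz]
      ring
    have := ht2 htU
    rwa [iteratedDeriv_one, ht4.deriv, pow_one] at this
  | succ n ih =>
    have hd : ∀ j ≤ n + 1, ∀ᵐ x, x ∈ U → ‖iteratedDeriv j (deriv f) x‖ ≤ M * μ * μ ^ j := by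
      intro j hj
      filter_upwards [h (j + 1) (by omega)] with x hx hxU
      rw [iteratedDeriv_succ'] at hx
      exact (hx hxU).trans_eq (by ring)
    exact ⟨hb, fun x hx => hf.1 x (h0 hx), ih hf.2 hd (norm_le_of_ae_norm_le hU
      (hf.2.continuousOn.mono h0) (by simpa using hd 0 (by omega)))⟩

/-! ### Symbol estimates for the solutions of the transport equations -/

/-- The weights μ^(k+1)/r^k are consistent with the recursion: a derivative or a factor κ costs μ,
division by p_0 costs 1/r, and each product p_{j+1} p_{k-j} has weight μ^(k+1)/r^(k-1). Each step
consumes one derivative, whence the constraint k + i ≤ n. The term p_1 is an input, because p_0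
itself is not assumed to be of size r. -/
theorem SymbolOn.exists_transport (n : ℕ) (C₀ : ℝ) (hC₀ : 0 ≤ C₀) : ∃ C : ℝ, 1 ≤ C ∧
    ∀ {U : Set ℝ} {μ r : ℝ} {p : ℕ → ℝ → ℂ} {κ : ℝ → ℂ}, IsOpen U → Convex ℝ U → 0 ≤ μ → 0 < r →
      SymbolOn U μ n (C₀ / r) (fun x => (p 0 x)⁻¹) → SymbolOn U μ n (C₀ * μ) κ →
      SymbolOn U μ n (C₀ * μ) (p 1) →
      (∀ k, 1 ≤ k → k ≤ n → ∀ x ∈ U, p (k + 1) x = 1 / 2 * ((p 0 x)⁻¹ *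
        (deriv (p k) x + κ x * p k x - ∑ j ∈ Finset.range k, p (j + 1) x * p (k - j) x))) →
      ∀ k i, k + i ≤ n → SymbolOn U μ i (C * (μ ^ (k + 1) / r ^ k)) (p (k + 1)) := by
  suffices H : ∀ K ≤ n, ∃ C : ℝ, 1 ≤ C ∧
    ∀ {U : Set ℝ} {μ r : ℝ} {p : ℕ → ℝ → ℂ} {κ : ℝ → ℂ}, IsOpen U → Convex ℝ U → 0 ≤ μ → 0 < r →
      SymbolOn U μ n (C₀ / r) (fun x => (p 0 x)⁻¹) → SymbolOn U μ n (C₀ * μ) κ →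
      SymbolOn U μ n (C₀ * μ) (p 1) →
      (∀ k, 1 ≤ k → k ≤ n → ∀ x ∈ U, p (k + 1) x = 1 / 2 * ((p 0 x)⁻¹ *
        (deriv (p k) x + κ x * p k x - ∑ j ∈ Finset.range k, p (j + 1) x * p (k - j) x))) →
      ∀ k ≤ K, ∀ i, k + i ≤ n → SymbolOn U μ i (C * (μ ^ (k + 1) / r ^ k)) (p (k + 1)) by
    obtain ⟨C, h1, h2⟩ := H n le_rfl
    exact ⟨C, h1, fun a b c d e f g h k i hk => h2 a b c d e f g h k (by omega) i hk⟩
  intro K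
  induction K with
  | zero =>
    intro _
    refine ⟨1 + C₀, by linarith, fun {U μ r p κ} hU hc hμ hr h0 hκ h1 hrec k hk i hi => ?_⟩
    obtain rfl : k = 0 := by omega
    refine (h1.of_le hc (by omega : i ≤ n)).mono hμ ?_
    simp only [zero_add, pow_one, pow_zero, div_one]
    nlinarith
  | succ K ih =>
    intro hK
    obtain ⟨C, hC, H⟩ := ih (by omega)
    set L : ℝ := 1 / 2 * (2 ^ (n + 1) * (C₀ *
      (C + 2 ^ (n + 1) * (C₀ * C) + (K + 1) * (2 ^ (n + 1) * (C * C))))) with hL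
    have hL0 : 0 ≤ L := by positivity
    refine ⟨C + L, by linarith, fun {U μ r p κ} hU hc hμ hr h0 hκ h1 hrec k hk i hi => ?_⟩
    have IH := H hU hc hμ hr h0 hκ h1 hrec
    have hq : ∀ a b : ℕ, 0 ≤ μ ^ a / r ^ b := fun a b => by positivity
    rcases hk.lt_or_eq with hk' | rfl
    · refine (IH k (by omega) i hi).mono hμ ?_
      gcongr
      linarith
    have pK := IH K le_rfl (i + 1) (by omega)
    have t1 := pK.2.2
    have t2 := (hκ.of_le hc (by omega : i ≤ n)).mul (IH K le_rfl i (by omega)) hU hc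
      (by positivity) (by positivity) hμ
    have t3 := SymbolOn.sum (Finset.range (K + 1)) (U := U) (μ := μ) (n := i)
      (M := fun _ => 2 ^ (i + 1) * (C * C) * (μ ^ (K + 2) / r ^ K))
      (f := fun j x => p (j + 1) x * p (K + 1 - j) x) hU hμ (fun j hj => by
        have hj' : j ≤ K := by
          have := Finset.mem_range.mp hj
          omega
        have e : K + 1 - j = (K - j) + 1 := by omega
        rw [e]
        refine ((IH j hj' i (by omega)).mul (IH (K - j) (by omega) i (by omega)) hU hc
          (by positivity) (by positivity) hμ).mono hμ (le_of_eq ?_)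
        have e1 : μ ^ (K + 2) = μ ^ (j + 1) * μ ^ (K - j + 1) := by
          rw [← pow_add]
          congr 1
          omega
        have e2 : r ^ K = r ^ j * r ^ (K - j) := by
          rw [← pow_add]
          congr 1
          omega
        rw [e1, e2]
        field_simp)
    have t4 := (((h0.of_le hc (by omega : i ≤ n)).mul ((t1.add t2 hU).sub t3 hU) hU hc
      (by positivity) (by positivity) hμ).const_mul (1 / 2))
    refine (t4.congr hU fun x hx => (hrec (K + 1) (by omega) hK x hx).symm).mono hμ ?_
    have hpow : (2 : ℝ) ^ (i + 1) ≤ 2 ^ (n + 1) := pow_le_pow_right₀ (by norm_num) (by omega)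
    have e2 : ‖(1 / 2 : ℂ)‖ = 1 / 2 := by norm_num
    rw [e2, Finset.sum_const, Finset.card_range, nsmul_eq_mul]
    push_cast
    have q0 := hq (K + 2) (K + 1)
    calc _ = 1 / 2 * (2 ^ (i + 1) * (C₀ * (C + 2 ^ (i + 1) * (C₀ * C) +
            (K + 1) * (2 ^ (i + 1) * (C * C))))) * (μ ^ (K + 2) / r ^ (K + 1)) := by
          field_simp
          ring
      _ ≤ L * (μ ^ (K + 2) / r ^ (K + 1)) := by
          rw [hL]
          gcongr
      _ ≤ _ := by
          gcongr
          linarith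

/-- Symbol estimates for `p_k`, starting from estimates for the two factors `A`, `B` of `V_λ`. -/
theorem exists_symbolOn_transport (n : ℕ) (C₀ : ℝ) (hC₀ : 0 ≤ C₀) : ∃ C : ℝ, 1 ≤ C ∧
    ∀ {U : Set ℝ} {μ r : ℝ} {p : ℕ → ℝ → ℂ} {κ A B D : ℝ → ℂ}, IsOpen U → Convex ℝ U →
      0 ≤ μ → 0 < r →
      (∀ x ∈ U, DifferentiableAt ℝ A x) → (∀ x ∈ U, DifferentiableAt ℝ B x) →
      SymbolOn U μ n (C₀ * r * μ) (deriv A) → SymbolOn U μ n (C₀ * r * μ) (deriv B) →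
      SymbolOn U μ n (C₀ * μ) D →
      (∀ x ∈ U, A x ≠ 0 ∧ ‖(A x)⁻¹‖ ≤ C₀ / r) → (∀ x ∈ U, B x ≠ 0 ∧ ‖(B x)⁻¹‖ ≤ C₀ / r) →
      (∀ x ∈ U, p 0 x ^ 2 = -(A x * B x)) →
      (∀ x ∈ U, HasDerivAt (p 0)
        (p 0 x * (1 / 2 * (deriv A x * (A x)⁻¹ + deriv B x * (B x)⁻¹))) x) →
      (∀ x ∈ U, κ x = -Complex.I * D x - deriv B x * (B x)⁻¹) →
      (∀ k, k ≤ n → ∀ x ∈ U, p (k + 1) x = 1 / 2 * ((p 0 x)⁻¹ *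
        (deriv (p k) x + κ x * p k x - ∑ j ∈ Finset.range k, p (j + 1) x * p (k - j) x))) →
      SymbolOn U μ n (C * μ) κ ∧
      ∀ k i, k + i ≤ n → SymbolOn U μ i (C * (μ ^ (k + 1) / r ^ k)) (p (k + 1)) := by
  obtain ⟨C₁, hC₁, H1⟩ := SymbolOn.exists_inv n C₀ hC₀
  set C₂ : ℝ := 2 ^ (n + 1) * (C₀ * C₁) with hC₂
  have hC₂0 : 0 ≤ C₂ := by positivity
  obtain ⟨C₃, hC₃, H3⟩ := SymbolOn.exists_of_hasDerivAt_mul n C₂ hC₂0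
  set C₄ : ℝ := C₀ + C₂ + C₃ * C₀ with hC₄
  have hC₄0 : 0 ≤ C₄ := by positivity
  obtain ⟨C₅, hC₅, H5⟩ := SymbolOn.exists_transport n C₄ hC₄0
  refine ⟨C₄ + C₅, by linarith, fun {U μ r p κ A B D} hU hc hμ hr hA hB hA' hB' hD hA0 hB0 hp
    hp' hκ hrec => ?_⟩
  have iA := H1 hU hc hμ hr hA' hA (fun x hx => (hA0 x hx).1) fun x hx => (hA0 x hx).2
  have iB := H1 hU hc hμ hr hB' hB (fun x hx => (hB0 x hx).1) fun x hx => (hB0 x hx).2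
  have eC : 2 ^ (n + 1) * (C₀ * r * μ * (C₁ / r)) = C₂ * μ := by
    rw [hC₂]
    field_simp
  have qA := hA'.mul (iA.of_succ hc) hU hc (by positivity) (by positivity) hμ
  have qB := hB'.mul (iB.of_succ hc) hU hc (by positivity) (by positivity) hμ
  rw [eC] at qA qB
  have hn : ‖(1 / 2 : ℂ)‖ = 1 / 2 := by norm_num
  have q0 := (qA.add qB hU).const_mul (1 / 2)
  have e0 : 1 / 2 * (C₂ * μ + C₂ * μ) = C₂ * μ := by ring
  rw [hn, e0] at q0
  have hp0 : ∀ x ∈ U, p 0 x ≠ 0 := fun x hx h => by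
    have := hp x hx
    rw [h] at this
    have h' := mul_ne_zero (hA0 x hx).1 (hB0 x hx).1
    apply h'
    linear_combination this
  -- Only the lower bound for p_0 is of order r; it is the geometric mean of the lower bounds for A
  -- and B.
  have bp : ∀ x ∈ U, ‖(p 0 x)⁻¹‖ ≤ C₀ / r := fun x hx => by
    have h2 : ‖(p 0 x)⁻¹‖ ^ 2 = ‖(A x)⁻¹‖ * ‖(B x)⁻¹‖ := by
      rw [← norm_pow, inv_pow, hp x hx, inv_neg, norm_neg, mul_inv, norm_mul]
    refine abs_le_of_sq_le_sq' ?_ (by positivity) |>.2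
    rw [h2, sq]
    exact mul_le_mul (hA0 x hx).2 (hB0 x hx).2 (norm_nonneg _) (by positivity)
  have ip : SymbolOn U μ (n + 1) (C₃ * (C₀ / r)) (fun x => (p 0 x)⁻¹) := by
    refine H3 (q := fun x => -(1 / 2 * (deriv A x * (A x)⁻¹ + deriv B x * (B x)⁻¹))) hU hc hμ
      (by positivity) q0.neg bp fun x hx => ?_
    convert! (hp' x hx).inv (hp0 x hx) using 1
    have := hp0 x hx
    field_simp
  have hκs : SymbolOn U μ n (C₄ * μ) κ := by
    have := ((hD.const_mul (-Complex.I)).sub qB hU).congr hU fun x hx => (hκ x hx).symm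
    refine this.mono hμ ?_
    rw [norm_neg, Complex.norm_I, one_mul, hC₄, add_mul, add_mul]
    have : 0 ≤ C₃ * C₀ * μ := by positivity
    linarith
  -- Here p_1 = (p_0'/p_0 + κ)/2 sees p_0 only through its logarithmic derivative, so no upper bound
  -- on p_0 enters.
  have h1 : SymbolOn U μ n (C₄ * μ) (p 1) := by
    have h1 := ((q0.add ((hD.const_mul (-Complex.I)).sub qB hU) hU).const_mul (1 / 2)).congr
      (g := p 1) hU fun x hx => by
        have h0 := hp0 x hx
        have := hrec 0 (Nat.zero_le _) x hx
        rw [zero_add, (hp' x hx).deriv, hκ x hx, Finset.range_zero, Finset.sum_empty] at this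
        rw [this]
        field_simp
        ring
    refine h1.mono hμ ?_
    rw [hn, norm_neg, Complex.norm_I, one_mul, hC₄]
    have : 0 ≤ C₃ * C₀ * μ := by positivity
    have : 0 ≤ C₀ * μ := by positivity
    nlinarith
  refine ⟨hκs.mono hμ (by gcongr; linarith), fun k i hk => ?_⟩
  refine (H5 hU hc hμ hr ((ip.of_succ hc).mono hμ ?_) hκs h1
    (fun k _ hk x hx => hrec k hk x hx) k i hk).mono hμ ?_
  · rw [hC₄, ← mul_div_assoc]
    gcongr
    linarith
  · gcongr
    linarith

/-! ### The remainder of the WKB expansion -/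

/-- Expand the square as p_0² + 2p_0 Q + Q². The recursion for k ≤ n replaces 2p_0 Q by the
derivative and κ terms up to index n minus all products with i + j < n. What survives is the part of
Q² with i + j ≥ n and the contributions of the last index n + 1. -/
theorem wkb_remainder_eq (n : ℕ) (p d : ℕ → ℂ) (κ W : ℂ) (h0 : p 0 ^ 2 = -W)
    (hrec : ∀ k ≤ n, 2 * p 0 * p (k + 1) =
      d k + κ * p k - ∑ j ∈ Finset.range k, p (j + 1) * p (k - j)) :
    (∑ k ∈ Finset.range (n + 2), p k) ^ 2 + W - ∑ k ∈ Finset.range (n + 2), d k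
        - κ * ∑ k ∈ Finset.range (n + 2), p k =
      (∑ i ∈ Finset.range (n + 1), ∑ j ∈ Finset.Ico (n - i) (n + 1), p (i + 1) * p (j + 1))
        - d (n + 1) - κ * p (n + 1) := by
  set Q := ∑ i ∈ Finset.range (n + 1), p (i + 1) with hQ
  have hS : ∑ k ∈ Finset.range (n + 2), p k = p 0 + Q := by
    rw [Finset.sum_range_succ', add_comm]
  have hS' : ∑ k ∈ Finset.range (n + 2), p k = ∑ k ∈ Finset.range (n + 1), p k + p (n + 1) :=
    Finset.sum_range_succ _ _
  have hd : ∑ k ∈ Finset.range (n + 2), d k = ∑ k ∈ Finset.range (n + 1), d k + d (n + 1) :=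
    Finset.sum_range_succ _ _
  have h1 : 2 * p 0 * Q = ∑ k ∈ Finset.range (n + 1), d k + κ * ∑ k ∈ Finset.range (n + 1), p k
      - ∑ k ∈ Finset.range (n + 1), ∑ j ∈ Finset.range k, p (j + 1) * p (k - j) := by
    rw [hQ, Finset.mul_sum, Finset.mul_sum, ← Finset.sum_add_distrib, ← Finset.sum_sub_distrib]
    exact Finset.sum_congr rfl fun k hk => hrec k (by
      have := Finset.mem_range.mp hk
      omega)
  have h2 : ∑ k ∈ Finset.range (n + 1), ∑ j ∈ Finset.range k, p (j + 1) * p (k - j) =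
      ∑ i ∈ Finset.range (n + 1), ∑ j ∈ Finset.range (n - i), p (i + 1) * p (j + 1) := by
    rw [Finset.sum_range_succ' _ n, Finset.range_zero, Finset.sum_empty, add_zero,
      Finset.sum_range_succ _ n, Nat.sub_self, Finset.range_zero, Finset.sum_empty, add_zero,
      ← Finset.sum_range_diag_flip n fun i j => p (i + 1) * p (j + 1)]
    refine Finset.sum_congr rfl fun k _ => Finset.sum_congr rfl fun j hj => ?_
    have := Finset.mem_range.mp hj
    congr 2
    omega
  have h3 : Q ^ 2 =
      (∑ i ∈ Finset.range (n + 1), ∑ j ∈ Finset.range (n - i), p (i + 1) * p (j + 1)) +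
      ∑ i ∈ Finset.range (n + 1), ∑ j ∈ Finset.Ico (n - i) (n + 1), p (i + 1) * p (j + 1) := by
    rw [sq, hQ, Finset.sum_mul_sum, ← Finset.sum_add_distrib]
    refine Finset.sum_congr rfl fun i _ => ?_
    exact (Finset.sum_range_add_sum_Ico (fun j => p (i + 1) * p (j + 1)) (by omega)).symm
  rw [hd]
  have e : (p 0 + Q) ^ 2 = p 0 ^ 2 + 2 * p 0 * Q + Q ^ 2 := by ring
  have e2 : κ * ∑ k ∈ Finset.range (n + 2), p k =
      κ * ∑ k ∈ Finset.range (n + 1), p k + κ * p (n + 1) := by rw [hS', mul_add]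
  rw [e2, hS, e, h0, h1, h2, h3]
  ring

/-- Every surviving term is of size μ^(n+l+2)/r^(n+l) for some 0 ≤ l ≤ n, which is r times one
summand of the σ-sum. The extra factor r is later absorbed by 1/B. -/
theorem norm_wkb_remainder_le (n : ℕ) {C μ r : ℝ} (hC : 0 ≤ C) (hμ : 0 ≤ μ) (hr : 0 < r)
    (p : ℕ → ℂ) (d κ : ℂ) (hp : ∀ k ≤ n, ‖p (k + 1)‖ ≤ C * (μ ^ (k + 1) / r ^ k))
    (hd : ‖d‖ ≤ C * (μ ^ (n + 2) / r ^ n)) (hκ : ‖κ‖ ≤ C * μ) :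
    ‖(∑ i ∈ Finset.range (n + 1), ∑ j ∈ Finset.Ico (n - i) (n + 1), p (i + 1) * p (j + 1))
        - d - κ * p (n + 1)‖ ≤ ((n + 1) ^ 2 * C ^ 2 + C + C ^ 2) * (r *
      ∑ i ∈ Finset.range (n + 1), μ ^ (n + 1 + i + 1) / r ^ (n + 1 + i)) := by
  set σ := ∑ i ∈ Finset.range (n + 1), μ ^ (n + 1 + i + 1) / r ^ (n + 1 + i) with hσ
  have hσ0 : 0 ≤ σ := Finset.sum_nonneg fun i _ => by positivity
  have key : ∀ l ≤ n, μ ^ (n + l + 2) / r ^ (n + l) ≤ r * σ := by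
    intro l hl
    have h1 : μ ^ (n + 1 + l + 1) / r ^ (n + 1 + l) ≤ σ :=
      Finset.single_le_sum (f := fun i => μ ^ (n + 1 + i + 1) / r ^ (n + 1 + i))
        (fun i _ => by positivity) (Finset.mem_range.mpr (by omega))
    have e : μ ^ (n + l + 2) / r ^ (n + l) = r * (μ ^ (n + 1 + l + 1) / r ^ (n + 1 + l)) := by
      rw [show n + 1 + l + 1 = n + l + 2 by ring, show n + 1 + l = (n + l) + 1 by ring, pow_succ r]
      field_simp
    rw [e]
    gcongr
  have k0 : μ ^ (n + 2) / r ^ n ≤ r * σ := key 0 (Nat.zero_le _)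
  have h1 : ‖∑ i ∈ Finset.range (n + 1), ∑ j ∈ Finset.Ico (n - i) (n + 1),
      p (i + 1) * p (j + 1)‖ ≤ (n + 1) ^ 2 * C ^ 2 * (r * σ) := by
    calc _ ≤ ∑ i ∈ Finset.range (n + 1), ∑ _j ∈ Finset.range (n + 1), C ^ 2 * (r * σ) := by
          refine (norm_sum_le _ _).trans (Finset.sum_le_sum fun i hi => ?_)
          refine ((norm_sum_le _ _).trans (Finset.sum_le_sum fun j hj => ?_)).trans
            (Finset.sum_le_sum_of_subset_of_nonneg
              (fun j hj => Finset.mem_range.mpr (Finset.mem_Ico.mp hj).2)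
              fun j _ _ => by positivity)
          have hi' := Finset.mem_range.mp hi
          have hj' := Finset.mem_Ico.mp hj
          rw [norm_mul]
          refine (mul_le_mul (hp i (by omega)) (hp j (by omega)) (norm_nonneg _)
            (by positivity)).trans ?_
          obtain ⟨l, hl⟩ : ∃ l, i + j = n + l := ⟨i + j - n, by omega⟩
          have := key l (by omega)
          rw [← hl] at this
          calc C * (μ ^ (i + 1) / r ^ i) * (C * (μ ^ (j + 1) / r ^ j))
              = C ^ 2 * (μ ^ (i + j + 2) / r ^ (i + j)) := by
                rw [show i + j + 2 = (i + 1) + (j + 1) by ring, pow_add, pow_add r]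
                field_simp
                ring
            _ ≤ _ := by gcongr
      _ = _ := by
          rw [Finset.sum_const, Finset.sum_const, Finset.card_range, nsmul_eq_mul, nsmul_eq_mul]
          push_cast
          ring
  have h2 : ‖d‖ ≤ C * (r * σ) := hd.trans (by gcongr)
  have h3 : ‖κ * p (n + 1)‖ ≤ C ^ 2 * (r * σ) := by
    rw [norm_mul]
    calc _ ≤ C * μ * (C * (μ ^ (n + 1) / r ^ n)) :=
          mul_le_mul hκ (hp n le_rfl) (norm_nonneg _) (by positivity)
      _ = C ^ 2 * (μ ^ (n + 2) / r ^ n) := by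
          rw [pow_succ μ (n + 1)]
          ring
      _ ≤ _ := by gcongr
  calc _ ≤ _ := (norm_sub_le _ _).trans (add_le_add ((norm_sub_le _ _).trans
        (add_le_add h1 h2)) h3)
    _ = _ := by ring

/-! ### The derivatives of the phase -/

section PhaseDeriv

variable (m : ℝ) (V : ℝ → Matrix (Fin 2) (Fin 2) ℂ) (xb : ℝ) (lam : ℂ)

/-- `λ^{1-k} ψ_{k-1}'`, the `k`-th summand of the derivative of the phase. -/
noncomputable def phaseDeriv (s : ℂ) (k : ℕ) (x : ℝ) : ℂ :=
  lam ^ (1 - (k : ℤ)) * psi m V xb lam s k x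

/-- The logarithmic derivative of `K_λ`. -/
noncomputable def logDerivK (x : ℝ) : ℂ := deriv (Klam m V xb lam) x / Klam m V xb lam x

/-- `λ - m - V₁₁`. -/
def factorA (x : ℝ) : ℂ := lam - m - V x 0 0

/-- `λ + m - V₂₂`. -/
def factorB (x : ℝ) : ℂ := lam + m - V x 1 1

variable {m V xb lam}

theorem phaseDeriv_zero (hl : lam ≠ 0) (s : ℂ) (x : ℝ) : phaseDeriv m V xb lam s 0 x =
    s * Complex.I * (factorA m V lam x * factorB m V lam x) ^ (1 / 2 : ℂ) := by
  have h : psi m V xb lam s 0 x = s * Complex.I * lam⁻¹ * Vlam m V lam x ^ (1 / 2 : ℂ) := by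
    rw [psi]
  rw [phaseDeriv, h, factorA, factorB, ← Vlam]
  simp only [Nat.cast_zero, sub_zero, zpow_one]
  field_simp

/-- The powers of λ balance, since (1 - (j+1)) + (1 - (k-j)) = 1 - k. The rescaled terms thus obey a
recursion in which λ no longer appears explicitly. -/
theorem phaseDeriv_succ (hl : lam ≠ 0) (s : ℂ) (k : ℕ) (x : ℝ) :
    phaseDeriv m V xb lam s (k + 1) x = 1 / 2 * ((phaseDeriv m V xb lam s 0 x)⁻¹ *
      (deriv (phaseDeriv m V xb lam s k) x + logDerivK m V xb lam x * phaseDeriv m V xb lam s k x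
        - ∑ j ∈ Finset.range k, phaseDeriv m V xb lam s (j + 1) x *
          phaseDeriv m V xb lam s (k - j) x)) := by
  have hd : deriv (phaseDeriv m V xb lam s k) x =
      lam ^ (1 - (k : ℤ)) * deriv (psi m V xb lam s k) x := by
    unfold phaseDeriv
    rw [deriv_const_mul_field]
  have hs : ∑ j ∈ Finset.range k, phaseDeriv m V xb lam s (j + 1) x *
      phaseDeriv m V xb lam s (k - j) x =
      lam ^ (1 - (k : ℤ)) * ∑ j : Fin k, psi m V xb lam s (j + 1) x * psi m V xb lam s (k - j) x := by
    rw [Finset.mul_sum, Finset.sum_range]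
    refine Finset.sum_congr rfl fun j _ => ?_
    have hj := j.2
    have e : lam ^ (1 - (k : ℤ)) =
        lam ^ (1 - ((j + 1 : ℕ) : ℤ)) * lam ^ (1 - ((k - j : ℕ) : ℤ)) := by
      rw [← zpow_add₀ hl]
      congr 1
      push_cast [Nat.cast_sub hj.le]
      ring
    rw [e, phaseDeriv, phaseDeriv]
    ring
  rw [hd, hs, logDerivK]
  have e1 : phaseDeriv m V xb lam s (k + 1) x = lam ^ (-(k : ℤ)) * psi m V xb lam s (k + 1) x := by
    rw [phaseDeriv]
    congr 2
    push_cast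
    ring
  have e0 : phaseDeriv m V xb lam s 0 x = lam * psi m V xb lam s 0 x := by
    rw [phaseDeriv]
    simp
  have e2 : lam ^ (1 - (k : ℤ)) = lam * lam ^ (-(k : ℤ)) := by
    rw [sub_eq_add_neg, zpow_add₀ hl, zpow_one]
  have e3 : psi m V xb lam s (k + 1) x = 1 / (2 * psi m V xb lam s 0 x) *
      (deriv (psi m V xb lam s k) x + deriv (Klam m V xb lam) x / Klam m V xb lam x *
        psi m V xb lam s k x
        - ∑ j : Fin k, psi m V xb lam s (j + 1) x * psi m V xb lam s (k - j) x) := by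
    conv_lhs => rw [psi]
  rw [e1, e0, e3, phaseDeriv, e2, mul_inv]
  field_simp

theorem phase_eq (s : ℂ) (n : ℕ) (x : ℝ) : phase m V xb lam s n x =
    ∑ k ∈ Finset.range (n + 1), ∫ t in xb..x, phaseDeriv m V xb lam s k t := rfl

end PhaseDeriv

/-- The assumptions on the potential and on `λ` in a neighbourhood `U` of the window around the
turning point, with quantitative bounds. -/
structure WindowData (m : ℝ) (V : ℝ → Matrix (Fin 2) (Fin 2) ℂ) (xb : ℝ) (lam s : ℂ) (n : ℕ)
    (U : Set ℝ) (μ r C₀ : ℝ) : Prop where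
  isOpen : IsOpen U
  convex : Convex ℝ U
  subset : U ⊆ Ioi 0
  mem : xb ∈ U
  cont_01 : ContinuousOn (fun x => V x 0 1) (Ioi 0)
  cont_10 : ContinuousOn (fun x => V x 1 0) (Ioi 0)
  cont_diag : ∀ i, ContinuousOn (fun x => V x i i) (Ioi 0)
  differentiableAt : ∀ i, ∀ x ∈ U, DifferentiableAt ℝ (fun x => V x i i) x
  symbol_diag : ∀ i, SymbolOn U μ n (C₀ * r * μ) (deriv fun x => V x i i)
  symbol_offDiag : SymbolOn U μ n (C₀ * μ) (fun x => V x 1 0 - V x 0 1)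
  mu_nonneg : 0 ≤ μ
  r_pos : 0 < r
  const_nonneg : 0 ≤ C₀
  sign : s = 1 ∨ s = -1
  lam_ne : lam ≠ 0
  im_eq : ∀ x ∈ U, (factorA m V lam x).im = (factorB m V lam x).im
  re_A : ∀ x ∈ U, r ≤ C₀ * (s * factorA m V lam x).re
  re_B : ∀ x ∈ U, r ≤ C₀ * (s * factorB m V lam x).re

namespace WindowData

variable {m : ℝ} {V : ℝ → Matrix (Fin 2) (Fin 2) ℂ} {xb : ℝ} {lam s : ℂ} {n : ℕ}
    {U : Set ℝ} {μ r C₀ : ℝ} (W : WindowData m V xb lam s n U μ r C₀)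

include W

theorem norm_sign : ‖s‖ = 1 := by
  rcases W.sign with h | h <;> rw [h] <;> simp

theorem sign_sq : s ^ 2 = 1 := by
  rcases W.sign with h | h <;> rw [h] <;> simp

theorem const_pos : 0 < C₀ := by
  by_contra h
  have h0 : C₀ = 0 := le_antisymm (not_lt.mp h) W.const_nonneg
  have := W.re_A xb W.mem
  rw [h0, zero_mul] at this
  exact absurd W.r_pos (not_lt.mpr this)

theorem re_A_pos {x : ℝ} (hx : x ∈ U) : 0 < (s * factorA m V lam x).re := by
  by_contra h
  have := W.re_A x hx
  nlinarith [W.r_pos, W.const_nonneg]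

theorem re_B_pos {x : ℝ} (hx : x ∈ U) : 0 < (s * factorB m V lam x).re := by
  by_contra h
  have := W.re_B x hx
  nlinarith [W.r_pos, W.const_nonneg]

theorem norm_A_ge {x : ℝ} (hx : x ∈ U) : r / C₀ ≤ ‖factorA m V lam x‖ := by
  rw [div_le_iff₀' W.const_pos]
  refine (W.re_A x hx).trans ?_
  gcongr
  · exact W.const_nonneg
  · refine (Complex.re_le_norm _).trans_eq ?_
    rw [norm_mul, W.norm_sign, one_mul]

theorem norm_B_ge {x : ℝ} (hx : x ∈ U) : r / C₀ ≤ ‖factorB m V lam x‖ := by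
  rw [div_le_iff₀' W.const_pos]
  refine (W.re_B x hx).trans ?_
  gcongr
  · exact W.const_nonneg
  · refine (Complex.re_le_norm _).trans_eq ?_
    rw [norm_mul, W.norm_sign, one_mul]

theorem A_ne {x : ℝ} (hx : x ∈ U) : factorA m V lam x ≠ 0 :=
  norm_pos_iff.mp ((div_pos W.r_pos W.const_pos).trans_le (W.norm_A_ge hx))

theorem B_ne {x : ℝ} (hx : x ∈ U) : factorB m V lam x ≠ 0 :=
  norm_pos_iff.mp ((div_pos W.r_pos W.const_pos).trans_le (W.norm_B_ge hx))

theorem norm_inv_A_le {x : ℝ} (hx : x ∈ U) : ‖(factorA m V lam x)⁻¹‖ ≤ C₀ / r := by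
  rw [norm_inv]
  exact inv_le_of_inv_le₀ (div_pos W.const_pos W.r_pos) (by
    rw [inv_div]
    exact W.norm_A_ge hx)

theorem norm_inv_B_le {x : ℝ} (hx : x ∈ U) : ‖(factorB m V lam x)⁻¹‖ ≤ C₀ / r := by
  rw [norm_inv]
  exact inv_le_of_inv_le₀ (div_pos W.const_pos W.r_pos) (by
    rw [inv_div]
    exact W.norm_B_ge hx)

theorem hasDerivAt_A {x : ℝ} (hx : x ∈ U) :
    HasDerivAt (factorA m V lam) (deriv (factorA m V lam) x) x :=
  ((W.differentiableAt 0 x hx).const_sub _).hasDerivAt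

theorem hasDerivAt_B {x : ℝ} (hx : x ∈ U) :
    HasDerivAt (factorB m V lam) (deriv (factorB m V lam) x) x :=
  ((W.differentiableAt 1 x hx).const_sub _).hasDerivAt

theorem symbol_A : SymbolOn U μ n (C₀ * r * μ) (deriv (factorA m V lam)) := by
  have : deriv (factorA m V lam) = fun x => -deriv (fun x => V x 0 0) x := by
    funext x
    exact deriv_const_sub _
  rw [this]
  exact (W.symbol_diag 0).neg

theorem symbol_B : SymbolOn U μ n (C₀ * r * μ) (deriv (factorB m V lam)) := by
  have : deriv (factorB m V lam) = fun x => -deriv (fun x => V x 1 1) x := by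
    funext x
    exact deriv_const_sub _
  rw [this]
  exact (W.symbol_diag 1).neg

/-- Multiplied by s, both factors have positive real parts a, b and a common imaginary part y. The
imaginary part y(a + b) of the product vanishes only for y = 0, where the product is ab > 0. Hence
the principal square root is differentiable along U. -/
theorem product_mem_slitPlane {x : ℝ} (hx : x ∈ U) :
    factorA m V lam x * factorB m V lam x ∈ Complex.slitPlane := by
  have h1 := W.re_A_pos hx
  have h2 := W.re_B_pos hx
  have h3 := W.im_eq x hx
  have e : factorA m V lam x * factorB m V lam x =
      (s * factorA m V lam x) * (s * factorB m V lam x) := by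
    linear_combination (-(factorA m V lam x * factorB m V lam x)) * W.sign_sq
  have h4 : (s * factorA m V lam x).im = (s * factorB m V lam x).im := by
    rcases W.sign with h | h <;> rw [h] <;> simp [h3]
  rw [e, Complex.mem_slitPlane_iff, Complex.mul_re (s * _) (s * _),
    Complex.mul_im (s * _) (s * _), h4]
  set y := (s * factorB m V lam x).im
  by_cases hy : y = 0
  · left
    rw [hy]
    simpa using mul_pos h1 h2
  · right
    have : (s * factorA m V lam x).re * y + y * (s * factorB m V lam x).re =
      y * ((s * factorA m V lam x).re + (s * factorB m V lam x).re) := by ring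
    rw [this]
    exact mul_ne_zero hy (by positivity)

theorem phaseDeriv_zero_sq (x : ℝ) : phaseDeriv m V xb lam s 0 x ^ 2 =
    -(factorA m V lam x * factorB m V lam x) := by
  rw [phaseDeriv_zero W.lam_ne, mul_pow, mul_pow, W.sign_sq, Complex.I_sq, one_div,
    ← Nat.cast_ofNat (R := ℂ), Complex.cpow_nat_inv_pow _ two_ne_zero]
  ring

theorem phaseDeriv_zero_ne {x : ℝ} (hx : x ∈ U) : phaseDeriv m V xb lam s 0 x ≠ 0 := by
  intro h
  have := W.phaseDeriv_zero_sq x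
  rw [h] at this
  have h' := mul_ne_zero (W.A_ne hx) (W.B_ne hx)
  apply h'
  linear_combination this

theorem hasDerivAt_phaseDeriv_zero {x : ℝ} (hx : x ∈ U) :
    HasDerivAt (phaseDeriv m V xb lam s 0) (phaseDeriv m V xb lam s 0 x *
      (1 / 2 * (deriv (factorA m V lam) x * (factorA m V lam x)⁻¹ +
        deriv (factorB m V lam) x * (factorB m V lam x)⁻¹))) x := by
  have h1 := (W.hasDerivAt_A hx).mul (W.hasDerivAt_B hx)
  have h0 : HasDerivAt (fun z : ℂ => z ^ (1 / 2 : ℂ)) _ ((factorA m V lam * factorB m V lam) x) :=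
    (hasDerivAt_id _).cpow_const (W.product_mem_slitPlane hx)
  have h2 := (h0.comp x h1).const_mul (s * Complex.I)
  have e : phaseDeriv m V xb lam s 0 = fun x => s * Complex.I *
      (factorA m V lam * factorB m V lam) x ^ (1 / 2 : ℂ) :=
    funext fun y => phaseDeriv_zero W.lam_ne s y
  have hA := W.A_ne hx
  have hB := W.B_ne hx
  rw [e]
  refine h2.congr_deriv ?_
  rw [id, Pi.mul_apply, Complex.cpow_sub _ _ (mul_ne_zero hA hB), Complex.cpow_one]
  field_simp
  rw [Pi.mul_apply]
  ring

theorem differentiableAt_k {f : ℝ → ℂ} (hf : ContinuousOn f (Ioi 0)) {x : ℝ} (hx : x ∈ U) :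
    HasDerivAt (fun x => Complex.exp (-Complex.I * ∫ t in xb..x, f t))
      (-Complex.I * f x * Complex.exp (-Complex.I * ∫ t in xb..x, f t)) x := by
  have hx0 := W.subset hx
  have hb0 := W.subset W.mem
  have h1 : HasDerivAt (fun x => ∫ t in xb..x, f t) (f x) x := by
    refine intervalIntegral.integral_hasDerivAt_right ?_
      (hf.stronglyMeasurableAtFilter isOpen_Ioi x hx0) (hf.continuousAt (Ioi_mem_nhds hx0))
    refine (hf.mono fun y hy => ?_).intervalIntegrable
    exact (lt_min hb0 hx0 : (0 : ℝ) < _).trans_le hy.1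
  convert! (h1.const_mul (-Complex.I)).cexp using 1
  ring

theorem hasDerivAt_k1 {x : ℝ} (hx : x ∈ U) :
    HasDerivAt (k1 V xb) (-Complex.I * V x 1 0 * k1 V xb x) x :=
  W.differentiableAt_k W.cont_10 hx

theorem hasDerivAt_k2 {x : ℝ} (hx : x ∈ U) :
    HasDerivAt (k2 V xb) (-Complex.I * V x 0 1 * k2 V xb x) x :=
  W.differentiableAt_k W.cont_01 hx

/-- The exponentials k₁ and k₂ enter the logarithmic derivative only through V₂₁ - V₁₂, which is why
the hypotheses control the derivatives of that difference alone. -/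
theorem hasDerivAt_K {x : ℝ} (hx : x ∈ U) : HasDerivAt (Klam m V xb lam)
    (Klam m V xb lam x * (-Complex.I * (V x 1 0 - V x 0 1) -
      deriv (factorB m V lam) x * (factorB m V lam x)⁻¹)) x := by
  have hk2 : k2 V xb x ≠ 0 := Complex.exp_ne_zero _
  have hB := W.B_ne hx
  have h := ((W.hasDerivAt_k1 hx).div (W.hasDerivAt_k2 hx) hk2).mul
    ((W.hasDerivAt_B hx).inv hB)
  have e : Klam m V xb lam = (k1 V xb / k2 V xb) * (factorB m V lam)⁻¹ := by
    funext y
    simp [Klam, factorB]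
  rw [e]
  refine h.congr_deriv ?_
  simp only [Pi.mul_apply, Pi.div_apply, Pi.inv_apply]
  field_simp
  ring

theorem K_ne {x : ℝ} (hx : x ∈ U) : Klam m V xb lam x ≠ 0 :=
  mul_ne_zero (div_ne_zero (Complex.exp_ne_zero _) (Complex.exp_ne_zero _))
    (one_div_ne_zero (W.B_ne hx))

theorem logDerivK_eq {x : ℝ} (hx : x ∈ U) : logDerivK m V xb lam x =
    -Complex.I * (V x 1 0 - V x 0 1) -
      deriv (factorB m V lam) x * (factorB m V lam x)⁻¹ := by
  rw [logDerivK, (W.hasDerivAt_K hx).deriv, mul_div_cancel_left₀ _ (W.K_ne hx)]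

end WindowData

theorem WindowData.exists_symbolOn (n : ℕ) (C₀ : ℝ) (hC₀ : 0 ≤ C₀) : ∃ C : ℝ, 1 ≤ C ∧
    ∀ {m : ℝ} {V : ℝ → Matrix (Fin 2) (Fin 2) ℂ} {xb : ℝ} {lam s : ℂ} {U : Set ℝ} {μ r : ℝ},
      WindowData m V xb lam s n U μ r C₀ → SymbolOn U μ n (C * μ) (logDerivK m V xb lam) ∧
      ∀ k i, k + i ≤ n →
        SymbolOn U μ i (C * (μ ^ (k + 1) / r ^ k)) (phaseDeriv m V xb lam s (k + 1)) := by
  obtain ⟨C, hC, H⟩ := exists_symbolOn_transport n C₀ hC₀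
  refine ⟨C, hC, fun {m V xb lam s U μ r} W => ?_⟩
  exact H (p := phaseDeriv m V xb lam s) W.isOpen W.convex W.mu_nonneg W.r_pos
    (fun x hx => (W.hasDerivAt_A hx).differentiableAt)
    (fun x hx => (W.hasDerivAt_B hx).differentiableAt) W.symbol_A W.symbol_B W.symbol_offDiag
    (fun x hx => ⟨W.A_ne hx, W.norm_inv_A_le hx⟩) (fun x hx => ⟨W.B_ne hx, W.norm_inv_B_le hx⟩)
    (fun x _ => W.phaseDeriv_zero_sq x) (fun x hx => W.hasDerivAt_phaseDeriv_zero hx)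
    (fun x hx => W.logDerivK_eq hx) (fun k _ x _ => phaseDeriv_succ W.lam_ne s k x)

/-! ### The pseudomode belongs to the domain -/

/-- An absolutely continuous function with compact support in `(0, ∞)` has its almost everywhere
derivative as weak derivative. -/
theorem hasWeakDeriv_of_eq_zero_off {f g : ℝ → ℂ} {a b : ℝ} (ha : 0 < a) (hab : a ≤ b)
    (hf : AbsolutelyContinuousOnInterval f a b) (hf0 : ∀ x ∉ Ioo a b, f x = 0)
    (hg : IntervalIntegrable g volume a b) (hg0 : ∀ x ∉ Icc a b, g x = 0)
    (h : ∀ᵐ x, x ∈ Icc a b → HasDerivAt f (g x) x) : HasWeakDeriv f g := by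
  have hfi : IntervalIntegrable f volume a b := hf.continuousOn.intervalIntegrable
  have loc : ∀ {k : ℝ → ℂ}, IntervalIntegrable k volume a b → (∀ x ∉ Icc a b, k x = 0) →
      LocallyIntegrableOn k (Ioi 0) := by
    intro k hk hk0
    have h1 : IntegrableOn k (Icc a b) := by
      rw [integrableOn_Icc_iff_integrableOn_Ioc]
      exact (intervalIntegrable_iff_integrableOn_Ioc_of_le hab).mp hk
    have h2 : IntegrableOn k univ :=
      h1.of_forall_sdiff_eq_zero MeasurableSet.univ fun x hx => hk0 x hx.2
    exact (integrableOn_univ.mp h2).locallyIntegrable.locallyIntegrableOn _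
  refine ⟨loc hfi fun x hx => hf0 x fun h' => hx (Ioo_subset_Icc_self h'), loc hg hg0,
    fun φ h1 h2 h3 => ?_⟩
  have hd : Continuous (deriv φ) := h1.continuous_deriv (by simp)
  have i1 : IntervalIntegrable (fun x => deriv φ x • f x) volume a b :=
    hfi.continuousOn_smul hd.continuousOn
  have i2 : IntervalIntegrable (fun x => φ x • g x) volume a b :=
    hg.continuousOn_smul h1.continuous.continuousOn
  have e2 : ∫ x in Ioi 0, φ x • g x = ∫ x in a..b, φ x • g x := by
    rw [intervalIntegral.integral_of_le hab, ← integral_Icc_eq_integral_Ioc]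
    refine (setIntegral_eq_of_subset_of_forall_sdiff_eq_zero measurableSet_Ioi
      (fun x hx => ha.trans_le hx.1) fun x hx => ?_)
    rw [hg0 x hx.2, smul_zero]
  rw [setIntegral_Ioi_eq_intervalIntegral ha hab fun x hx => by rw [hf0 x hx, smul_zero], e2,
    eq_neg_iff_add_eq_zero, ← intervalIntegral.integral_add i1 i2,
    integral_eq_sub_of_ae_hasDerivAt (f := φ • f) _ (i1.add i2)]
  · simp [hf0 a (by simp), hf0 b (by simp)]
  · filter_upwards [h] with x hx hxm
    rw [uIcc_of_le hab] at hxm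
    have := ((h1.differentiable (by simp)) x).hasDerivAt.smul (hx hxm)
    convert! this using 1
    rw [add_comm]
  · have : AbsolutelyContinuousOnInterval φ a b :=
      (h1.contDiffOn.of_le (by simp)).absolutelyContinuousOnInterval
    exact this.smul hf

theorem absolutelyContinuousOnInterval_of_hasDerivAt {f f' : ℝ → ℂ} {a b : ℝ}
    (h : ∀ x ∈ uIcc a b, HasDerivAt f (f' x) x) (hc : ContinuousOn f' (uIcc a b)) :
    AbsolutelyContinuousOnInterval f a b := by
  obtain ⟨C, hC⟩ := isCompact_uIcc.exists_bound_of_continuousOn hc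
  refine (Convex.lipschitzOnWith_of_nnnorm_hasDerivWithin_le (C := C.toNNReal) (convex_uIcc a b)
    (fun x hx => (h x hx).hasDerivWithinAt) fun x hx => ?_).absolutelyContinuousOnInterval
  rw [← NNReal.coe_le_coe, coe_nnnorm]
  exact (hC x hx).trans (Real.le_coe_toNNReal C)

theorem SymbolOn.absolutelyContinuousOnInterval {U : Set ℝ} (hc : Convex ℝ U) {μ M : ℝ} {n : ℕ}
    {f : ℝ → ℂ} (h : SymbolOn U μ n M f) {a b : ℝ} (hab : uIcc a b ⊆ U) :
    AbsolutelyContinuousOnInterval f a b := by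
  refine LipschitzOnWith.absolutelyContinuousOnInterval (K := (M * μ).toNNReal) ?_
  refine LipschitzOnWith.of_dist_le_mul fun x hx y hy => ?_
  rw [dist_eq_norm, Real.dist_eq]
  exact (h.lipschitz hc (hab hy) (hab hx)).trans
    (mul_le_mul_of_nonneg_right (Real.le_coe_toNNReal _) (abs_nonneg _))

theorem AbsolutelyContinuousOnInterval.sum_range {p : ℕ → ℝ → ℂ} {a b : ℝ} {N : ℕ}
    (h : ∀ k < N, AbsolutelyContinuousOnInterval (p k) a b) :
    AbsolutelyContinuousOnInterval (fun x => ∑ k ∈ Finset.range N, p k x) a b := by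
  induction N with
  | zero =>
    simp only [Finset.range_zero, Finset.sum_empty]
    exact (LipschitzWith.const (0 : ℂ)).lipschitzOnWith.absolutelyContinuousOnInterval
  | succ N ih =>
    simp only [Finset.sum_range_succ]
    exact (ih fun k hk => h k (by omega)).add (h N (by omega))

/-- Evaluation of the Dirac operator on a function given by representatives. -/
theorem diracOp_apply {m : ℝ} {V : ℝ → Matrix (Fin 2) (Fin 2) ℂ}
    {f g : ℝ → EuclideanSpace ℂ (Fin 2)} (hf : MemLp f 2 (volume.restrict (Ioi (0 : ℝ))))
    (hg : MemLp g 2 (volume.restrict (Ioi (0 : ℝ)))) (h : IsDiracImage m V f g) :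
    ∃ hD : hf.toLp f ∈ (diracOp m V).domain, diracOp m V ⟨hf.toLp f, hD⟩ = hg.toLp g := by
  have h' : IsDiracImage m V (hf.toLp f) (hg.toLp g) := by
    refine ⟨h.1.ae_congr ?_ ?_, h.2.ae_congr ?_ ?_⟩ <;>
      filter_upwards [hf.coeFn_toLp, hg.coeFn_toLp] with x hx hy <;> simp only [hx, hy]
  have hD : hf.toLp f ∈ (diracOp m V).domain := ⟨hg.toLp g, h'⟩
  exact ⟨hD, IsDiracImage.unique (Exists.choose_spec hD) h'⟩

namespace WindowData

variable {m : ℝ} {V : ℝ → Matrix (Fin 2) (Fin 2) ℂ} {xb : ℝ} {lam s : ℂ} {n : ℕ}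
    {U : Set ℝ} {μ r C₀ C : ℝ} (W : WindowData m V xb lam s n U μ r C₀)
    (hκ : SymbolOn U μ n (C * μ) (logDerivK m V xb lam))
    (hP : ∀ k i, k + i ≤ n →
        SymbolOn U μ i (C * (μ ^ (k + 1) / r ^ k)) (phaseDeriv m V xb lam s (k + 1)))

include W

theorem continuousOn_deriv_phaseDeriv_zero : ContinuousOn (fun x => phaseDeriv m V xb lam s 0 x *
      (1 / 2 * (deriv (factorA m V lam) x * (factorA m V lam x)⁻¹ +
        deriv (factorB m V lam) x * (factorB m V lam x)⁻¹))) U := by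
  have hA : ContinuousOn (factorA m V lam) U := fun x hx =>
    (W.hasDerivAt_A hx).continuousAt.continuousWithinAt
  have hB : ContinuousOn (factorB m V lam) U := fun x hx =>
    (W.hasDerivAt_B hx).continuousAt.continuousWithinAt
  have h0 : ContinuousOn (phaseDeriv m V xb lam s 0) U := fun _ hx =>
    (W.hasDerivAt_phaseDeriv_zero hx).continuousAt.continuousWithinAt
  have hA' := W.symbol_A.continuousOn W.convex
  have hB' := W.symbol_B.continuousOn W.convex
  exact h0.mul (continuousOn_const.mul ((hA'.mul (hA.inv₀ fun x hx => W.A_ne hx)).add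
    (hB'.mul (hB.inv₀ fun x hx => W.B_ne hx))))

theorem continuousOn_phaseDeriv_zero : ContinuousOn (phaseDeriv m V xb lam s 0) U := fun _ hx =>
    (W.hasDerivAt_phaseDeriv_zero hx).continuousAt.continuousWithinAt

include hP

theorem continuousOn_phaseDeriv {k : ℕ} (hk : k ≤ n + 1) :
    ContinuousOn (phaseDeriv m V xb lam s k) U := by
  cases k with
  | zero => exact W.continuousOn_phaseDeriv_zero
  | succ k => exact (hP k 0 (by omega)).continuousOn W.convex

theorem differentiableAt_phaseDeriv {k : ℕ} (hk : k ≤ n) {x : ℝ} (hx : x ∈ U) :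
    DifferentiableAt ℝ (phaseDeriv m V xb lam s k) x := by
  cases k with
  | zero => exact (W.hasDerivAt_phaseDeriv_zero hx).differentiableAt
  | succ k => exact (hP k 1 (by omega)).2.1 x hx

theorem absolutelyContinuous_phaseDeriv {k : ℕ} (hk : k ≤ n + 1) {a b : ℝ} (hab : uIcc a b ⊆ U) :
    AbsolutelyContinuousOnInterval (phaseDeriv m V xb lam s k) a b := by
  cases k with
  | zero =>
    exact absolutelyContinuousOnInterval_of_hasDerivAt
      (fun x hx => W.hasDerivAt_phaseDeriv_zero (hab hx))
      (W.continuousOn_deriv_phaseDeriv_zero.mono hab)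
  | succ k => exact (hP k 0 (by omega)).absolutelyContinuousOnInterval W.convex hab

/-- The last term of the phase is merely Lipschitz; Rademacher's theorem on the line supplies the
derivative almost everywhere, bounded by the Lipschitz constant. -/
theorem ae_differentiableAt_phaseDeriv (hC : 0 ≤ C) : ∀ᵐ x, x ∈ U →
    DifferentiableAt ℝ (phaseDeriv m V xb lam s (n + 1)) x ∧
    ‖deriv (phaseDeriv m V xb lam s (n + 1)) x‖ ≤ C * (μ ^ (n + 2) / r ^ n) := by
  have h := hP n 0 (by omega)
  have hμ := W.mu_nonneg
  have hr := W.r_pos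
  have hK : 0 ≤ C * (μ ^ (n + 1) / r ^ n) * μ := by positivity
  have hL : LipschitzOnWith (C * (μ ^ (n + 1) / r ^ n) * μ).toNNReal
      (phaseDeriv m V xb lam s (n + 1)) U := by
    refine LipschitzOnWith.of_dist_le_mul fun x hx y hy => ?_
    rw [dist_eq_norm, Real.dist_eq, Real.coe_toNNReal _ hK]
    exact h.lipschitz W.convex hy hx
  filter_upwards [hL.ae_differentiableWithinAt_of_mem_real] with x hx hxU
  have hn := W.isOpen.mem_nhds hxU
  refine ⟨(hx hxU).differentiableAt hn, ?_⟩
  have := norm_deriv_le_of_lipschitzOn hn hL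
  rw [Real.coe_toNNReal _ hK] at this
  refine this.trans_eq ?_
  rw [pow_succ μ (n + 1)]
  ring

theorem hasDerivAt_phase {x : ℝ} (hx : x ∈ U) : HasDerivAt (phase m V xb lam s (n + 1))
    (∑ k ∈ Finset.range (n + 2), phaseDeriv m V xb lam s k x) x := by
  have e : phase m V xb lam s (n + 1) = fun x =>
      ∑ k ∈ Finset.range (n + 2), ∫ t in xb..x, phaseDeriv m V xb lam s k t := rfl
  rw [e]
  refine HasDerivAt.fun_sum fun k hk => ?_
  have hc := W.continuousOn_phaseDeriv hP (k := k) (by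
    have := Finset.mem_range.mp hk
    omega)
  refine intervalIntegral.integral_hasDerivAt_right ?_
    (hc.stronglyMeasurableAtFilter W.isOpen x hx) (hc.continuousAt (W.isOpen.mem_nhds hx))
  exact (hc.mono (W.convex.ordConnected.uIcc_subset W.mem hx)).intervalIntegrable

theorem continuousOn_phase : ContinuousOn (phase m V xb lam s (n + 1)) U := fun _ hx =>
  (W.hasDerivAt_phase hP hx).continuousAt.continuousWithinAt

theorem continuousOn_sum_phaseDeriv :
    ContinuousOn (fun x => ∑ k ∈ Finset.range (n + 2), phaseDeriv m V xb lam s k x) U :=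
  continuousOn_finsetSum _ fun k hk => W.continuousOn_phaseDeriv hP (by
    have := Finset.mem_range.mp hk
    omega)

theorem hasDerivAt_modeU {ξ : ℝ → ℝ} (hξ : Differentiable ℝ ξ) {x : ℝ} (hx : x ∈ U) :
    HasDerivAt (modeU m V xb lam s (n + 1) ξ)
      (((deriv ξ x : ℝ) - ξ x * ∑ k ∈ Finset.range (n + 2), phaseDeriv m V xb lam s k x) *
        Complex.exp (-phase m V xb lam s (n + 1) x)) x := by
  have h1 : HasDerivAt (fun y => (ξ y : ℂ)) ((deriv ξ x : ℝ) : ℂ) x := (hξ x).hasDerivAt.ofReal_comp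
  refine (h1.mul (W.hasDerivAt_phase hP hx).neg.cexp).congr_deriv ?_
  simp only [Pi.neg_apply]
  ring

theorem mode_one_eq {ξ : ℝ → ℝ} (hξ : Differentiable ℝ ξ) {x : ℝ} (hx : x ∈ U) :
    mode m V xb lam s (n + 1) ξ x 1 =
      -Complex.I * k1 V xb x * (factorB m V lam x)⁻¹ *
        Complex.exp (-phase m V xb lam s (n + 1) x) *
      ((deriv ξ x : ℝ) - ξ x * ∑ k ∈ Finset.range (n + 2), phaseDeriv m V xb lam s k x) := by
  have h2 : k2 V xb x ≠ 0 := Complex.exp_ne_zero _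
  have hB := W.B_ne hx
  have e : mode m V xb lam s (n + 1) ξ x 1 = k2 V xb x * (k1 V xb x / k2 V xb x *
      (-Complex.I * deriv (modeU m V xb lam s (n + 1) ξ) x / factorB m V lam x)) := rfl
  rw [e, (W.hasDerivAt_modeU hP hξ hx).deriv]
  field_simp

/-- This is the second equation of H_V Ψ = λΨ solved for the derivative. It holds exactly by the
choice of v, so the whole error sits in the first component. -/
theorem hasDerivAt_mode_zero {ξ : ℝ → ℝ} (hξ : Differentiable ℝ ξ) {x : ℝ} (hx : x ∈ U) :
    HasDerivAt (fun x => mode m V xb lam s (n + 1) ξ x 0)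
      (Complex.I * (lam * mode m V xb lam s (n + 1) ξ x 1 -
        (V x 1 0 * mode m V xb lam s (n + 1) ξ x 0 +
          (V x 1 1 - m) * mode m V xb lam s (n + 1) ξ x 1))) x := by
  have hB := W.B_ne hx
  have e : (fun x => mode m V xb lam s (n + 1) ξ x 0) =
    fun x => k1 V xb x * modeU m V xb lam s (n + 1) ξ x := rfl
  have e0 : mode m V xb lam s (n + 1) ξ x 0 = k1 V xb x * modeU m V xb lam s (n + 1) ξ x := rfl
  have e1 : Complex.I * (lam * mode m V xb lam s (n + 1) ξ x 1 -
        (V x 1 0 * mode m V xb lam s (n + 1) ξ x 0 +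
          (V x 1 1 - m) * mode m V xb lam s (n + 1) ξ x 1)) =
      Complex.I * (factorB m V lam x * mode m V xb lam s (n + 1) ξ x 1 -
        V x 1 0 * mode m V xb lam s (n + 1) ξ x 0) := by
    rw [factorB]
    ring
  rw [e, e1, W.mode_one_eq hP hξ hx, e0]
  refine ((W.hasDerivAt_k1 hx).mul (W.hasDerivAt_modeU hP hξ hx)).congr_deriv ?_
  field_simp
  linear_combination (k1 V xb x * Complex.exp (-phase m V xb lam s (n + 1) x) *
    ((deriv ξ x : ℝ) - ξ x * ∑ k ∈ Finset.range (n + 2), phaseDeriv m V xb lam s k x)) * Complex.I_sq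

/-- The action of the Dirac operator on the pseudomode, first component. -/
theorem dirac_mode_zero {ξ : ℝ → ℝ} (hξ : ContDiff ℝ ∞ ξ) {x : ℝ} (hx : x ∈ U)
    (hd : DifferentiableAt ℝ (phaseDeriv m V xb lam s (n + 1)) x) :
    DifferentiableAt ℝ (fun x => mode m V xb lam s (n + 1) ξ x 1) x ∧
    -Complex.I * deriv (fun x => mode m V xb lam s (n + 1) ξ x 1) x +
        V x 0 1 * mode m V xb lam s (n + 1) ξ x 1 +
        (V x 0 0 + m) * mode m V xb lam s (n + 1) ξ x 0 =
      lam * mode m V xb lam s (n + 1) ξ x 0 -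
      k1 V xb x * (factorB m V lam x)⁻¹ * Complex.exp (-phase m V xb lam s (n + 1) x) *
        ((iteratedDeriv 2 ξ x : ℝ) - 2 * (deriv ξ x : ℝ) * ∑ k ∈ Finset.range (n + 2),
            phaseDeriv m V xb lam s k x + logDerivK m V xb lam x * (deriv ξ x : ℝ)) -
      (factorB m V lam x)⁻¹ *
        ((∑ i ∈ Finset.range (n + 1), ∑ j ∈ Finset.Ico (n - i) (n + 1),
            phaseDeriv m V xb lam s (i + 1) x * phaseDeriv m V xb lam s (j + 1) x)
          - deriv (phaseDeriv m V xb lam s (n + 1)) x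
          - logDerivK m V xb lam x * phaseDeriv m V xb lam s (n + 1) x) *
        mode m V xb lam s (n + 1) ξ x 0 := by
  have hξ' : Differentiable ℝ ξ := hξ.differentiable (by simp)
  have hB := W.B_ne hx
  have hD : ∀ k ∈ Finset.range (n + 2), HasDerivAt (phaseDeriv m V xb lam s k)
      (deriv (phaseDeriv m V xb lam s k) x) x := by
    intro k hk
    have hk' := Finset.mem_range.mp hk
    rcases Nat.lt_or_ge k (n + 1) with h | h
    · exact (W.differentiableAt_phaseDeriv hP (by omega) hx).hasDerivAt
    · obtain rfl : k = n + 1 := by omega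
      exact hd.hasDerivAt
  have hS := HasDerivAt.fun_sum hD
  have h1 : HasDerivAt (fun y => (ξ y : ℂ)) ((deriv ξ x : ℝ) : ℂ) x := (hξ' x).hasDerivAt.ofReal_comp
  have h2 : HasDerivAt (fun y => ((deriv ξ y : ℝ) : ℂ)) ((iteratedDeriv 2 ξ x : ℝ) : ℂ) x := by
    have h3 : ContDiff ℝ ∞ (deriv ξ) := (contDiff_infty_iff_deriv.mp hξ).2
    have h4 := ((h3.differentiable (by simp)) x).hasDerivAt.ofReal_comp
    have e : iteratedDeriv 2 ξ x = deriv (deriv ξ) x := by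
      rw [iteratedDeriv_succ, iteratedDeriv_one]
    rwa [e]
  -- The second component is -i k₁ B⁻¹ e^{-P} (ξ' - ξP'), differentiated as a product. This is where
  -- differentiability of the last phase term is needed.
  have key := ((((W.hasDerivAt_k1 hx).const_mul (-Complex.I)).mul ((W.hasDerivAt_B hx).inv hB)).mul
    (W.hasDerivAt_phase hP hx).neg.cexp).mul (h2.sub (h1.mul hS))
  have ev : (fun x => mode m V xb lam s (n + 1) ξ x 1) =ᶠ[𝓝 x]
      ((((fun y => -Complex.I * k1 V xb y) * (factorB m V lam)⁻¹) *
        (fun y => Complex.exp ((-phase m V xb lam s (n + 1)) y))) *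
      ((fun y => ((deriv ξ y : ℝ) : ℂ)) - (fun y => (ξ y : ℂ)) * fun y =>
        ∑ k ∈ Finset.range (n + 2), phaseDeriv m V xb lam s k y)) := by
    filter_upwards [W.isOpen.mem_nhds hx] with y hy
    exact W.mode_one_eq hP hξ' hy
  have key' := key.congr_of_eventuallyEq ev
  refine ⟨key'.differentiableAt, ?_⟩
  -- The terms carrying ξ itself combine to (P')² + AB - P'' - κP', which this identity reduces to
  -- the tail.
  have hrem := wkb_remainder_eq n (fun k => phaseDeriv m V xb lam s k x)
    (fun k => deriv (phaseDeriv m V xb lam s k) x) (logDerivK m V xb lam x)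
    (factorA m V lam x * factorB m V lam x) (W.phaseDeriv_zero_sq x) (fun k _ => by
      have h0 := W.phaseDeriv_zero_ne hx
      rw [phaseDeriv_succ W.lam_ne s k x]
      field_simp)
  have e0 : mode m V xb lam s (n + 1) ξ x 0 =
    k1 V xb x * (ξ x * Complex.exp (-phase m V xb lam s (n + 1) x)) := rfl
  have eA : (V x 0 0 + m : ℂ) = lam - factorA m V lam x := by
    rw [factorA]
    ring
  rw [← hrem, key'.deriv, W.mode_one_eq hP hξ' hx, e0, eA, W.logDerivK_eq hx]
  simp only [Pi.mul_apply, Pi.inv_apply, Pi.sub_apply, Pi.neg_apply]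
  set S := ∑ k ∈ Finset.range (n + 2), phaseDeriv m V xb lam s k x
  set S' := ∑ k ∈ Finset.range (n + 2), deriv (phaseDeriv m V xb lam s k) x
  set E := Complex.exp (-phase m V xb lam s (n + 1) x)
  set B := factorB m V lam x
  set B' := deriv (factorB m V lam) x
  set A := factorA m V lam x
  set k := k1 V xb x
  have hI : Complex.I ^ 2 = -1 := Complex.I_sq
  field_simp
  linear_combination -(k * E * ((Complex.I * V x 1 0 * B + B' + B * S) *
    ((deriv ξ x : ℝ) - S * ξ x) - B * ((iteratedDeriv 2 ξ x : ℝ) -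
      (S * (deriv ξ x : ℝ) + ξ x * S')))) * hI

end WindowData

/-! ### Square integrability of the pseudomode and of its image -/

theorem memLp_of_bound_of_eq_zero_off {E : Type*} [NormedAddCommGroup E] {f : ℝ → E} {p q M : ℝ}
    (hm : AEStronglyMeasurable f (volume.restrict (Icc p q)))
    (hb : ∀ᵐ x, x ∈ Icc p q → ‖f x‖ ≤ M) (h0 : ∀ x ∉ Icc p q, f x = 0) :
    MemLp f 2 (volume.restrict (Ioi (0 : ℝ))) := by
  have h1 : MemLp f 2 (volume.restrict (Icc p q)) :=
    MemLp.of_bound hm M ((ae_restrict_iff' measurableSet_Icc).mpr hb)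
  have h2 : (Icc p q).indicator f = f := by
    funext x
    by_cases hx : x ∈ Icc p q
    · rw [indicator_of_mem hx]
    · rw [indicator_of_notMem hx, h0 x hx]
  have h3 := (memLp_indicator_iff_restrict measurableSet_Icc).mpr h1
  rw [h2] at h3
  exact h3.restrict _

theorem aestronglyMeasurable_vec {a b : ℝ → ℂ} {ν : Measure ℝ} (ha : AEStronglyMeasurable a ν)
    (hb : AEStronglyMeasurable b ν) :
    AEStronglyMeasurable (fun x => (!₂[a x, b x] : EuclideanSpace ℂ (Fin 2))) ν := by
  have h : Continuous fun z : ℂ × ℂ => (!₂[z.1, z.2] : EuclideanSpace ℂ (Fin 2)) := by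
    refine (PiLp.continuous_toLp 2 _).comp (continuous_pi fun i => ?_)
    fin_cases i
    · exact continuous_fst
    · exact continuous_snd
  exact h.comp_aestronglyMeasurable (ha.prodMk hb)

theorem norm_vec_le (a b : ℂ) : ‖(!₂[a, b] : EuclideanSpace ℂ (Fin 2))‖ ≤ ‖a‖ + ‖b‖ := by
  rw [EuclideanSpace.norm_eq, Fin.sum_univ_two]
  refine Real.sqrt_le_iff.mpr ⟨by positivity, ?_⟩
  simp only [Matrix.cons_val_zero, Matrix.cons_val_one]
  nlinarith [norm_nonneg a, norm_nonneg b]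

/-- The terms of `(H_V - λ) Ψ` that contain derivatives of the cut-off. -/
noncomputable def cutoffTerm (m : ℝ) (V : ℝ → Matrix (Fin 2) (Fin 2) ℂ) (xb : ℝ) (lam s : ℂ) (n : ℕ)
    (ξ : ℝ → ℝ) (x : ℝ) : ℂ :=
  k1 V xb x * (factorB m V lam x)⁻¹ * Complex.exp (-phase m V xb lam s (n + 1) x) *
    ((iteratedDeriv 2 ξ x : ℝ) - 2 * (deriv ξ x : ℝ) * ∑ k ∈ Finset.range (n + 2),
      phaseDeriv m V xb lam s k x + logDerivK m V xb lam x * (deriv ξ x : ℝ))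

/-- Membership in the maximal domain needs weak derivatives on the whole half-line. Both components
are absolutely continuous on the closed window and vanish off its interior, so their almost
everywhere derivatives are weak derivatives. The error is then the cut-off term plus the WKB tail
divided by B. -/
theorem WindowData.exists_isDiracImage {m : ℝ} {V : ℝ → Matrix (Fin 2) (Fin 2) ℂ} {xb : ℝ}
    {lam s : ℂ} {n : ℕ} {U : Set ℝ} {μ r C₀ C : ℝ} (W : WindowData m V xb lam s n U μ r C₀)
    (hC : 0 ≤ C) (hκ : SymbolOn U μ n (C * μ) (logDerivK m V xb lam))
    (hP : ∀ k i, k + i ≤ n →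
      SymbolOn U μ i (C * (μ ^ (k + 1) / r ^ k)) (phaseDeriv m V xb lam s (k + 1)))
    {ξ : ℝ → ℝ} (hξ : ContDiff ℝ ∞ ξ) (hξ0 : ∀ x, 0 ≤ ξ x) {p q : ℝ} (hpq : p ≤ q)
    (hU : Icc p q ⊆ U) (hoff : ∀ x ∉ Ioo p q, ξ x = 0) :
    ∃ G : ℝ → EuclideanSpace ℂ (Fin 2),
      MemLp (mode m V xb lam s (n + 1) ξ) 2 (volume.restrict (Ioi (0 : ℝ))) ∧
      MemLp G 2 (volume.restrict (Ioi (0 : ℝ))) ∧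
      IsDiracImage m V (mode m V xb lam s (n + 1) ξ) G ∧
      ∀ᵐ x, (x ∈ Icc p q → ‖G x - lam • mode m V xb lam s (n + 1) ξ x‖ ≤
          ‖cutoffTerm m V xb lam s n ξ x‖ +
            C₀ * ((n + 1) ^ 2 * C ^ 2 + C + C ^ 2) *
              (∑ i ∈ Finset.range (n + 1), μ ^ (n + 1 + i + 1) / r ^ (n + 1 + i)) *
              ‖mode m V xb lam s (n + 1) ξ x‖) ∧
        (x ∉ Icc p q → G x - lam • mode m V xb lam s (n + 1) ξ x = 0) := by
  have hr := W.r_pos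
  have hμ := W.mu_nonneg
  have hC₀ := W.const_pos
  have hξd : Differentiable ℝ ξ := hξ.differentiable (by simp)
  have hp0 : 0 < p := W.subset (hU (left_mem_Icc.mpr hpq))
  have hab : uIcc p q ⊆ U := by rwa [uIcc_of_le hpq]
  set f := mode m V xb lam s (n + 1) ξ with hf
  set σ := ∑ i ∈ Finset.range (n + 1), μ ^ (n + 1 + i + 1) / r ^ (n + 1 + i) with hσ
  have hσ0 : 0 ≤ σ := Finset.sum_nonneg fun i _ => by positivity
  -- vanishing outside the window
  have hd0 : ∀ x ∉ Ioo p q, deriv ξ x = 0 := fun x hx => by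
    refine IsLocalMin.deriv_eq_zero (Eventually.of_forall fun y => ?_)
    rw [hoff x hx]
    exact hξ0 y
  have z0 : ∀ x ∉ Ioo p q, f x 0 = 0 := fun x hx => by
    have : f x 0 = k1 V xb x * (ξ x * Complex.exp (-phase m V xb lam s (n + 1) x)) := rfl
    rw [this, hoff x hx]
    simp
  have z1 : ∀ x ∉ Ioo p q, f x 1 = 0 := fun x hx => by
    -- On U, endpoints included, the explicit formula applies. Off U the point is away from the
    -- closed window and u vanishes nearby.
    by_cases hxU : x ∈ U
    · rw [hf, W.mode_one_eq hP hξd hxU, hoff x hx, hd0 x hx]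
      simp
    · have hx' : x ∉ Icc p q := fun h => hxU (hU h)
      have e : f x 1 = k2 V xb x * (k1 V xb x / k2 V xb x *
        (-Complex.I * deriv (modeU m V xb lam s (n + 1) ξ) x / factorB m V lam x)) := rfl
      have e2 : modeU m V xb lam s (n + 1) ξ =ᶠ[𝓝 x] fun _ => 0 := by
        filter_upwards [isClosed_Icc.isOpen_compl.mem_nhds hx'] with y hy
        rw [modeU, hoff y fun h => hy (Ioo_subset_Icc_self h)]
        simp
      rw [e, e2.deriv_eq]
      simp
  have zd : ∀ x ∉ Icc p q, deriv (fun x => f x 1) x = 0 := fun x hx => by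
    have e2 : (fun x => f x 1) =ᶠ[𝓝 x] fun _ => 0 := by
      filter_upwards [isClosed_Icc.isOpen_compl.mem_nhds hx] with y hy
      exact z1 y fun h => hy (Ioo_subset_Icc_self h)
    rw [e2.deriv_eq]
    simp
  -- continuity on the window
  have ck1 : ContinuousOn (k1 V xb) U := fun x hx =>
    (W.hasDerivAt_k1 hx).continuousAt.continuousWithinAt
  have cB : ContinuousOn (fun x => (factorB m V lam x)⁻¹) U := fun x hx =>
    ((W.hasDerivAt_B hx).inv (W.B_ne hx)).continuousAt.continuousWithinAt
  have cE : ContinuousOn (fun x => Complex.exp (-phase m V xb lam s (n + 1) x)) U :=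
    (W.continuousOn_phase hP).neg.cexp
  have cS := W.continuousOn_sum_phaseDeriv hP
  have cκ := hκ.continuousOn W.convex
  have cξ : Continuous ξ := hξ.continuous
  have cξ' : Continuous (deriv ξ) := hξ.continuous_deriv (by simp)
  have hξ' : ContDiff ℝ ∞ (deriv ξ) := (contDiff_infty_iff_deriv.mp hξ).2
  have cξ'' : Continuous (iteratedDeriv 2 ξ) := by
    rw [iteratedDeriv_succ, iteratedDeriv_one]
    exact hξ'.continuous_deriv (by simp)
  have cc : ContinuousOn (cutoffTerm m V xb lam s n ξ) U := by
    refine ((ck1.mul cB).mul cE).mul (((Complex.continuous_ofReal.comp cξ'').continuousOn.sub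
      ((continuousOn_const.mul (Complex.continuous_ofReal.comp cξ').continuousOn).mul cS)).add
      (cκ.mul (Complex.continuous_ofReal.comp cξ').continuousOn))
  have c0 : ContinuousOn (fun x => f x 0) U := fun x hx =>
    (W.hasDerivAt_mode_zero hP hξd hx).continuousAt.continuousWithinAt
  have c1 : ContinuousOn (fun x => f x 1) U := by
    refine ContinuousOn.congr ?_ fun x hx => W.mode_one_eq hP hξd hx
    exact (((continuousOn_const.mul ck1).mul cB).mul cE).mul
      ((Complex.continuous_ofReal.comp cξ').continuousOn.sub
        ((Complex.continuous_ofReal.comp cξ).continuousOn.mul cS))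
  obtain ⟨M0, hM0⟩ := isCompact_Icc.exists_bound_of_continuousOn (c0.mono hU)
  obtain ⟨M1, hM1⟩ := isCompact_Icc.exists_bound_of_continuousOn (c1.mono hU)
  obtain ⟨Mc, hMc⟩ := isCompact_Icc.exists_bound_of_continuousOn (cc.mono hU)
  have hI0 : Icc p q ⊆ Ioi 0 := hU.trans W.subset
  -- the image
  set g0 : ℝ → ℂ := fun x => -Complex.I * deriv (fun x => f x 1) x + V x 0 1 * f x 1 +
        (V x 0 0 + m) * f x 0 with hg0
  set L := C₀ * ((n + 1) ^ 2 * C ^ 2 + C + C ^ 2) * σ with hL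
  have hL0 : 0 ≤ L := by positivity
  have main : ∀ᵐ x, x ∈ Icc p q → DifferentiableAt ℝ (fun x => f x 1) x ∧
      ‖g0 x - lam * f x 0‖ ≤ ‖cutoffTerm m V xb lam s n ξ x‖ + L * ‖f x 0‖ := by
    filter_upwards [W.ae_differentiableAt_phaseDeriv hP hC] with x hx hxI
    have hxU := hU hxI
    obtain ⟨hxd, hxb⟩ := hx hxU
    obtain ⟨h1, h2⟩ := W.dirac_mode_zero hP hξ hxU hxd
    refine ⟨h1, ?_⟩
    simp only [hg0]
    rw [hf, h2, ← hf]
    have hrem := norm_wkb_remainder_le n hC hμ hr (fun k => phaseDeriv m V xb lam s k x)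
      (deriv (phaseDeriv m V xb lam s (n + 1)) x) (logDerivK m V xb lam x)
      (fun k hk => (hP k 0 (by omega)).norm_le hxU) hxb (hκ.norm_le hxU)
    set R := (∑ i ∈ Finset.range (n + 1), ∑ j ∈ Finset.Ico (n - i) (n + 1),
            phaseDeriv m V xb lam s (i + 1) x * phaseDeriv m V xb lam s (j + 1) x)
          - deriv (phaseDeriv m V xb lam s (n + 1)) x
          - logDerivK m V xb lam x * phaseDeriv m V xb lam s (n + 1) x
    have e : ∀ z : ℂ, lam * f x 0 - z - (factorB m V lam x)⁻¹ * R * f x 0 - lam * f x 0 =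
      -(z + (factorB m V lam x)⁻¹ * R * f x 0) := fun z => by ring
    rw [e, norm_neg]
    refine (norm_add_le _ _).trans (add_le_add le_rfl ?_)
    rw [norm_mul, norm_mul]
    refine mul_le_mul_of_nonneg_right ?_ (norm_nonneg _)
    -- The factor r in the bound for the tail cancels against |1/B| ≤ C₀/r.
    refine (mul_le_mul (W.norm_inv_B_le hxU) hrem (norm_nonneg _) (by positivity)).trans_eq ?_
    rw [hL, ← hσ]
    field_simp
  have md : Measurable (deriv fun x => f x 1) := measurable_deriv _
  have m0 : AEStronglyMeasurable (fun x => f x 0) (volume.restrict (Icc p q)) :=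
    (c0.mono hU).aestronglyMeasurable measurableSet_Icc
  have m1 : AEStronglyMeasurable (fun x => f x 1) (volume.restrict (Icc p q)) :=
    (c1.mono hU).aestronglyMeasurable measurableSet_Icc
  have m01 : AEStronglyMeasurable (fun x => V x 0 1) (volume.restrict (Icc p q)) :=
    (W.cont_01.mono hI0).aestronglyMeasurable measurableSet_Icc
  have m00 : AEStronglyMeasurable (fun x => V x 0 0) (volume.restrict (Icc p q)) :=
    ((W.cont_diag 0).mono hI0).aestronglyMeasurable measurableSet_Icc
  have mg0 : AEStronglyMeasurable g0 (volume.restrict (Icc p q)) :=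
    ((md.aestronglyMeasurable.const_mul _).add (m01.mul m1)).add
      ((m00.add aestronglyMeasurable_const).mul m0)
  have bg0 : ∀ᵐ x, x ∈ Icc p q → ‖g0 x‖ ≤ Mc + L * M0 + ‖lam‖ * M0 := by
    filter_upwards [main] with x hx hxI
    have h := (hx hxI).2
    have h1 : ‖g0 x‖ ≤ ‖g0 x - lam * f x 0‖ + ‖lam * f x 0‖ := by
      simpa using norm_add_le (g0 x - lam * f x 0) (lam * f x 0)
    rw [norm_mul] at h1
    have h2 := mul_le_mul_of_nonneg_left (hM0 x hxI) hL0
    have h3 := mul_le_mul_of_nonneg_left (hM0 x hxI) (norm_nonneg lam)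
    linarith [hMc x hxI]
  -- The second entry is exactly λ times that of the mode, so the difference with λΨ has only a
  -- first component.
  refine ⟨fun x => !₂[g0 x, lam * f x 1], ?_, ?_, ⟨?_, ?_⟩, ?_⟩
  · have e : f = fun x => !₂[f x 0, f x 1] := by
      funext x
      ext i
      fin_cases i <;> rfl
    rw [e]
    refine memLp_of_bound_of_eq_zero_off (p := p) (q := q) (M := M0 + M1)
      (aestronglyMeasurable_vec m0 m1) (Eventually.of_forall fun x hx =>
        (norm_vec_le _ _).trans (add_le_add (hM0 x hx) (hM1 x hx))) fun x hx => ?_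
    have hx' : x ∉ Ioo p q := fun h => hx (Ioo_subset_Icc_self h)
    rw [z0 x hx', z1 x hx']
    ext i
    fin_cases i <;> rfl
  · refine memLp_of_bound_of_eq_zero_off (p := p) (q := q)
      (M := Mc + L * M0 + ‖lam‖ * M0 + ‖lam‖ * M1)
      (aestronglyMeasurable_vec mg0 (m1.const_mul _)) ?_ fun x hx => ?_
    · filter_upwards [bg0] with x hx hxI
      refine (norm_vec_le _ _).trans (add_le_add (hx hxI) ?_)
      rw [norm_mul]
      exact mul_le_mul_of_nonneg_left (hM1 x hxI) (norm_nonneg _)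
    · have hx' : x ∉ Ioo p q := fun h => hx (Ioo_subset_Icc_self h)
      simp only [hg0]
      rw [z0 x hx', z1 x hx', zd x hx]
      ext i
      fin_cases i <;> simp
  · have e : (fun x => Complex.I * ((!₂[g0 x, lam * f x 1] : EuclideanSpace ℂ (Fin 2)) 0 -
        (V x 0 1 * f x 1 + (V x 0 0 + m) * f x 0))) = deriv (fun x => f x 1) := by
      funext x
      have e1 : (!₂[g0 x, lam * f x 1] : EuclideanSpace ℂ (Fin 2)) 0 = g0 x := rfl
      rw [e1]
      simp only [hg0]
      linear_combination (-(deriv (fun x => f x 1) x)) * Complex.I_sq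
    rw [e]
    -- A continuously differentiable factor times ξ' - ξP', where the last summand of P' is only
    -- Lipschitz: absolute continuity is the regularity that survives.
    have ac : AbsolutelyContinuousOnInterval (fun x => f x 1) p q := by
      have h1 : AbsolutelyContinuousOnInterval (fun x => -Complex.I * k1 V xb x *
          (factorB m V lam x)⁻¹ * Complex.exp (-phase m V xb lam s (n + 1) x)) p q := by
        have cV : ContinuousOn (fun x => V x 1 0) U := W.cont_10.mono W.subset
        have cB' := W.symbol_B.continuousOn W.convex
        have cB0 : ContinuousOn (factorB m V lam) U := fun x hx =>
          (W.hasDerivAt_B hx).continuousAt.continuousWithinAt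
        refine absolutelyContinuousOnInterval_of_hasDerivAt (fun x hx =>
          (((W.hasDerivAt_k1 (hab hx)).const_mul (-Complex.I)).mul
            ((W.hasDerivAt_B (hab hx)).inv (W.B_ne (hab hx)))).mul
              (W.hasDerivAt_phase hP (hab hx)).neg.cexp) ?_
        refine ContinuousOn.mono ?_ hab
        exact ((((continuousOn_const.mul ((continuousOn_const.mul cV).mul ck1)).mul cB).add
          ((continuousOn_const.mul ck1).mul (cB'.neg.div (cB0.pow 2) fun x hx =>
            pow_ne_zero 2 (W.B_ne hx)))).mul cE).add
          (((continuousOn_const.mul ck1).mul cB).mul (cE.mul cS.neg))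
      have h2 : AbsolutelyContinuousOnInterval (fun x => ((deriv ξ x : ℝ) : ℂ)) p q :=
        absolutelyContinuousOnInterval_of_hasDerivAt
          (fun x _ => ((hξ'.differentiable (by simp)) x).hasDerivAt.ofReal_comp)
          (Complex.continuous_ofReal.comp (hξ'.continuous_deriv (by simp))).continuousOn
      have h3 : AbsolutelyContinuousOnInterval (fun x => (ξ x : ℂ)) p q :=
        absolutelyContinuousOnInterval_of_hasDerivAt
          (fun x _ => (hξd x).hasDerivAt.ofReal_comp)
          (Complex.continuous_ofReal.comp cξ').continuousOn
      have h4 : AbsolutelyContinuousOnInterval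
          (fun x => ∑ k ∈ Finset.range (n + 2), phaseDeriv m V xb lam s k x) p q :=
        AbsolutelyContinuousOnInterval.sum_range fun k hk =>
          W.absolutelyContinuous_phaseDeriv hP (by omega) hab
      have h5 := h1.smul (h2.sub (h3.smul h4))
      rw [absolutelyContinuousOnInterval_iff] at h5 ⊢
      intro ε hε
      obtain ⟨δ, hδ, H⟩ := h5 ε hε
      refine ⟨δ, hδ, fun E hE hl => ?_⟩
      convert H E hE hl using 2 with i hi
      have hm := hE.1 i hi
      rw [hf, W.mode_one_eq hP hξd (hab hm.1), W.mode_one_eq hP hξd (hab hm.2)]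
      rfl
    refine hasWeakDeriv_of_eq_zero_off hp0 hpq ac z1 ?_ zd ?_
    · obtain ⟨K01, hK01⟩ := isCompact_Icc.exists_bound_of_continuousOn (W.cont_01.mono hI0)
      obtain ⟨K00, hK00⟩ := isCompact_Icc.exists_bound_of_continuousOn ((W.cont_diag 0).mono hI0)
      rw [intervalIntegrable_iff_integrableOn_Icc_of_le hpq]
      refine Integrable.of_bound md.aestronglyMeasurable
        (Mc + L * M0 + ‖lam‖ * M0 + K01 * M1 + (K00 + ‖(m : ℂ)‖) * M0) ?_
      rw [ae_restrict_iff' measurableSet_Icc]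
      filter_upwards [bg0] with x hx hxI
      have e1 : ‖deriv (fun x => f x 1) x‖ =
          ‖g0 x - V x 0 1 * f x 1 - (V x 0 0 + m) * f x 0‖ := by
        have : g0 x - V x 0 1 * f x 1 - (V x 0 0 + m) * f x 0 =
          -Complex.I * deriv (fun x => f x 1) x := by
          simp only [hg0]
          ring
        rw [this]
        simp
      rw [e1]
      refine (norm_sub_le _ _).trans (add_le_add ((norm_sub_le _ _).trans
        (add_le_add (hx hxI) ?_)) ?_)
      · rw [norm_mul]
        exact mul_le_mul (hK01 x hxI) (hM1 x hxI) (norm_nonneg _)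
          ((norm_nonneg _).trans (hK01 x hxI))
      · rw [norm_mul]
        exact mul_le_mul ((norm_add_le _ _).trans (add_le_add (hK00 x hxI) le_rfl)) (hM0 x hxI)
          (norm_nonneg _) (add_nonneg ((norm_nonneg _).trans (hK00 x hxI)) (norm_nonneg _))
    · filter_upwards [main] with x hx hxI
      exact (hx hxI).1.hasDerivAt
  · have ac : AbsolutelyContinuousOnInterval (fun x => f x 0) p q := by
      refine absolutelyContinuousOnInterval_of_hasDerivAt
        (fun x hx => W.hasDerivAt_mode_zero hP hξd (hab hx)) (ContinuousOn.mono ?_ hab)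
      exact continuousOn_const.mul ((continuousOn_const.mul c1).sub
        (((W.cont_10.mono W.subset).mul c0).add
          ((((W.cont_diag 1).mono W.subset).sub continuousOn_const).mul c1)))
    refine hasWeakDeriv_of_eq_zero_off hp0 hpq ac z0 ?_ (fun x hx => ?_)
      (Eventually.of_forall fun x hx => W.hasDerivAt_mode_zero hP hξd (hU hx))
    · refine ContinuousOn.intervalIntegrable (ContinuousOn.mono ?_ hab)
      exact continuousOn_const.mul ((continuousOn_const.mul c1).sub
        (((W.cont_10.mono W.subset).mul c0).add
          ((((W.cont_diag 1).mono W.subset).sub continuousOn_const).mul c1)))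
    · have hx' : x ∉ Ioo p q := fun h => hx (Ioo_subset_Icc_self h)
      have e1 : (!₂[g0 x, lam * f x 1] : EuclideanSpace ℂ (Fin 2)) 1 = lam * f x 1 := rfl
      rw [e1, z0 x hx', z1 x hx']
      simp
  · have e : ∀ x, (!₂[g0 x, lam * f x 1] : EuclideanSpace ℂ (Fin 2)) - lam • f x =
        !₂[g0 x - lam * f x 0, 0] := fun x => by
      ext i
      fin_cases i <;> simp
    filter_upwards [main] with x hx
    refine ⟨fun hxI => ?_, fun hxI => ?_⟩
    · rw [e]
      refine (norm_vec_le _ _).trans ?_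
      rw [norm_zero, add_zero]
      refine (hx hxI).2.trans (add_le_add le_rfl ?_)
      exact mul_le_mul_of_nonneg_left (PiLp.norm_apply_le (f x) 0) hL0
    · have hx' : x ∉ Ioo p q := fun h => hxI (Ioo_subset_Icc_self h)
      rw [e]
      simp only [hg0]
      rw [z0 x hx', z1 x hx', zd x hxI]
      ext i
      fin_cases i <;> simp

/-! ### From pointwise bounds to quotients of L² norms -/

theorem eLpNorm_indicator_Icc_le {a b Q : ℝ} (hQ : 0 ≤ Q) (hab : a ≤ b) :
    eLpNorm ((Icc a b).indicator fun _ => Q) 2 (volume.restrict (Ioi (0 : ℝ))) ≤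
      ENNReal.ofReal (Q * √(b - a)) := by
  refine (eLpNorm_indicator_const_le _ _).trans ?_
  rw [ENNReal.ofReal_mul hQ, Real.enorm_of_nonneg hQ, Real.sqrt_eq_rpow]
  refine mul_le_mul' le_rfl ?_
  rw [← ENNReal.ofReal_rpow_of_nonneg (sub_nonneg.mpr hab) (by norm_num), ← Real.volume_Icc]
  norm_num only [ENNReal.toReal_ofNat]
  exact ENNReal.rpow_le_rpow (Measure.restrict_apply_le _ _) (by norm_num)

theorem ofReal_le_eLpNorm_of_le {E : Type*} [NormedAddCommGroup E] {f : ℝ → E} {c d w₀ : ℝ}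
    (hc : 0 < c) (hcd : c ≤ d) (hw₀ : 0 ≤ w₀) (h : ∀ x ∈ Icc c d, w₀ ≤ ‖f x‖) :
    ENNReal.ofReal (w₀ * √(d - c)) ≤ eLpNorm f 2 (volume.restrict (Ioi (0 : ℝ))) := by
  have h1 : eLpNorm ((Icc c d).indicator fun _ => w₀) 2 (volume.restrict (Ioi (0 : ℝ))) ≤
      eLpNorm f 2 (volume.restrict (Ioi (0 : ℝ))) := by
    refine eLpNorm_mono fun x => ?_
    by_cases hx : x ∈ Icc c d
    · rw [indicator_of_mem hx, Real.norm_of_nonneg hw₀]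
      exact h x hx
    · rw [indicator_of_notMem hx, norm_zero]
      exact norm_nonneg _
  refine le_trans (le_of_eq ?_) h1
  have hs : Icc c d ∩ Ioi 0 = Icc c d := inter_eq_left.mpr fun x hx => hc.trans_le hx.1
  rw [eLpNorm_indicator_const measurableSet_Icc (by norm_num) (by norm_num),
    Measure.restrict_apply measurableSet_Icc, hs,
    Real.volume_Icc, Real.enorm_of_nonneg hw₀, ENNReal.ofReal_mul hw₀, Real.sqrt_eq_rpow,
    ← ENNReal.ofReal_rpow_of_nonneg (sub_nonneg.mpr hcd) (by norm_num)]
  norm_num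

/-- From pointwise bounds to the quotient of norms. -/
theorem norm_sub_smul_le_of_pointwise {E : Type*} [NormedAddCommGroup E] [NormedSpace ℂ E]
    {f G : ℝ → E} {lam : ℂ} {cut : ℝ → ℂ}
    (hf : MemLp f 2 (volume.restrict (Ioi (0 : ℝ))))
    (hG : MemLp G 2 (volume.restrict (Ioi (0 : ℝ)))) {p q K a₁ b₁ a₂ b₂ Q₁ Q₂ c d w₀ L : ℝ}
    (hK : 0 ≤ K) (hQ₁ : 0 ≤ Q₁) (hQ₂ : 0 ≤ Q₂) (h₁ : a₁ ≤ b₁) (h₂ : a₂ ≤ b₂) (hc : 0 < c)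
    (hcd : c < d) (hw₀ : 0 < w₀) (hL : 0 ≤ L) (hL₁ : b₁ - a₁ ≤ L ^ 2 * (d - c))
    (hL₂ : b₂ - a₂ ≤ L ^ 2 * (d - c))
    (h : ∀ᵐ x, (x ∈ Icc p q → ‖G x - lam • f x‖ ≤ ‖cut x‖ + K * ‖f x‖) ∧
      (x ∉ Icc p q → G x - lam • f x = 0))
    (hcut : ∀ x ∈ Icc p q, ‖cut x‖ ≤
      (Icc a₁ b₁).indicator (fun _ => Q₁) x + (Icc a₂ b₂).indicator (fun _ => Q₂) x)
    (hlow : ∀ x ∈ Icc c d, w₀ ≤ ‖f x‖) :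
    hf.toLp f ≠ 0 ∧ ‖hG.toLp G - lam • hf.toLp f‖ / ‖hf.toLp f‖ ≤ (Q₁ + Q₂) * L / w₀ + K := by
  set ν := volume.restrict (Ioi (0 : ℝ)) with hν
  set D := ‖hf.toLp f‖ with hD
  have hDe : eLpNorm f 2 ν = ENNReal.ofReal D := by
    rw [hD, Lp.norm_toLp, ENNReal.ofReal_toReal hf.eLpNorm_ne_top]
  have hsq : 0 < √(d - c) := Real.sqrt_pos.mpr (sub_pos.mpr hcd)
  have hDlow : w₀ * √(d - c) ≤ D := by
    have := ofReal_le_eLpNorm_of_le hc hcd.le hw₀.le hlow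
    rw [← hν, hDe] at this
    exact (ENNReal.ofReal_le_ofReal_iff (norm_nonneg _)).mp this
  have hDpos : 0 < D := (mul_pos hw₀ hsq).trans_le hDlow
  refine ⟨norm_pos_iff.mp hDpos, ?_⟩
  have hnum : ‖hG.toLp G - lam • hf.toLp f‖ ≤ Q₁ * √(b₁ - a₁) + Q₂ * √(b₂ - a₂) + K * D := by
    have e : hG.toLp G - lam • hf.toLp f = (hG.sub (hf.const_smul lam)).toLp _ := by
      rw [MemLp.toLp_sub hG (hf.const_smul lam), MemLp.toLp_const_smul]
    rw [e, Lp.norm_toLp]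
    refine ENNReal.toReal_le_of_le_ofReal (by positivity) ?_
    have hb : ∀ᵐ x ∂ν, ‖(G - lam • f) x‖ ≤ ((Icc a₁ b₁).indicator (fun _ => Q₁) +
        (Icc a₂ b₂).indicator (fun _ => Q₂) + fun x => K * ‖f x‖) x := by
      refine ae_restrict_of_ae ?_
      filter_upwards [h] with x hx
      simp only [Pi.sub_apply, Pi.smul_apply, Pi.add_apply]
      by_cases hxI : x ∈ Icc p q
      · exact (hx.1 hxI).trans (add_le_add (hcut x hxI) le_rfl)
      · rw [hx.2 hxI, norm_zero]
        have i1 : 0 ≤ (Icc a₁ b₁).indicator (fun _ => Q₁) x := indicator_nonneg (fun _ _ => hQ₁) x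
        have i2 : 0 ≤ (Icc a₂ b₂).indicator (fun _ => Q₂) x := indicator_nonneg (fun _ _ => hQ₂) x
        positivity
    refine (eLpNorm_mono_ae_real hb).trans ?_
    have m1 : AEStronglyMeasurable ((Icc a₁ b₁).indicator (fun _ => Q₁)) ν :=
      aestronglyMeasurable_const.indicator measurableSet_Icc
    have m2 : AEStronglyMeasurable ((Icc a₂ b₂).indicator (fun _ => Q₂)) ν :=
      aestronglyMeasurable_const.indicator measurableSet_Icc
    have m3 : AEStronglyMeasurable (fun x => K * ‖f x‖) ν := hf.1.norm.const_mul K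
    refine (eLpNorm_add_le (m1.add m2) m3 (by norm_num)).trans ?_
    rw [ENNReal.ofReal_add (by positivity) (by positivity),
      ENNReal.ofReal_add (by positivity) (by positivity)]
    refine add_le_add ((eLpNorm_add_le m1 m2 (by norm_num)).trans (add_le_add
      (eLpNorm_indicator_Icc_le hQ₁ h₁) (eLpNorm_indicator_Icc_le hQ₂ h₂))) ?_
    have e3 : (fun x => K * ‖f x‖) = K • fun x => ‖f x‖ := rfl
    rw [e3, eLpNorm_const_smul, eLpNorm_norm, hDe, ENNReal.ofReal_mul hK,
      Real.enorm_of_nonneg hK]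
  have hs : ∀ a b : ℝ, b - a ≤ L ^ 2 * (d - c) → √(b - a) ≤ L / w₀ * D := by
    intro a b hab
    calc √(b - a) ≤ √(L ^ 2 * (d - c)) := Real.sqrt_le_sqrt hab
      _ = L * √(d - c) := by rw [Real.sqrt_mul (sq_nonneg L), Real.sqrt_sq hL]
      _ = L / w₀ * (w₀ * √(d - c)) := by field_simp
      _ ≤ _ := by gcongr
  rw [div_le_iff₀ hDpos]
  refine hnum.trans ?_
  have e1 := mul_le_mul_of_nonneg_left (hs a₁ b₁ hL₁) hQ₁
  have e2 := mul_le_mul_of_nonneg_left (hs a₂ b₂ hL₂) hQ₂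
  calc _ ≤ Q₁ * (L / w₀ * D) + Q₂ * (L / w₀ * D) + K * D := by linarith
    _ = _ := by ring

/-! ### The size of the pseudomode -/

namespace WindowData

variable {m : ℝ} {V : ℝ → Matrix (Fin 2) (Fin 2) ℂ} {xb : ℝ} {lam s : ℂ} {n : ℕ}
    {U : Set ℝ} {μ r C₀ C : ℝ} (W : WindowData m V xb lam s n U μ r C₀)

include W

/-- The first transport equation reads 2p_1 = (log(p_0 K_λ))', so the left-hand side has derivative
zero on the interval U. -/
theorem exp_neg_integral_phaseDeriv_one
    (hc : ContinuousOn (phaseDeriv m V xb lam s 1) U) {x : ℝ} (hx : x ∈ U) :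
    phaseDeriv m V xb lam s 0 x * Klam m V xb lam x *
        Complex.exp (-(2 * ∫ t in xb..x, phaseDeriv m V xb lam s 1 t)) =
      phaseDeriv m V xb lam s 0 xb * Klam m V xb lam xb := by
  set g : ℝ → ℂ := fun x => phaseDeriv m V xb lam s 0 x * Klam m V xb lam x *
        Complex.exp (-(2 * ∫ t in xb..x, phaseDeriv m V xb lam s 1 t)) with hg
  have hd : ∀ y ∈ U, HasDerivAt g 0 y := by
    intro y hy
    have hi : HasDerivAt (fun x => ∫ t in xb..x, phaseDeriv m V xb lam s 1 t)
        (phaseDeriv m V xb lam s 1 y) y :=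
      intervalIntegral.integral_hasDerivAt_right
        ((hc.mono (W.convex.ordConnected.uIcc_subset W.mem hy)).intervalIntegrable)
        (hc.stronglyMeasurableAtFilter W.isOpen y hy) (hc.continuousAt (W.isOpen.mem_nhds hy))
    have h1 := ((W.hasDerivAt_phaseDeriv_zero hy).mul (W.hasDerivAt_K hy)).mul
      (hi.const_mul 2).neg.cexp
    refine h1.congr_deriv ?_
    have h0 := W.phaseDeriv_zero_ne hy
    have e := phaseDeriv_succ (m := m) (V := V) (xb := xb) W.lam_ne s 0 y
    rw [zero_add, (W.hasDerivAt_phaseDeriv_zero hy).deriv, W.logDerivK_eq hy, Finset.range_zero,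
      Finset.sum_empty] at e
    simp only [Pi.mul_apply, Pi.neg_apply]
    rw [e]
    field_simp
    ring
  have := W.convex.norm_image_sub_le_of_norm_hasDerivWithin_le (C := 0)
    (fun y hy => (hd y hy).hasDerivWithinAt) (fun y _ => by simp) W.mem hx
  rw [zero_mul, norm_le_zero_iff, sub_eq_zero] at this
  rw [hg] at this
  simpa using this

/-- Squaring avoids choosing a root of the exact contribution of p_1. That contribution contains
k₂/k₁, which turns k₁² into k₁k₂, so in modulus only Im V₁₂ + Im V₂₁ matters. -/
theorem sq_weight_eq (hP : ∀ k i, k + i ≤ n →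
      SymbolOn U μ i (C * (μ ^ (k + 1) / r ^ k)) (phaseDeriv m V xb lam s (k + 1)))
    {x : ℝ} (hx : x ∈ U) :
    (k1 V xb x * Complex.exp (-phase m V xb lam s (n + 1) x)) ^ 2 =
      (k1 V xb x * k2 V xb x) * ((phaseDeriv m V xb lam s 0 xb * factorB m V lam x) /
        (phaseDeriv m V xb lam s 0 x * factorB m V lam xb)) *
      Complex.exp (-2 * ∫ t in xb..x, phaseDeriv m V xb lam s 0 t) *
      Complex.exp (-2 * ∑ k ∈ Finset.range n, ∫ t in xb..x, phaseDeriv m V xb lam s (k + 2) t) := by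
  have h1 := W.exp_neg_integral_phaseDeriv_one (W.continuousOn_phaseDeriv hP (by omega)) hx
  have e0 : k1 V xb xb = 1 := by simp [k1]
  have e0' : k2 V xb xb = 1 := by simp [k2]
  have hk1 : k1 V xb x ≠ 0 := Complex.exp_ne_zero _
  have hk2 : k2 V xb x ≠ 0 := Complex.exp_ne_zero _
  have hB := W.B_ne hx
  have hBb := W.B_ne W.mem
  have hp := W.phaseDeriv_zero_ne hx
  have hK : ∀ y, Klam m V xb lam y = k1 V xb y / k2 V xb y * (1 / factorB m V lam y) := fun y => rfl
  rw [hK, hK, e0, e0'] at h1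
  have ephase : phase m V xb lam s (n + 1) x = (∫ t in xb..x, phaseDeriv m V xb lam s 0 t) +
      (∫ t in xb..x, phaseDeriv m V xb lam s 1 t) +
      ∑ k ∈ Finset.range n, ∫ t in xb..x, phaseDeriv m V xb lam s (k + 2) t := by
    rw [phase_eq, Finset.sum_range_succ', Finset.sum_range_succ']
    ring
  rw [ephase, mul_pow, ← Complex.exp_nat_mul]
  set I0 := ∫ t in xb..x, phaseDeriv m V xb lam s 0 t
  set I1 := ∫ t in xb..x, phaseDeriv m V xb lam s 1 t
  set I2 := ∑ k ∈ Finset.range n, ∫ t in xb..x, phaseDeriv m V xb lam s (k + 2) t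
  have e3 : Complex.exp ((2 : ℕ) * -(I0 + I1 + I2)) =
      Complex.exp (-2 * I0) * Complex.exp (-(2 * I1)) * Complex.exp (-2 * I2) := by
    rw [← Complex.exp_add, ← Complex.exp_add]
    congr 1
    push_cast
    ring
  have e4 : Complex.exp (-(2 * I1)) = (phaseDeriv m V xb lam s 0 xb * factorB m V lam x *
      k2 V xb x) / (phaseDeriv m V xb lam s 0 x * factorB m V lam xb * k1 V xb x) := by
    field_simp at h1 ⊢
    linear_combination h1
  rw [e3, e4]
  field_simp

theorem norm_k1_mul_k2 {x : ℝ} (hx : x ∈ U) : ‖k1 V xb x * k2 V xb x‖ =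
    Real.exp (∫ t in xb..x, ((V t 0 1).im + (V t 1 0).im)) := by
  have hs : uIcc xb x ⊆ Ioi 0 := (W.convex.ordConnected.uIcc_subset W.mem hx).trans W.subset
  have i1 := (W.cont_10.mono hs).intervalIntegrable (μ := volume)
  have i2 := (W.cont_01.mono hs).intervalIntegrable (μ := volume)
  have r1 : (∫ t in xb..x, V t 1 0).im = ∫ t in xb..x, (V t 1 0).im :=
    (Complex.imCLM.intervalIntegral_comp_comm i1).symm
  have r2 : (∫ t in xb..x, V t 0 1).im = ∫ t in xb..x, (V t 0 1).im :=
    (Complex.imCLM.intervalIntegral_comp_comm i2).symm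
  have i1' : IntervalIntegrable (fun t => (V t 1 0).im) volume xb x := ⟨i1.1.im, i1.2.im⟩
  have i2' : IntervalIntegrable (fun t => (V t 0 1).im) volume xb x := ⟨i2.1.im, i2.2.im⟩
  rw [k1, k2, ← Complex.exp_add, Complex.norm_exp, intervalIntegral.integral_add i2' i1', ← r1,
    ← r2]
  congr 1
  simp
  ring

theorem norm_phaseDeriv_zero_sq (x : ℝ) : ‖phaseDeriv m V xb lam s 0 x‖ ^ 2 =
    ‖factorA m V lam x‖ * ‖factorB m V lam x‖ := by
  rw [← norm_pow, W.phaseDeriv_zero_sq, norm_neg, norm_mul]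

/-- Two-sided bound for the ratio that comes from the first transport equation. -/
theorem ratio_le {Λ : ℝ} (hΛ : ∀ x ∈ U, ‖factorA m V lam x‖ ≤ Λ ∧ ‖factorB m V lam x‖ ≤ Λ) {x y : ℝ}
    (hx : x ∈ U) (hy : y ∈ U) :
    ‖phaseDeriv m V xb lam s 0 y * factorB m V lam x‖ ≤ (Λ * C₀ / r) ^ 2 *
      ‖phaseDeriv m V xb lam s 0 x * factorB m V lam y‖ := by
  have hr := W.r_pos
  have hC₀ := W.const_pos
  have hΛ0 : 0 ≤ Λ := (norm_nonneg _).trans (hΛ x hx).1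
  have up : ∀ z ∈ U, ‖phaseDeriv m V xb lam s 0 z‖ ≤ Λ := fun z hz => by
    refine abs_le_of_sq_le_sq' ?_ hΛ0 |>.2
    rw [W.norm_phaseDeriv_zero_sq, sq]
    exact mul_le_mul (hΛ z hz).1 (hΛ z hz).2 (norm_nonneg _) hΛ0
  have low : ∀ z ∈ U, r / C₀ ≤ ‖phaseDeriv m V xb lam s 0 z‖ := fun z hz => by
    refine abs_le_of_sq_le_sq' ?_ (norm_nonneg _) |>.2
    rw [W.norm_phaseDeriv_zero_sq, sq]
    exact mul_le_mul (W.norm_A_ge hz) (W.norm_B_ge hz) (by positivity) (norm_nonneg _)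
  rw [norm_mul, norm_mul]
  calc _ ≤ Λ * Λ := mul_le_mul (up y hy) (hΛ x hx).2 (norm_nonneg _) hΛ0
    _ = (Λ * C₀ / r) ^ 2 * (r / C₀ * (r / C₀)) := by field_simp
    _ ≤ _ := by
        gcongr
        · exact low x hx
        · exact W.norm_B_ge hy

theorem ratio_bounds {Λ : ℝ} (hΛ : ∀ x ∈ U, ‖factorA m V lam x‖ ≤ Λ ∧ ‖factorB m V lam x‖ ≤ Λ)
    {x : ℝ} (hx : x ∈ U) :
    ‖(phaseDeriv m V xb lam s 0 xb * factorB m V lam x) /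
        (phaseDeriv m V xb lam s 0 x * factorB m V lam xb)‖ ≤ (Λ * C₀ / r) ^ 2 ∧
    1 ≤ (Λ * C₀ / r) ^ 2 * ‖(phaseDeriv m V xb lam s 0 xb * factorB m V lam x) /
        (phaseDeriv m V xb lam s 0 x * factorB m V lam xb)‖ := by
  have h0 : 0 < ‖phaseDeriv m V xb lam s 0 x * factorB m V lam xb‖ :=
    norm_pos_iff.mpr (mul_ne_zero (W.phaseDeriv_zero_ne hx) (W.B_ne W.mem))
  refine ⟨?_, ?_⟩
  · rw [norm_div, div_le_iff₀ h0]
    exact W.ratio_le hΛ hx W.mem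
  · rw [norm_div, ← mul_div_assoc, one_le_div h0]
    exact W.ratio_le hΛ W.mem hx

omit W in
-- The equation rearranges to X(X - P) = (Q - X)Y, and the signs of the two sides agree only for P ≤
-- X ≤ Q. It is applied to X = (Re √(AB))², P = ab and Q = ((a + b)/2)², with a, b the real parts of
-- sA, sB.
theorem le_and_le_of_mul_eq {X P Y Q : ℝ} (hP : 0 < P) (hX : 0 ≤ X) (hY : 0 ≤ Y) (hQ : P ≤ Q)
    (h0 : 0 ≤ X - (P - Y)) (h : X * (X - (P - Y)) = Q * Y) : P ≤ X ∧ X ≤ Q := by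
  have e : X * (X - (P - Y)) = X * (X - P) + X * Y := by ring
  rw [e] at h
  have h1 : P ≤ X := by
    by_contra hlt
    push Not at hlt
    have hY0 : 0 < Y := by linarith
    have h2 : X * (X - P) ≤ 0 := mul_nonpos_of_nonneg_of_nonpos hX (by linarith)
    have h3 : X * Y < Q * Y := mul_lt_mul_of_pos_right (hlt.trans_le hQ) hY0
    linarith
  refine ⟨h1, ?_⟩
  by_contra hlt
  push Not at hlt
  have h2 : 0 < X * (X - P) := mul_pos (hP.trans_le h1) (by linarith)
  have h3 : Q * Y ≤ X * Y := mul_le_mul_of_nonneg_right hlt.le hY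
  linarith

/-- The sign and the size of the real part of the leading term of the phase. -/
theorem re_phaseDeriv_zero {x : ℝ} (hx : x ∈ U)
    (hA : (s * factorA m V lam x).re ≤ C₀ * r) (hB : (s * factorB m V lam x).re ≤ C₀ * r) :
    ∃ θ : ℝ, 1 ≤ θ ∧ θ ≤ C₀ ^ 2 ∧
      (phaseDeriv m V xb lam s 0 x).re = -θ * (factorA m V lam x).im := by
  have hr := W.r_pos
  have hC₀ := W.const_pos
  have hA0 := W.re_A_pos hx
  have hB0 := W.re_B_pos hx
  have hA1 := W.re_A x hx
  have hB1 := W.re_B x hx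
  set A := factorA m V lam x
  set B := factorB m V lam x
  have him : A.im = B.im := W.im_eq x hx
  set y := A.im with hy
  set a := (s * A).re with ha
  set b := (s * B).re with hb
  obtain ⟨s', hs', hs2, hAr, hBr⟩ : ∃ s' : ℝ, s = (s' : ℂ) ∧ s' ^ 2 = 1 ∧ a = s' * A.re ∧
      b = s' * B.re := by
    rcases W.sign with h | h
    · exact ⟨1, by simp [h], by norm_num, by simp [ha, h], by simp [hb, h]⟩
    · exact ⟨-1, by simp [h], by norm_num, by simp [ha, h], by simp [hb, h]⟩
  set w : ℂ := (A * B) ^ (1 / 2 : ℂ) with hw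
  have hw2 : w ^ 2 = A * B := by
    rw [hw, one_div, ← Nat.cast_ofNat (R := ℂ), Complex.cpow_nat_inv_pow _ two_ne_zero]
  have hABre : (A * B).re = a * b - y ^ 2 := by
    rw [Complex.mul_re, ← him, hAr, hBr]
    linear_combination (-(A.re * B.re)) * hs2
  have hABim : (A * B).im = s' * (a + b) * y := by
    rw [Complex.mul_im, ← him, hAr, hBr]
    linear_combination (-(A.re + B.re) * y) * hs2
  have hre : w.re ^ 2 - w.im ^ 2 = a * b - y ^ 2 := by
    rw [← hABre, ← hw2, sq w, Complex.mul_re]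
    ring
  have him2 : 2 * w.re * w.im = s' * (a + b) * y := by
    rw [← hABim, ← hw2, sq w, Complex.mul_im]
    ring
  have hnn : 0 ≤ w.re := by
    have hne : A * B ≠ 0 := mul_ne_zero (W.A_ne hx) (W.B_ne hx)
    rw [hw, Complex.cpow_def_of_ne_zero hne, Complex.exp_re]
    refine mul_nonneg (Real.exp_pos _).le (Real.cos_nonneg_of_mem_Icc ?_)
    have e : (Complex.log (A * B) * (1 / 2 : ℂ)).im = Complex.arg (A * B) / 2 := by
      rw [Complex.mul_im]
      simp [Complex.log_im]
      ring
    rw [e]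
    constructor <;> linarith [Complex.neg_pi_lt_arg (A * B), Complex.arg_le_pi (A * B)]
  have h4 : (w.re ^ 2) * (w.re ^ 2 - (a * b - y ^ 2)) = ((a + b) / 2) ^ 2 * y ^ 2 := by
    have : w.re ^ 2 - (a * b - y ^ 2) = w.im ^ 2 := by linarith
    rw [this]
    have h : (2 * w.re * w.im) ^ 2 = (s' * (a + b) * y) ^ 2 := by rw [him2]
    have : (s' * (a + b) * y) ^ 2 = (a + b) ^ 2 * y ^ 2 := by
      rw [mul_pow, mul_pow, hs2, one_mul]
    rw [this] at h
    linear_combination h / 4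
  have hab : 0 < a * b := mul_pos hA0 hB0
  have hQ : a * b ≤ ((a + b) / 2) ^ 2 := by nlinarith [sq_nonneg (a - b)]
  have him3 : 0 ≤ w.re ^ 2 - (a * b - y ^ 2) := by
    have := sq_nonneg w.im
    linarith
  obtain ⟨hlow, hup⟩ := le_and_le_of_mul_eq hab (sq_nonneg w.re) (sq_nonneg y) hQ him3 h4
  have hwpos : 0 < w.re := by
    rcases hnn.lt_or_eq with h | h
    · exact h
    · rw [← h] at hlow
      nlinarith
  -- From 2 Re w Im w = s(a + b)y, the imaginary part of w is sθy with this θ. The bound Re w ≤ (a +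
  -- b)/2 gives θ ≥ 1; the bounds Re w ≥ √(ab) ≥ r/C₀ and a, b ≤ C₀r give θ ≤ C₀².
  refine ⟨(a + b) / 2 / w.re, ?_, ?_, ?_⟩
  · rw [one_le_div hwpos]
    exact abs_le_of_sq_le_sq' hup (by positivity) |>.2
  · rw [div_le_iff₀ hwpos]
    have h1 : r / C₀ ≤ w.re := by
      refine abs_le_of_sq_le_sq' (le_trans ?_ hlow) hnn |>.2
      rw [sq]
      refine mul_le_mul ?_ ?_ (by positivity) hA0.le
      · rwa [div_le_iff₀' hC₀]
      · rwa [div_le_iff₀' hC₀]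
    calc (a + b) / 2 ≤ C₀ * r := by linarith
      _ = C₀ ^ 2 * (r / C₀) := by field_simp
      _ ≤ _ := by gcongr
  · rw [phaseDeriv_zero W.lam_ne]
    have e : (s * Complex.I * w).re = -s' * w.im := by
      rw [hs']
      simp
    change (s * Complex.I * w).re = _
    rw [e]
    field_simp
    linear_combination -s' * him2 - (a + b) * y * hs2

end WindowData

/-- Comparison of two primitives based at a point where the integrand changes sign. -/
theorem integral_le_integral_of_sign {f g : ℝ → ℝ} {a x : ℝ}
    (hf : IntervalIntegrable f volume a x) (hg : IntervalIntegrable g volume a x)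
    (h₁ : ∀ t ∈ uIcc a x, a ≤ t → f t ≤ g t) (h₂ : ∀ t ∈ uIcc a x, t ≤ a → g t ≤ f t) :
    ∫ t in a..x, f t ≤ ∫ t in a..x, g t := by
  rcases le_total a x with h | h
  · refine intervalIntegral.integral_mono_on h hf hg fun t ht => h₁ t ?_ ht.1
    rwa [uIcc_of_le h]
  · rw [intervalIntegral.integral_symm x a, intervalIntegral.integral_symm x a, neg_le_neg_iff]
    refine intervalIntegral.integral_mono_on h hg.symm hf.symm fun t ht => h₂ t ?_ ht.2
    rwa [uIcc_of_ge h]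

namespace WindowData

variable {m : ℝ} {V : ℝ → Matrix (Fin 2) (Fin 2) ℂ} {xb : ℝ} {lam s : ℂ} {n : ℕ}
    {U : Set ℝ} {μ r C₀ C : ℝ} (W : WindowData m V xb lam s n U μ r C₀)

include W

/-- Re p_0 = θ(𝒱 - β) changes sign at the turning point together with 𝒱 - β, so the pointwise
comparison integrates on either side of it. The constant 1 in the lower bound is essential for
reaching every c < 1. -/
theorem re_integral_phaseDeriv_zero {β : ℝ} (hlam : lam.im = β)
    (hA : ∀ x ∈ U, (s * factorA m V lam x).re ≤ C₀ * r)
    (hB : ∀ x ∈ U, (s * factorB m V lam x).re ≤ C₀ * r)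
    (hge : ∀ t ∈ U, xb ≤ t → β ≤ imDiag V t) (hle : ∀ t ∈ U, t ≤ xb → imDiag V t ≤ β)
    {x : ℝ} (hx : x ∈ U) :
    ∫ t in xb..x, (imDiag V t - β) ≤ (∫ t in xb..x, phaseDeriv m V xb lam s 0 t).re ∧
    (∫ t in xb..x, phaseDeriv m V xb lam s 0 t).re ≤
      C₀ ^ 2 * ∫ t in xb..x, (imDiag V t - β) := by
  have hs : uIcc xb x ⊆ U := W.convex.ordConnected.uIcc_subset W.mem hx
  have ip := (W.continuousOn_phaseDeriv_zero.mono hs).intervalIntegrable (μ := volume)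
  have ip' : IntervalIntegrable (fun t => (phaseDeriv m V xb lam s 0 t).re) volume xb x :=
    ⟨ip.1.re, ip.2.re⟩
  have cF : ContinuousOn (fun t => imDiag V t - β) (uIcc xb x) :=
    ((Complex.continuous_im.comp_continuousOn ((W.cont_diag 0).mono
      (hs.trans W.subset))).sub continuousOn_const)
  have iF := cF.intervalIntegrable (μ := volume)
  have e : (∫ t in xb..x, phaseDeriv m V xb lam s 0 t).re =
      ∫ t in xb..x, (phaseDeriv m V xb lam s 0 t).re :=
    (Complex.reCLM.intervalIntegral_comp_comm ip).symm
  have him : ∀ t, (factorA m V lam t).im = β - imDiag V t := fun t => by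
    simp [factorA, imDiag, hlam]
  rw [e, ← intervalIntegral.integral_const_mul]
  constructor
  · refine integral_le_integral_of_sign iF ip' (fun t ht h => ?_) fun t ht h => ?_
    · obtain ⟨θ, h1, -, h3⟩ := W.re_phaseDeriv_zero (hs ht) (hA t (hs ht)) (hB t (hs ht))
      rw [h3, him]
      have := hge t (hs ht) h
      nlinarith
    · obtain ⟨θ, h1, -, h3⟩ := W.re_phaseDeriv_zero (hs ht) (hA t (hs ht)) (hB t (hs ht))
      rw [h3, him]
      have := hle t (hs ht) h
      nlinarith
  · refine integral_le_integral_of_sign ip' (iF.const_mul _) (fun t ht h => ?_) fun t ht h => ?_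
    · obtain ⟨θ, -, h2, h3⟩ := W.re_phaseDeriv_zero (hs ht) (hA t (hs ht)) (hB t (hs ht))
      rw [h3, him]
      have := hge t (hs ht) h
      nlinarith
    · obtain ⟨θ, -, h2, h3⟩ := W.re_phaseDeriv_zero (hs ht) (hA t (hs ht)) (hB t (hs ht))
      rw [h3, him]
      have := hle t (hs ht) h
      nlinarith

/-- Two-sided bounds for the modulus of the first component of the pseudomode. -/
theorem weight_bounds (hP : ∀ k i, k + i ≤ n →
      SymbolOn U μ i (C * (μ ^ (k + 1) / r ^ k)) (phaseDeriv m V xb lam s (k + 1)))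
    {β Λ e₁ e₂ : ℝ} (hlam : lam.im = β)
    (hΛ : ∀ x ∈ U, ‖factorA m V lam x‖ ≤ Λ ∧ ‖factorB m V lam x‖ ≤ Λ)
    (hA : ∀ x ∈ U, (s * factorA m V lam x).re ≤ C₀ * r)
    (hB : ∀ x ∈ U, (s * factorB m V lam x).re ≤ C₀ * r)
    (hge : ∀ t ∈ U, xb ≤ t → β ≤ imDiag V t) (hle : ∀ t ∈ U, t ≤ xb → imDiag V t ≤ β)
    {x : ℝ} (hx : x ∈ U)
    (he₁ : |∫ t in xb..x, ((V t 0 1).im + (V t 1 0).im)| ≤ e₁)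
    (he₂ : ∀ k < n, C * (μ ^ (k + 2) / r ^ (k + 1)) * |x - xb| ≤ e₂) :
    ‖k1 V xb x * Complex.exp (-phase m V xb lam s (n + 1) x)‖ ^ 2 ≤ (Λ * C₀ / r) ^ 2 *
      Real.exp (e₁ + 2 * (n * e₂) - 2 * ∫ t in xb..x, (imDiag V t - β)) ∧
    Real.exp (-(e₁ + 2 * (n * e₂)) - 2 * (C₀ ^ 2 * ∫ t in xb..x, (imDiag V t - β))) ≤
      (Λ * C₀ / r) ^ 2 *
        ‖k1 V xb x * Complex.exp (-phase m V xb lam s (n + 1) x)‖ ^ 2 := by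
  obtain ⟨f1, f2⟩ := W.re_integral_phaseDeriv_zero hlam hA hB hge hle hx
  obtain ⟨r1, r2⟩ := W.ratio_bounds hΛ hx
  set F := ∫ t in xb..x, (imDiag V t - β)
  -- The terms p_2, ..., p_{n+1} are estimated by sup norm times distance to the turning point.
  have hsum : ‖∑ k ∈ Finset.range n, ∫ t in xb..x, phaseDeriv m V xb lam s (k + 2) t‖ ≤
      n * e₂ := by
    refine (norm_sum_le_of_le _ (f := fun k => ∫ t in xb..x, phaseDeriv m V xb lam s (k + 2) t)
      (n := fun _ => e₂) fun k hk => ?_).trans_eq (by simp)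
    have hk' := Finset.mem_range.mp hk
    refine (intervalIntegral.norm_integral_le_of_norm_le_const fun t ht => ?_).trans (he₂ k hk')
    exact (hP (k + 1) 0 (by omega)).norm_le
      (W.convex.ordConnected.uIcc_subset W.mem hx (uIoc_subset_uIcc ht))
  set S := ∑ k ∈ Finset.range n, ∫ t in xb..x, phaseDeriv m V xb lam s (k + 2) t
  set I0 := ∫ t in xb..x, phaseDeriv m V xb lam s 0 t
  set I1 := ∫ t in xb..x, ((V t 0 1).im + (V t 1 0).im)
  set Q := (Λ * C₀ / r) ^ 2
  set ρ := ‖(phaseDeriv m V xb lam s 0 xb * factorB m V lam x) /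
        (phaseDeriv m V xb lam s 0 x * factorB m V lam xb)‖
  have hSre := (abs_le.mp ((Complex.abs_re_le_norm S).trans hsum))
  have hI1 := abs_le.mp he₁
  have key : ‖k1 V xb x * Complex.exp (-phase m V xb lam s (n + 1) x)‖ ^ 2 =
      ρ * Real.exp (I1 - 2 * I0.re - 2 * S.re) := by
    rw [← norm_pow, W.sq_weight_eq hP hx, norm_mul, norm_mul, norm_mul, W.norm_k1_mul_k2 hx,
      Complex.norm_exp, Complex.norm_exp]
    have e : Real.exp (I1 - 2 * I0.re - 2 * S.re) =
        Real.exp I1 * Real.exp (-2 * I0).re * Real.exp (-2 * S).re := by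
      rw [← Real.exp_add, ← Real.exp_add]
      congr 1
      simp
      ring
    rw [e]
    ring
  have hQ : 0 ≤ Q := sq_nonneg _
  rw [key]
  constructor
  · refine mul_le_mul r1 (Real.exp_le_exp.mpr ?_) (Real.exp_pos _).le hQ
    linarith [hSre.1, hI1.2]
  · rw [← mul_assoc Q]
    have h1 : Real.exp (-(e₁ + 2 * (n * e₂)) - 2 * (C₀ ^ 2 * F)) ≤
        Real.exp (I1 - 2 * I0.re - 2 * S.re) := Real.exp_le_exp.mpr (by linarith [hSre.2, hI1.1])
    exact h1.trans (le_mul_of_one_le_left (Real.exp_pos _).le r2)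

end WindowData

/-! ### The potential near infinity -/

/-- Explicit form of the assumptions on the potential on `[X, ∞)`; the regularity index is
`N = n + 1`. -/
structure TailBounds (n : ℕ) (ν : ℝ) (V : ℝ → Matrix (Fin 2) (Fin 2) ℂ) (X C : ℝ) : Prop where
  one_le_X : 1 ≤ X
  one_le_C : 1 ≤ C
  neg_one_le : -1 ≤ ν
  one_le_n : 1 ≤ n
  primitive_diag : ∀ i, IsIteratedPrimitive (n + 1) (fun x => V x i i)
  primitive_01 : IsIteratedPrimitive n (fun x => V x 0 1)
  primitive_10 : IsIteratedPrimitive n (fun x => V x 1 0)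
  deriv_diag : ∀ i, ∀ j, 1 ≤ j → j ≤ n + 2 → ∀ᵐ x, X ≤ x →
    ‖iteratedDeriv j (fun x => V x i i) x‖ ≤ C * (x ^ (j * ν) * ‖V x i i‖)
  deriv_offDiag : ∀ j ≤ n + 1, ∀ᵐ x, X ≤ x →
    ‖iteratedDeriv j (fun x => V x 1 0 - V x 0 1) x‖ ≤ C * x ^ ((j + 1) * ν)
  im_eq : ∀ x > 0, (V x 0 0).im = (V x 1 1).im
  strictMono : StrictMonoOn (imDiag V) (Ioi 0)
  nonneg : ∀ x ≥ X, 0 ≤ imDiag V x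
  deriv_pos : ∀ x ≥ X, 0 < deriv (imDiag V) x
  deriv_two : ∀ x ≥ X, |deriv (deriv (imDiag V)) x| ≤ C * (x ^ ν * deriv (imDiag V) x)

theorem AdmissiblePotential.exists_tailBounds {n : ℕ} {ν : ℝ}
    {V : ℝ → Matrix (Fin 2) (Fin 2) ℂ} (hn : 1 ≤ n) (hν : -1 ≤ ν)
    (h : AdmissiblePotential (n + 1) ν V) : ∃ X C, TailBounds n ν V X C := by
  obtain ⟨ε₁, hε₁, p, hp, a, ha, x₀, hx₀, hg⟩ := h.growth
  have h1 : ∀ i, ∀ j, ∃ C X : ℝ, 1 ≤ j → j ≤ n + 2 → ∀ᵐ x, X ≤ x →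
      ‖iteratedDeriv j (fun x => V x i i) x‖ ≤ C * (x ^ (j * ν) * ‖V x i i‖) := by
    intro i j
    by_cases hj : 1 ≤ j ∧ j ≤ n + 2
    · obtain ⟨C, hC⟩ := (h.deriv_diag i j (Finset.mem_Icc.mpr ⟨hj.1, by omega⟩)).bound
      obtain ⟨s, hs, t, ht, hst⟩ := hC
      obtain ⟨X, hX⟩ := mem_atTop_sets.mp hs
      refine ⟨C, max X 0, fun _ _ => ?_⟩
      filter_upwards [ht] with x hx hXx
      have hx' : x ∈ s ∩ t := ⟨hX x ((le_max_left _ _).trans hXx), hx⟩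
      rw [← hst] at hx'
      have h2 : ‖iteratedDeriv j (fun x => V x i i) x‖ ≤ C * ‖x ^ (j * ν) * ‖V x i i‖‖ := hx'
      rwa [Real.norm_of_nonneg (mul_nonneg (Real.rpow_nonneg ((le_max_right _ _).trans hXx) _)
        (norm_nonneg _))] at h2
    · exact ⟨0, 0, fun h1 h2 => absurd ⟨h1, h2⟩ hj⟩
  have h2 : ∀ j, ∃ C X : ℝ, j ≤ n + 1 → ∀ᵐ x, X ≤ x →
      ‖iteratedDeriv j (fun x => V x 1 0 - V x 0 1) x‖ ≤ C * x ^ ((j + 1) * ν) := by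
    intro j
    by_cases hj : j ≤ n + 1
    · obtain ⟨C, hC⟩ := (h.deriv_offDiag j (Finset.mem_Icc.mpr ⟨Nat.zero_le _, hj⟩)).bound
      obtain ⟨s, hs, t, ht, hst⟩ := hC
      obtain ⟨X, hX⟩ := mem_atTop_sets.mp hs
      refine ⟨C, max X 0, fun _ => ?_⟩
      filter_upwards [ht] with x hx hXx
      have hx' : x ∈ s ∩ t := ⟨hX x ((le_max_left _ _).trans hXx), hx⟩
      rw [← hst] at hx'
      have h2 : ‖iteratedDeriv j (fun x => V x 1 0 - V x 0 1) x‖ ≤ C * ‖x ^ ((j + 1) * ν)‖ := hx'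
      rwa [Real.norm_of_nonneg (Real.rpow_nonneg ((le_max_right _ _).trans hXx) _)] at h2
    · exact ⟨0, 0, fun h1 => absurd h1 hj⟩
  choose C₁ X₁ H1 using h1
  choose C₂ X₂ H2 using h2
  obtain ⟨X₃, hX₃⟩ := eventually_atTop.mp (h.tendsto.eventually_ge_atTop 0)
  -- Sums of absolute values dominate the finitely many constants and thresholds simultaneously.
  set C := 1 + a⁻¹ + (∑ i, ∑ j ∈ Finset.range (n + 3), |C₁ i j|) +
    ∑ j ∈ Finset.range (n + 2), |C₂ j| with hC
  set X := 1 + x₀ + |X₃| + (∑ i, ∑ j ∈ Finset.range (n + 3), |X₁ i j|) +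
    ∑ j ∈ Finset.range (n + 2), |X₂ j| with hX
  have s1 : ∀ f : Fin 2 → ℕ → ℝ, 0 ≤ ∑ i, ∑ j ∈ Finset.range (n + 3), |f i j| := fun f =>
    Finset.sum_nonneg fun i _ => Finset.sum_nonneg fun j _ => abs_nonneg _
  have s2 : ∀ f : ℕ → ℝ, 0 ≤ ∑ j ∈ Finset.range (n + 2), |f j| := fun f =>
    Finset.sum_nonneg fun j _ => abs_nonneg _
  have s3 : ∀ (f : Fin 2 → ℕ → ℝ) (i : Fin 2) (j : ℕ), j ≤ n + 2 → f i j ≤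
      ∑ i, ∑ j ∈ Finset.range (n + 3), |f i j| := fun f i j hj => by
    refine (le_abs_self _).trans ((Finset.single_le_sum (f := fun j => |f i j|)
      (fun j _ => abs_nonneg _) (Finset.mem_range.mpr (by omega : j < n + 3))).trans ?_)
    exact Finset.single_le_sum (f := fun i => ∑ j ∈ Finset.range (n + 3), |f i j|)
      (fun i _ => Finset.sum_nonneg fun j _ => abs_nonneg _) (Finset.mem_univ i)
  have s4 : ∀ (f : ℕ → ℝ) (j : ℕ), j ≤ n + 1 → f j ≤ ∑ j ∈ Finset.range (n + 2), |f j| :=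
    fun f j hj => (le_abs_self _).trans (Finset.single_le_sum (f := fun j => |f j|)
      (fun j _ => abs_nonneg _) (Finset.mem_range.mpr (by omega : j < n + 2)))
  have ha' : 0 < a⁻¹ := inv_pos.mpr ha
  have hX1 : 1 ≤ X := by linarith [s1 X₁, s2 X₂, abs_nonneg X₃]
  have pos : ∀ x ≥ X, 0 < deriv (imDiag V) x := fun x hx => by
    have hx0 : 0 < x := by linarith
    refine lt_of_lt_of_le ?_ (hg x (by linarith [s1 X₁, s2 X₂, abs_nonneg X₃])).1
    positivity
  refine ⟨X, C, hX1, by linarith [s1 C₁, s2 C₂], hν, hn, fun i => (h.memW_diag i).isIteratedPrimitive,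
    h.memW_12.isIteratedPrimitive, h.memW_21.isIteratedPrimitive, fun i j hj1 hj2 => ?_,
    fun j hj => ?_, h.im_eq, h.strictMono, fun x hx => ?_, pos, fun x hx => ?_⟩
  · filter_upwards [H1 i j hj1 hj2] with x hx hXx
    have hx0 : 0 ≤ x := by linarith
    refine (hx (by linarith [s3 X₁ i j hj2, s2 X₂, abs_nonneg X₃])).trans ?_
    refine mul_le_mul_of_nonneg_right ?_ (mul_nonneg (Real.rpow_nonneg hx0 _) (norm_nonneg _))
    linarith [s3 C₁ i j hj2, s2 C₂]
  · filter_upwards [H2 j hj] with x hx hXx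
    have hx0 : 0 ≤ x := by linarith
    refine (hx (by linarith [s1 X₁, s4 X₂ j hj, abs_nonneg X₃])).trans ?_
    refine mul_le_mul_of_nonneg_right ?_ (Real.rpow_nonneg hx0 _)
    linarith [s1 C₁, s4 C₂ j hj]
  · exact hX₃ x (by linarith [s1 X₁, s2 X₂, le_abs_self X₃])
  · have hx0 : 0 < x := by linarith
    have h3 := (hg x (by linarith [s1 X₁, s2 X₂, abs_nonneg X₃])).2.1
    have e : iteratedDeriv 2 (imDiag V) x = deriv (deriv (imDiag V)) x := by
      rw [iteratedDeriv_succ, iteratedDeriv_one]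
    rw [e, Real.rpow_neg hx0.le] at h3
    have hxν : 0 < x ^ ν := Real.rpow_pos_of_pos hx0 ν
    have h4 : |deriv (deriv (imDiag V)) x| ≤ a⁻¹ * (x ^ ν * deriv (imDiag V) x) := by
      have h5 := mul_le_mul_of_nonneg_left h3 (by positivity : 0 ≤ a⁻¹ * x ^ ν)
      calc _ = a⁻¹ * x ^ ν * (a * (|deriv (deriv (imDiag V)) x| * (x ^ ν)⁻¹)) := by field_simp
        _ ≤ _ := h5
        _ = _ := by ring
    refine h4.trans (mul_le_mul_of_nonneg_right ?_ (mul_nonneg hxν.le (pos x hx).le))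
    linarith [s1 C₁, s2 C₂]

/-! ### The potential on a window around the turning point -/

theorem rpow_le_of_mem_Icc {x y s : ℝ} (hy : 0 < y) (h1 : y / 4 ≤ x) (h2 : x ≤ 4 * y) :
    x ^ s ≤ 4 ^ |s| * y ^ s := by
  have hx : 0 < x := by linarith
  have h3 : (x / y) ^ s ≤ 4 ^ |s| := by
    have hq : 0 < x / y := div_pos hx hy
    have hq1 : x / y ≤ 4 := by rwa [div_le_iff₀ hy]
    have hq2 : (x / y)⁻¹ ≤ 4 := by
      rw [inv_div, div_le_iff₀ hx]
      linarith
    rcases le_total 0 s with hs | hs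
    · rw [abs_of_nonneg hs]
      exact Real.rpow_le_rpow hq.le hq1 hs
    · rw [abs_of_nonpos hs]
      have : (x / y) ^ s = ((x / y)⁻¹) ^ (-s) := by
        rw [Real.inv_rpow hq.le, Real.rpow_neg hq.le, inv_inv]
      rw [this]
      exact Real.rpow_le_rpow (inv_pos.mpr hq).le hq2 (by linarith)
  calc x ^ s = (x / y) ^ s * y ^ s := by
        rw [Real.div_rpow hx.le hy.le, div_mul_cancel₀ _ (Real.rpow_pos_of_pos hy s).ne']
    _ ≤ _ := mul_le_mul_of_nonneg_right h3 (Real.rpow_nonneg hy.le _)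

/-- A neighbourhood of the closed window of half-width `x^{-ν} / 2`. -/
def bigWindow (ν x₀ : ℝ) : Set ℝ :=
  Ioo (x₀ - 3 / 4 * x₀ ^ (-ν)) (x₀ + 3 / 4 * x₀ ^ (-ν))

/-- Here ν ≥ -1 enters: the width of the window is at most x₀, so the enlarged window stays in the
half-line at points comparable to x₀. -/
theorem rpow_neg_le_self {ν x₀ : ℝ} (hν : -1 ≤ ν) (hx : 1 ≤ x₀) : x₀ ^ (-ν) ≤ x₀ := by
  calc x₀ ^ (-ν) ≤ x₀ ^ (1 : ℝ) := Real.rpow_le_rpow_of_exponent_le hx (by linarith)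
    _ = x₀ := Real.rpow_one _

theorem bigWindow_bounds {ν x₀ x : ℝ} (hν : -1 ≤ ν) (hx₀ : 1 ≤ x₀) (hx : x ∈ bigWindow ν x₀) :
    x₀ / 4 ≤ x ∧ x ≤ 4 * x₀ := by
  have := rpow_neg_le_self hν hx₀
  constructor <;> linarith [hx.1, hx.2]

theorem abs_sub_le_of_mem_bigWindow {ν x₀ x : ℝ} (hx : x ∈ bigWindow ν x₀) :
    |x - x₀| ≤ 3 / 4 * x₀ ^ (-ν) := by
  rw [abs_le]
  constructor <;> linarith [hx.1, hx.2]

theorem mem_bigWindow_self {ν x₀ : ℝ} (hx₀ : 0 < x₀) : x₀ ∈ bigWindow ν x₀ := by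
  have : 0 < x₀ ^ (-ν) := Real.rpow_pos_of_pos hx₀ _
  constructor <;> linarith

namespace TailBounds

variable {n : ℕ} {ν : ℝ} {V : ℝ → Matrix (Fin 2) (Fin 2) ℂ} {X C : ℝ} (H : TailBounds n ν V X C)

include H

theorem differentiableAt_diag (i : Fin 2) {x : ℝ} (hx : 0 < x) :
    DifferentiableAt ℝ (fun x => V x i i) x := (H.primitive_diag i).1 x hx

theorem differentiableAt_deriv_diag (i : Fin 2) {x : ℝ} (hx : 0 < x) :
    DifferentiableAt ℝ (deriv fun x => V x i i) x := by
  obtain ⟨k, rfl⟩ : ∃ k, n = k + 1 := ⟨n - 1, by have := H.one_le_n; omega⟩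
  exact (H.primitive_diag i).2.1 x hx

theorem hasDerivAt_imDiag {x : ℝ} (hx : 0 < x) :
    HasDerivAt (imDiag V) (deriv (fun x => V x 0 0) x).im x :=
  Complex.imCLM.hasFDerivAt.comp_hasDerivAt x (H.differentiableAt_diag 0 hx).hasDerivAt

theorem deriv_imDiag {x : ℝ} (hx : 0 < x) :
    deriv (imDiag V) x = (deriv (fun x => V x 0 0) x).im := (H.hasDerivAt_imDiag hx).deriv

theorem differentiableAt_deriv_imDiag {x : ℝ} (hx : 0 < x) :
    DifferentiableAt ℝ (deriv (imDiag V)) x := by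
  have h : HasDerivAt (fun x => (deriv (fun x => V x 0 0) x).im) _ x :=
    Complex.imCLM.hasFDerivAt.comp_hasDerivAt x (H.differentiableAt_deriv_diag 0 hx).hasDerivAt
  refine (h.congr_of_eventuallyEq ?_).differentiableAt
  filter_upwards [Ioi_mem_nhds hx] with y hy
  exact H.deriv_imDiag hy

theorem differentiableAt_imDiag {x : ℝ} (hx : 0 < x) : DifferentiableAt ℝ (imDiag V) x :=
  (H.hasDerivAt_imDiag hx).differentiableAt

theorem le_of_mem_bigWindow {x₀ x : ℝ} (hx₀ : 4 * X ≤ x₀) (hx : x ∈ bigWindow ν x₀) : X ≤ x := by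
  have := bigWindow_bounds H.neg_one_le (by linarith [H.one_le_X]) hx
  linarith [this.1]

/-- `𝒱'` is comparable to its value at the turning point. -/
theorem deriv_imDiag_le {x₀ x y : ℝ} (hx₀ : 4 * X ≤ x₀) (hx : x ∈ bigWindow ν x₀)
    (hy : y ∈ bigWindow ν x₀) : deriv (imDiag V) x ≤
      Real.exp (2 * C * 4 ^ |ν|) * deriv (imDiag V) y := by
  have hX := H.one_le_X
  have hC := H.one_le_C
  have h0 : 0 < x₀ := by linarith
  have hν : 0 < x₀ ^ ν := Real.rpow_pos_of_pos h0 ν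
  have hc : Convex ℝ (bigWindow ν x₀) := convex_Ioo _ _
  have pos : ∀ z ∈ bigWindow ν x₀, 0 < deriv (imDiag V) z := fun z hz =>
    H.deriv_pos z (H.le_of_mem_bigWindow hx₀ hz)
  -- The bound on 𝒱'' makes the logarithmic derivative of 𝒱' at most a multiple of x₀^ν, and two
  -- points of the window are within 2x₀^(-ν). Hence log 𝒱' varies by a bounded amount.
  have hd : ∀ z ∈ bigWindow ν x₀, HasDerivWithinAt (fun z => Real.log (deriv (imDiag V) z))
      (deriv (deriv (imDiag V)) z / deriv (imDiag V) z) (bigWindow ν x₀) z := fun z hz =>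
    ((H.differentiableAt_deriv_imDiag (by linarith [H.le_of_mem_bigWindow hx₀ hz])).hasDerivAt.log
      (pos z hz).ne').hasDerivWithinAt
  have hb : ∀ z ∈ bigWindow ν x₀, ‖deriv (deriv (imDiag V)) z / deriv (imDiag V) z‖ ≤
      C * (4 ^ |ν| * x₀ ^ ν) := fun z hz => by
    have hzX := H.le_of_mem_bigWindow hx₀ hz
    rw [norm_div, Real.norm_eq_abs, Real.norm_of_nonneg (pos z hz).le, div_le_iff₀ (pos z hz)]
    refine (H.deriv_two z hzX).trans ?_
    have hb := bigWindow_bounds H.neg_one_le (by linarith) hz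
    have := rpow_le_of_mem_Icc (s := ν) h0 hb.1 hb.2
    have := pos z hz
    rw [← mul_assoc]
    gcongr
  have h1 := hc.norm_image_sub_le_of_norm_hasDerivWithin_le hd hb hy hx
  have h2 : ‖x - y‖ ≤ 2 * x₀ ^ (-ν) := by
    rw [Real.norm_eq_abs, abs_le]
    have : 0 < x₀ ^ (-ν) := Real.rpow_pos_of_pos h0 _
    constructor <;> linarith [hx.1, hx.2, hy.1, hy.2]
  have h3 : Real.log (deriv (imDiag V) x) - Real.log (deriv (imDiag V) y) ≤ 2 * C * 4 ^ |ν| := by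
    refine (le_abs_self _).trans (h1.trans ?_)
    calc _ ≤ C * (4 ^ |ν| * x₀ ^ ν) * (2 * x₀ ^ (-ν)) := by gcongr
      _ = 2 * C * 4 ^ |ν| * (x₀ ^ ν * x₀ ^ (-ν)) := by ring
      _ = _ := by rw [← Real.rpow_add h0, add_neg_cancel, Real.rpow_zero, mul_one]
  rw [← Real.exp_log (pos x hx), ← Real.exp_log (pos y hy), ← Real.exp_add]
  exact Real.exp_le_exp.mpr (by linarith)

theorem continuousOn_imDiag : ContinuousOn (imDiag V) (Ioi 0) := fun _ hx =>
  (H.differentiableAt_imDiag hx).continuousAt.continuousWithinAt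

/-- Bounds for `𝒱 - β` on the window. -/
theorem imDiag_sub_bounds {x₀ x y : ℝ} (hx₀ : 4 * X ≤ x₀) (hx : x ∈ bigWindow ν x₀)
    (hy : y ∈ bigWindow ν x₀) (hxy : x ≤ y) :
    (Real.exp (2 * C * 4 ^ |ν|))⁻¹ * deriv (imDiag V) x₀ * (y - x) ≤ imDiag V y - imDiag V x ∧
    imDiag V y - imDiag V x ≤ Real.exp (2 * C * 4 ^ |ν|) * deriv (imDiag V) x₀ * (y - x) := by
  have hX := H.one_le_X
  have h0 : 0 < x₀ := by linarith
  have hs := mem_bigWindow_self (ν := ν) h0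
  have hpos : ∀ z ∈ bigWindow ν x₀, 0 < z := fun z hz => by
    linarith [H.le_of_mem_bigWindow hx₀ hz]
  have hc : Convex ℝ (bigWindow ν x₀) := convex_Ioo _ _
  have hcont : ContinuousOn (imDiag V) (bigWindow ν x₀) := H.continuousOn_imDiag.mono hpos
  have hdiff : DifferentiableOn ℝ (imDiag V) (interior (bigWindow ν x₀)) := fun z hz =>
    (H.differentiableAt_imDiag (hpos z (interior_subset hz))).differentiableWithinAt
  constructor
  · refine hc.mul_sub_le_image_sub_of_le_deriv hcont hdiff (fun z hz => ?_) x hx y hy hxy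
    rw [inv_mul_le_iff₀ (Real.exp_pos _)]
    exact H.deriv_imDiag_le hx₀ hs (interior_subset hz)
  · refine hc.image_sub_le_mul_sub_of_deriv_le hcont hdiff (fun z hz => ?_) x hx y hy hxy
    exact H.deriv_imDiag_le hx₀ (interior_subset hz) hs

theorem intervalIntegrable_imDiag_sub {x₀ x : ℝ} (hx₀ : 4 * X ≤ x₀) (hx : x ∈ bigWindow ν x₀) {y : ℝ}
    (hy : y ∈ bigWindow ν x₀) (β : ℝ) :
    IntervalIntegrable (fun t => imDiag V t - β) volume y x := by
  refine ((H.continuousOn_imDiag.mono fun z hz => ?_).sub continuousOn_const).intervalIntegrable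
  have hz' : z ∈ bigWindow ν x₀ := (convex_Ioo _ _).ordConnected.uIcc_subset hy hx hz
  have := H.le_of_mem_bigWindow hx₀ hz'
  exact lt_of_lt_of_le (by linarith [H.one_le_X]) this

/-- Quadratic bounds for `F`. -/
theorem integral_imDiag_sub_bounds {x₀ x : ℝ} (hx₀ : 4 * X ≤ x₀) (hx : x ∈ bigWindow ν x₀) :
    (Real.exp (2 * C * 4 ^ |ν|))⁻¹ * deriv (imDiag V) x₀ * ((x - x₀) ^ 2 / 2) ≤
      ∫ t in x₀..x, (imDiag V t - imDiag V x₀) ∧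
    ∫ t in x₀..x, (imDiag V t - imDiag V x₀) ≤
      Real.exp (2 * C * 4 ^ |ν|) * deriv (imDiag V) x₀ * ((x - x₀) ^ 2 / 2) := by
  have h0 : 0 < x₀ := by linarith [H.one_le_X]
  have hs := mem_bigWindow_self (ν := ν) h0
  have hi := H.intervalIntegrable_imDiag_sub hx₀ hx hs (imDiag V x₀)
  have hl : ∀ c : ℝ, IntervalIntegrable (fun t => c * (t - x₀)) volume x₀ x := fun c =>
    (by fun_prop : Continuous fun t : ℝ => c * (t - x₀)).intervalIntegrable _ _
  have he : ∀ c : ℝ, ∫ t in x₀..x, c * (t - x₀) = c * ((x - x₀) ^ 2 / 2) := fun c => by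
    rw [intervalIntegral.integral_const_mul, intervalIntegral.integral_comp_sub_right (fun t => t),
      integral_id]
    ring
  have hsub : uIcc x₀ x ⊆ bigWindow ν x₀ := (convex_Ioo _ _).ordConnected.uIcc_subset hs hx
  rw [← he, ← he]
  constructor
  · refine integral_le_integral_of_sign (hl _) hi (fun t ht h => ?_) fun t ht h => ?_
    · exact (H.imDiag_sub_bounds hx₀ hs (hsub ht) h).1
    · have := (H.imDiag_sub_bounds hx₀ (hsub ht) hs h).1
      linarith
  · refine integral_le_integral_of_sign hi (hl _) (fun t ht h => ?_) fun t ht h => ?_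
    · exact (H.imDiag_sub_bounds hx₀ hs (hsub ht) h).2
    · have := (H.imDiag_sub_bounds hx₀ (hsub ht) hs h).2
      linarith

/-- `F` increases away from the turning point. -/
theorem integral_imDiag_sub_mono {x₀ x y : ℝ} (hx₀ : 4 * X ≤ x₀) (hx : x ∈ bigWindow ν x₀)
    (hy : y ∈ bigWindow ν x₀) (h : x₀ ≤ x ∧ x ≤ y ∨ y ≤ x ∧ x ≤ x₀) :
    ∫ t in x₀..x, (imDiag V t - imDiag V x₀) ≤ ∫ t in x₀..y, (imDiag V t - imDiag V x₀) := by
  have h0 : 0 < x₀ := by linarith [H.one_le_X]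
  have hs := mem_bigWindow_self (ν := ν) h0
  have hpos : ∀ z ∈ bigWindow ν x₀, z ∈ Ioi (0 : ℝ) := fun z hz =>
    lt_of_lt_of_le (by linarith [H.one_le_X]) (H.le_of_mem_bigWindow hx₀ hz)
  have hc : OrdConnected (bigWindow ν x₀) := (convex_Ioo _ _).ordConnected
  rw [← intervalIntegral.integral_add_adjacent_intervals
    (H.intervalIntegrable_imDiag_sub hx₀ hx hs _) (H.intervalIntegrable_imDiag_sub hx₀ hy hx _)]
  refine le_add_of_nonneg_right ?_
  rcases h with ⟨h1, h2⟩ | ⟨h1, h2⟩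
  · refine intervalIntegral.integral_nonneg h2 fun t ht => sub_nonneg.mpr ?_
    exact H.strictMono.monotoneOn h0 (hpos t (hc.out hx hy ht)) (h1.trans ht.1)
  · rw [intervalIntegral.integral_symm, ← intervalIntegral.integral_neg]
    refine intervalIntegral.integral_nonneg h1 fun t ht => ?_
    have := H.strictMono.monotoneOn (hpos t (hc.out hy hx ht)) h0 (ht.2.trans h2)
    linarith

end TailBounds

/-- On a neighbourhood `U` of the closed window around `x₀`, the real parts of `λ - m - V₁₁` and
`λ + m - V₂₂` have the sign `s` and are comparable to `α = Re λ`. -/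
structure ComparisonData (m ν : ℝ) (V : ℝ → Matrix (Fin 2) (Fin 2) ℂ) (x₀ α s : ℝ) (U : Set ℝ)
    (C₁ : ℝ) : Prop where
  isOpen : IsOpen U
  convex : Convex ℝ U
  subset : U ⊆ bigWindow ν x₀
  Icc_subset : Icc (x₀ - x₀ ^ (-ν) / 2) (x₀ + x₀ ^ (-ν) / 2) ⊆ U
  ne_zero : α ≠ 0
  sign : s = 1 ∨ s = -1
  nonneg_m : 0 ≤ m
  m_le : m ≤ imDiag V x₀
  lower_A : ∀ x ∈ U, |α| ≤ C₁ * (s * (α - m - (V x 0 0).re))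
  lower_B : ∀ x ∈ U, |α| ≤ C₁ * (s * (α + m - (V x 1 1).re))
  upper_A : ∀ x ∈ U, s * (α - m - (V x 0 0).re) ≤ C₁ * |α|
  upper_B : ∀ x ∈ U, s * (α + m - (V x 1 1).re) ≤ C₁ * |α|
  const_nonneg : 0 ≤ C₁

theorem TailBounds.pos {n : ℕ} {ν : ℝ} {V : ℝ → Matrix (Fin 2) (Fin 2) ℂ} {X C x₀ : ℝ}
    (H : TailBounds n ν V X C) (hx₀ : 4 * X ≤ x₀) : 0 < x₀ := by linarith [H.one_le_X]

theorem TailBounds.imDiag_nonneg {n : ℕ} {ν : ℝ} {V : ℝ → Matrix (Fin 2) (Fin 2) ℂ} {X C x₀ : ℝ}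
    (H : TailBounds n ν V X C) (hx₀ : 4 * X ≤ x₀) : 0 ≤ imDiag V x₀ :=
  H.nonneg x₀ (by linarith [H.one_le_X])

theorem TailBounds.im_diag_eq {n : ℕ} {ν : ℝ} {V : ℝ → Matrix (Fin 2) (Fin 2) ℂ} {X C : ℝ}
    (H : TailBounds n ν V X C) {x : ℝ} (hx : 0 < x) (i : Fin 2) :
    (V x i i).im = imDiag V x := by
  fin_cases i
  · rfl
  · exact (H.im_eq x hx).symm

namespace ComparisonData

variable {n : ℕ} {m ν : ℝ} {V : ℝ → Matrix (Fin 2) (Fin 2) ℂ} {X C : ℝ} {x₀ α s : ℝ} {U : Set ℝ}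
    {C₁ : ℝ} (D : ComparisonData m ν V x₀ α s U C₁)

include D

theorem abs_re_A_le {x : ℝ} (hx : x ∈ U) : |α - m - (V x 0 0).re| ≤ C₁ * |α| := by
  have h1 := D.lower_A x hx
  have h2 := D.upper_A x hx
  have h3 := abs_pos.mpr D.ne_zero
  have h4 : 0 ≤ s * (α - m - (V x 0 0).re) := by
    by_contra h
    nlinarith [D.const_nonneg]
  have : |α - m - (V x 0 0).re| = |s * (α - m - (V x 0 0).re)| := by
    rcases D.sign with h | h <;> rw [h] <;> simp [abs_sub_comm]
  rwa [this, abs_of_nonneg h4]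

theorem abs_re_B_le {x : ℝ} (hx : x ∈ U) : |α + m - (V x 1 1).re| ≤ C₁ * |α| := by
  have h1 := D.lower_B x hx
  have h2 := D.upper_B x hx
  have h3 := abs_pos.mpr D.ne_zero
  have h4 : 0 ≤ s * (α + m - (V x 1 1).re) := by
    by_contra h
    nlinarith [D.const_nonneg]
  have : |α + m - (V x 1 1).re| = |s * (α + m - (V x 1 1).re)| := by
    rcases D.sign with h | h <;> rw [h] <;> simp [abs_sub_comm]
  rwa [this, abs_of_nonneg h4]

theorem abs_re_diag_le (i : Fin 2) {x : ℝ} (hx : x ∈ U) :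
    |(V x i i).re| ≤ (1 + C₁) * |α| + m := by
  have hm := D.nonneg_m
  have h0 := D.abs_re_A_le hx
  have h1 := D.abs_re_B_le hx
  rw [abs_le] at *
  have := neg_abs_le α
  have := le_abs_self α
  fin_cases i <;> simp only [Fin.zero_eta, Fin.mk_one] <;> constructor <;> linarith [h0.1, h0.2, h1.1, h1.2]

variable (H : TailBounds n ν V X C) (hx₀ : 4 * X ≤ x₀)

include H hx₀

theorem mem_self : x₀ ∈ U := by
  have : 0 < x₀ ^ (-ν) := Real.rpow_pos_of_pos (H.pos hx₀) _
  exact D.Icc_subset ⟨by linarith, by linarith⟩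

theorem le_of_mem {x : ℝ} (hx : x ∈ U) : X ≤ x := H.le_of_mem_bigWindow hx₀ (D.subset hx)

theorem pos_of_mem {x : ℝ} (hx : x ∈ U) : 0 < x := by
  linarith [H.one_le_X, D.le_of_mem H hx₀ hx]

theorem rpow_mul_le (j : ℕ) {x : ℝ} (hx : x ∈ U) :
    x ^ (j * ν) ≤ (4 ^ |ν|) ^ j * (x₀ ^ ν) ^ j := by
  have h0 := H.pos hx₀
  have hb := bigWindow_bounds H.neg_one_le (by linarith [H.one_le_X]) (D.subset hx)
  rw [mul_comm, Real.rpow_mul_natCast (D.pos_of_mem H hx₀ hx).le, ← mul_pow]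
  exact pow_le_pow_left₀ (Real.rpow_nonneg (D.pos_of_mem H hx₀ hx).le _)
    (rpow_le_of_mem_Icc h0 hb.1 hb.2) j

/-- The bound on V₁₁' is evaluated at a point y to the left of x₀: there 𝒱(y) ≤ 𝒱(x₀), so ‖V₁₁(y)‖
is controlled without yet knowing how much 𝒱 grows across the window. Such a y exists because the
left part of U has positive measure, and comparability of 𝒱' carries the bound to x₀. -/
theorem deriv_imDiag_self_le : deriv (imDiag V) x₀ ≤
    Real.exp (2 * C * 4 ^ |ν|) * C * 4 ^ |ν| * (2 + C₁) * (x₀ ^ ν * (|α| + imDiag V x₀)) := by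
  have h0 := H.pos hx₀
  have hC := H.one_le_C
  have hC₁ := D.const_nonneg
  have hm := D.m_le
  have ho : IsOpen (U ∩ Iio x₀) := D.isOpen.inter isOpen_Iio
  have hne : (U ∩ Iio x₀).Nonempty := by
    have : 0 < x₀ ^ (-ν) := Real.rpow_pos_of_pos h0 _
    exact ⟨x₀ - x₀ ^ (-ν) / 2, D.Icc_subset ⟨le_rfl, by linarith⟩, by simp only [mem_Iio]; linarith⟩
  have hpos : volume (U ∩ Iio x₀) ≠ 0 := (ho.measure_pos volume hne).ne'
  obtain ⟨y, hy, hyb⟩ : ∃ y ∈ U ∩ Iio x₀, ‖iteratedDeriv 1 (fun x => V x 0 0) y‖ ≤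
      C * (y ^ (((1 : ℕ) : ℝ) * ν) * ‖V y 0 0‖) := by
    by_contra! h
    refine hpos (measure_mono_null (fun y hy => ?_) (H.deriv_diag 0 1 le_rfl (by omega)))
    exact fun h' => absurd (h' (D.le_of_mem H hx₀ hy.1)) (not_le.mpr (h y hy))
  have hy0 := D.pos_of_mem H hx₀ hy.1
  have h1 := H.deriv_imDiag_le hx₀ (mem_bigWindow_self h0) (D.subset hy.1)
  have h2 : deriv (imDiag V) y ≤ ‖iteratedDeriv 1 (fun x => V x 0 0) y‖ := by
    rw [H.deriv_imDiag hy0, iteratedDeriv_one]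
    exact (le_abs_self _).trans (Complex.abs_im_le_norm _)
  have h3 : ‖V y 0 0‖ ≤ (2 + C₁) * (|α| + imDiag V x₀) := by
    refine (Complex.norm_le_abs_re_add_abs_im _).trans ?_
    have h4 := D.abs_re_diag_le 0 hy.1
    have h5 : imDiag V y ≤ imDiag V x₀ := H.strictMono.monotoneOn hy0 h0 (le_of_lt hy.2)
    have h6 : |(V y 0 0).im| = imDiag V y := abs_of_nonneg (H.nonneg y (D.le_of_mem H hx₀ hy.1))
    rw [h6]
    nlinarith [abs_nonneg α, H.imDiag_nonneg hx₀]
  have h4 := D.rpow_mul_le H hx₀ 1 hy.1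
  simp only [pow_one] at h4
  calc _ ≤ Real.exp (2 * C * 4 ^ |ν|) * (C * ((4 ^ |ν| * x₀ ^ ν) *
        ((2 + C₁) * (|α| + imDiag V x₀)))) := by
        refine h1.trans (mul_le_mul_of_nonneg_left (h2.trans (hyb.trans ?_)) (Real.exp_pos _).le)
        gcongr
    _ = _ := by ring

theorem abs_imDiag_sub_le {x : ℝ} (hx : x ∈ U) : |imDiag V x - imDiag V x₀| ≤
    Real.exp (2 * C * 4 ^ |ν|) * deriv (imDiag V) x₀ * (x₀ ^ ν)⁻¹ := by
  have h0 := H.pos hx₀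
  have hT := H.deriv_pos x₀ (by linarith [H.one_le_X])
  have hs := mem_bigWindow_self (ν := ν) h0
  have hb := abs_le.mp (abs_sub_le_of_mem_bigWindow (D.subset hx))
  have hE := Real.exp_pos (2 * C * 4 ^ |ν|)
  have hP : 0 < (x₀ ^ ν)⁻¹ := inv_pos.mpr (Real.rpow_pos_of_pos h0 _)
  rw [Real.rpow_neg h0.le] at hb
  rcases le_total x₀ x with h | h
  · have h1 := H.imDiag_sub_bounds hx₀ hs (D.subset hx) h
    have h2 := H.strictMono.monotoneOn h0 (D.pos_of_mem H hx₀ hx) h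
    rw [abs_of_nonneg (sub_nonneg.mpr h2)]
    refine h1.2.trans (mul_le_mul_of_nonneg_left ?_ (by positivity))
    linarith
  · have h1 := H.imDiag_sub_bounds hx₀ (D.subset hx) hs h
    have h2 := H.strictMono.monotoneOn (D.pos_of_mem H hx₀ hx) h0 h
    rw [abs_sub_comm, abs_of_nonneg (sub_nonneg.mpr h2)]
    refine h1.2.trans (mul_le_mul_of_nonneg_left ?_ (by positivity))
    linarith

end ComparisonData

/-- The bound for 𝒱'(x₀) keeps 𝒱 within O(|α| + 𝒱(x₀)) of its central value, so both V_ii are of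
that size on U and the derivative hypotheses become powers of x₀^ν. The mass is absorbed through m ≤
𝒱(x₀), which keeps K independent of m, x₀ and α. -/
theorem TailBounds.exists_bounds {n : ℕ} {ν : ℝ} {V : ℝ → Matrix (Fin 2) (Fin 2) ℂ} {X C : ℝ}
    (H : TailBounds n ν V X C) {C₁ : ℝ} (hC₁ : 0 ≤ C₁) : ∃ K : ℝ, 1 ≤ K ∧
    ∀ {m x₀ α s : ℝ} {U : Set ℝ}, 4 * X ≤ x₀ → ComparisonData m ν V x₀ α s U C₁ →
      deriv (imDiag V) x₀ ≤ K * (x₀ ^ ν * (|α| + imDiag V x₀)) ∧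
      (∀ x ∈ U, |imDiag V x - imDiag V x₀| ≤ K * (|α| + imDiag V x₀)) ∧
      (∀ x ∈ U, deriv (imDiag V) x ≤ K * deriv (imDiag V) x₀) ∧
      (∀ i : Fin 2, ∀ j, 1 ≤ j → j ≤ n + 2 → ∀ᵐ x, x ∈ U →
        ‖iteratedDeriv j (fun x => V x i i) x‖ ≤ K * (x₀ ^ ν) ^ j * (|α| + imDiag V x₀)) ∧
      (∀ j ≤ n + 1, ∀ᵐ x, x ∈ U →
        ‖iteratedDeriv j (fun x => V x 1 0 - V x 0 1) x‖ ≤ K * (x₀ ^ ν) ^ (j + 1)) := by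
  have hC := H.one_le_C
  set E := Real.exp (2 * C * 4 ^ |ν|) with hE
  set Q : ℝ := 4 ^ |ν| with hQ
  have hQ1 : 1 ≤ Q := Real.one_le_rpow (by norm_num) (abs_nonneg ν)
  have hE1 : 1 ≤ E := Real.one_le_exp (by positivity)
  set K₀ := E * C * Q * (2 + C₁) with hK₀
  have hK₀1 : 0 ≤ K₀ := by positivity
  set K₁ := (2 + C₁) + E * K₀ with hK₁
  have hK₁0 : 0 ≤ K₁ := by positivity
  set K₂ := C * Q ^ (n + 2) * (1 + K₁) with hK₂
  have hK₂0 : 0 ≤ K₂ := by positivity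
  refine ⟨1 + K₀ + E * K₀ + E + K₂, by nlinarith, fun {m x₀ α s U} hx₀ D => ?_⟩
  have h0 := H.pos hx₀
  have hP : 0 < x₀ ^ ν := Real.rpow_pos_of_pos h0 _
  have hβ := H.imDiag_nonneg hx₀
  have hS : 0 ≤ |α| + imDiag V x₀ := by positivity
  set S := |α| + imDiag V x₀ with hSdef
  have hT := D.deriv_imDiag_self_le H hx₀
  have hT0 := H.deriv_pos x₀ (by linarith [H.one_le_X])
  have hEK : 0 ≤ E * K₀ := by positivity
  have hE0 : 0 ≤ E := by linarith
  have him : ∀ x ∈ U, |imDiag V x - imDiag V x₀| ≤ E * K₀ * S := fun x hx => by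
    refine (D.abs_imDiag_sub_le H hx₀ hx).trans ?_
    calc E * deriv (imDiag V) x₀ * (x₀ ^ ν)⁻¹ ≤ E * (K₀ * (x₀ ^ ν * S)) * (x₀ ^ ν)⁻¹ := by gcongr
      _ = _ := by field_simp
  have hV : ∀ i : Fin 2, ∀ x ∈ U, ‖V x i i‖ ≤ K₁ * S := fun i x hx => by
    refine (Complex.norm_le_abs_re_add_abs_im _).trans ?_
    have h4 := D.abs_re_diag_le i hx
    have h6 := him x hx
    have h7 := abs_le.mp h6
    have h8 := D.m_le
    rw [H.im_diag_eq (D.pos_of_mem H hx₀ hx) i,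
      abs_of_nonneg (H.nonneg x (D.le_of_mem H hx₀ hx))]
    rw [hK₁, hSdef] at *
    nlinarith [abs_nonneg α]
  refine ⟨hT.trans (mul_le_mul_of_nonneg_right ?_ (by positivity)), fun x hx => (him x hx).trans
    (mul_le_mul_of_nonneg_right ?_ hS), fun x hx => ?_, fun i j hj1 hj2 => ?_, fun j hj => ?_⟩
  · linarith
  · linarith
  · refine (H.deriv_imDiag_le hx₀ (D.subset hx) (mem_bigWindow_self h0)).trans ?_
    exact mul_le_mul_of_nonneg_right (by linarith) hT0.le
  · filter_upwards [H.deriv_diag i j hj1 hj2] with x hx hxU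
    refine (hx (D.le_of_mem H hx₀ hxU)).trans ?_
    have h1 := D.rpow_mul_le H hx₀ j hxU
    have h2 := hV i x hxU
    have hQj : Q ^ j ≤ Q ^ (n + 2) := pow_le_pow_right₀ hQ1 hj2
    have hK11 : K₁ ≤ 1 + K₁ := by linarith
    calc C * (x ^ (j * ν) * ‖V x i i‖) ≤ C * (((4 ^ |ν|) ^ j * (x₀ ^ ν) ^ j) * (K₁ * S)) := by
          gcongr
      _ ≤ C * ((Q ^ (n + 2) * (x₀ ^ ν) ^ j) * ((1 + K₁) * S)) := by
          gcongr
      _ = K₂ * (x₀ ^ ν) ^ j * S := by rw [hK₂]; ring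
      _ ≤ _ := by
          gcongr
          linarith
  · filter_upwards [H.deriv_offDiag j hj] with x hx hxU
    refine (hx (D.le_of_mem H hx₀ hxU)).trans ?_
    have h1 := D.rpow_mul_le H hx₀ (j + 1) hxU
    have hQj : Q ^ (j + 1) ≤ Q ^ (n + 2) := pow_le_pow_right₀ hQ1 (by omega)
    push_cast at h1
    calc C * x ^ (((j : ℝ) + 1) * ν) ≤ C * (((4 ^ |ν|) ^ (j + 1) * (x₀ ^ ν) ^ (j + 1))) := by gcongr
      _ ≤ C * ((Q ^ (n + 2) * (x₀ ^ ν) ^ (j + 1))) := by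
          gcongr
      _ = C * Q ^ (n + 2) * 1 * (x₀ ^ ν) ^ (j + 1) := by ring
      _ ≤ _ := by
          gcongr
          have : C * Q ^ (n + 2) * 1 ≤ K₂ := by
            rw [hK₂]
            gcongr
            linarith
          linarith

/-- The scale μ is left free. The condition `hμ₂` handles all diagonal derivatives of order at least
two, and only the first-order bound `h0` depends on a finer argument; this allows two different
choices of μ. -/
theorem ComparisonData.windowData {n : ℕ} {ν : ℝ} {V : ℝ → Matrix (Fin 2) (Fin 2) ℂ} {X C : ℝ}
    (H : TailBounds n ν V X C) {m x₀ α s C₁ K μ : ℝ} {U : Set ℝ} (hx₀ : 4 * X ≤ x₀)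
    (D : ComparisonData m ν V x₀ α s U C₁) (hK : 0 ≤ K) (hC₁ : C₁ ≤ K)
    (hμ : x₀ ^ ν ≤ μ) (hμ₂ : (x₀ ^ ν) ^ 2 * (|α| + imDiag V x₀) ≤ |α| * μ ^ 2)
    (h0 : ∀ i : Fin 2, ∀ x ∈ U, ‖deriv (fun x => V x i i) x‖ ≤ K * |α| * μ)
    (h1 : ∀ i : Fin 2, ∀ j, 1 ≤ j → j ≤ n + 2 → ∀ᵐ x, x ∈ U →
        ‖iteratedDeriv j (fun x => V x i i) x‖ ≤ K * (x₀ ^ ν) ^ j * (|α| + imDiag V x₀))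
    (h2 : ∀ j ≤ n + 1, ∀ᵐ x, x ∈ U →
        ‖iteratedDeriv j (fun x => V x 1 0 - V x 0 1) x‖ ≤ K * (x₀ ^ ν) ^ (j + 1)) :
    WindowData m V x₀ (α + imDiag V x₀ * Complex.I) s n U μ |α| K := by
  have hpos := H.pos hx₀
  have hP : 0 < x₀ ^ ν := Real.rpow_pos_of_pos hpos _
  have hsub : U ⊆ Ioi 0 := fun x hx => D.pos_of_mem H hx₀ hx
  have hμ0 : 0 ≤ μ := hP.le.trans hμ
  have hα := abs_pos.mpr D.ne_zero
  refine ⟨D.isOpen, D.convex, hsub, D.mem_self H hx₀, H.primitive_01.continuousOn,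
    H.primitive_10.continuousOn, fun i => (H.primitive_diag i).continuousOn,
    fun i x hx => H.differentiableAt_diag i (hsub hx), fun i => ?_, ?_, hμ0, hα, hK, ?_, ?_, ?_,
    ?_, ?_⟩
  · refine IsIteratedPrimitive.symbolOn D.isOpen D.convex hsub n (H.primitive_diag i).2
      fun j hj => ?_
    rcases j with _ | j
    · exact ae_of_all _ fun x hx => by simpa using h0 i x hx
    · filter_upwards [h1 i (j + 2) (by omega) (by omega)] with x hx hxU
      rw [← iteratedDeriv_succ']
      refine (hx hxU).trans ?_
      have hβ := H.imDiag_nonneg hx₀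
      calc K * (x₀ ^ ν) ^ (j + 2) * (|α| + imDiag V x₀) =
            K * (x₀ ^ ν) ^ j * ((x₀ ^ ν) ^ 2 * (|α| + imDiag V x₀)) := by ring
        _ ≤ K * μ ^ j * (|α| * μ ^ 2) := by gcongr
        _ = _ := by ring
  · refine IsIteratedPrimitive.symbolOn D.isOpen D.convex hsub n
      (H.primitive_10.sub H.primitive_01) fun j hj => ?_
    filter_upwards [h2 j hj] with x hx hxU
    refine (hx hxU).trans ?_
    calc K * (x₀ ^ ν) ^ (j + 1) ≤ K * μ ^ (j + 1) := by gcongr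
      _ = _ := by ring
  · rcases D.sign with h | h <;> simp [h]
  · intro h
    have := congrArg Complex.re h
    simp at this
    exact D.ne_zero this
  · intro x hx
    simp [factorA, factorB, H.im_eq x (hsub hx)]
  · intro x hx
    have h3 := D.lower_A x hx
    have h4 : (↑s * factorA m V (α + imDiag V x₀ * Complex.I) x).re =
        s * (α - m - (V x 0 0).re) := by simp [factorA]
    rw [h4]
    refine h3.trans (mul_le_mul_of_nonneg_right hC₁ ?_)
    by_contra h5
    nlinarith [D.const_nonneg]
  · intro x hx
    have h3 := D.lower_B x hx
    have h4 : (↑s * factorB m V (α + imDiag V x₀ * Complex.I) x).re =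
        s * (α + m - (V x 1 1).re) := by simp [factorB]
    rw [h4]
    refine h3.trans (mul_le_mul_of_nonneg_right hC₁ ?_)
    by_contra h5
    nlinarith [D.const_nonneg]

/-- Landau's interpolation inequality. -/
theorem abs_deriv_le_of_abs_le {f f' : ℝ → ℝ} {U : Set ℝ} (hc : OrdConnected U) {M L t x y : ℝ}
    (hf : ∀ z ∈ U, HasDerivAt f (f' z) z) (hM : ∀ z ∈ U, |f z| ≤ M)
    (hL : ∀ z ∈ U, |f' x - f' z| ≤ L * |x - z|) (hL0 : 0 ≤ L) (ht : 0 < t) (hx : x ∈ U) (hy : y ∈ U)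
    (hxy : |x - y| = t) : |f' x| ≤ 2 * M / t + L * t := by
  have key : ∃ z ∈ U, |x - z| ≤ t ∧ |f' z| * t = |f y - f x| := by
    rcases lt_trichotomy x y with h | h | h
    · obtain ⟨z, hz, hz'⟩ := exists_hasDerivAt_eq_slope f f' h
        (fun w hw => (hf w (hc.out hx hy hw)).continuousAt.continuousWithinAt)
        (fun w hw => hf w (hc.out hx hy (Ioo_subset_Icc_self hw)))
      have e : y - x = t := by rw [← hxy, abs_sub_comm, abs_of_pos (by linarith)]
      refine ⟨z, hc.out hx hy (Ioo_subset_Icc_self hz), ?_, ?_⟩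
      · rw [abs_sub_comm, abs_of_pos (by linarith [hz.1])]
        linarith [hz.2]
      · rw [hz', e, abs_div, abs_of_pos ht, div_mul_cancel₀ _ ht.ne']
    · rw [h, sub_self, abs_zero] at hxy
      exact absurd hxy ht.ne
    · obtain ⟨z, hz, hz'⟩ := exists_hasDerivAt_eq_slope f f' h
        (fun w hw => (hf w (hc.out hy hx hw)).continuousAt.continuousWithinAt)
        (fun w hw => hf w (hc.out hy hx (Ioo_subset_Icc_self hw)))
      have e : x - y = t := by rw [← hxy, abs_of_pos (by linarith)]
      refine ⟨z, hc.out hy hx (Ioo_subset_Icc_self hz), ?_, ?_⟩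
      · rw [abs_of_pos (by linarith [hz.2])]
        linarith [hz.1]
      · rw [hz', e, abs_div, abs_of_pos ht, div_mul_cancel₀ _ ht.ne', abs_sub_comm]
  obtain ⟨z, hz, h1, h2⟩ := key
  have h3 : |f' z| ≤ 2 * M / t := by
    rw [le_div_iff₀ ht, h2]
    have := hM y hy
    have := hM x hx
    have := abs_sub (f y) (f x)
    linarith
  have h4 : |f' x - f' z| ≤ L * t := (hL z hz).trans (mul_le_mul_of_nonneg_left h1 hL0)
  have h5 : |f' x| ≤ |f' z| + |f' x - f' z| := by
    have := abs_add_le (f' z) (f' x - f' z)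
    rwa [add_sub_cancel] at this
  linarith

/-- Let τ = 1 + 𝒱(x₀)/|α|. The scale x₀^ν τ always works. From order two on, x₀^ν √τ already
suffices; at order one the imaginary part is covered by the extra hypothesis on 𝒱', and the real
part follows by interpolation between Re V_ii - α = O(|α|), up to the mass, and the second-order
bound. -/
theorem TailBounds.exists_windowData {n : ℕ} {ν : ℝ} {V : ℝ → Matrix (Fin 2) (Fin 2) ℂ} {X C : ℝ}
    (H : TailBounds n ν V X C) {C₁ : ℝ} (hC₁ : 0 ≤ C₁) : ∃ K : ℝ, 1 ≤ K ∧
    ∀ {m x₀ α s : ℝ} {U : Set ℝ}, 4 * X ≤ x₀ → ComparisonData m ν V x₀ α s U C₁ →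
      (∀ x ∈ U, ‖factorA m V (α + imDiag V x₀ * Complex.I) x‖ ≤ K * (|α| + imDiag V x₀) ∧
        ‖factorB m V (α + imDiag V x₀ * Complex.I) x‖ ≤ K * (|α| + imDiag V x₀)) ∧
      (∀ x ∈ U, (s * factorA m V (α + imDiag V x₀ * Complex.I) x).re ≤ K * |α|) ∧
      (∀ x ∈ U, (s * factorB m V (α + imDiag V x₀ * Complex.I) x).re ≤ K * |α|) ∧
      WindowData m V x₀ (α + imDiag V x₀ * Complex.I) s n U
        (x₀ ^ ν * (1 + imDiag V x₀ / |α|)) |α| K ∧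
      (deriv (imDiag V) x₀ ≤ x₀ ^ ν * |α| →
        WindowData m V x₀ (α + imDiag V x₀ * Complex.I) s n U
          (x₀ ^ ν * √(1 + imDiag V x₀ / |α|)) |α| K) := by
  obtain ⟨K, hK1, hK⟩ := H.exists_bounds hC₁
  have hK0 : 0 ≤ K := by linarith
  refine ⟨C₁ + 8 * (2 + C₁) + 2 * K, by linarith, fun {m x₀ α s U} hx₀ D => ?_⟩
  obtain ⟨b1, b2, b3, b4, b5⟩ := hK hx₀ D
  have h0 := H.pos hx₀
  have hP : 0 < x₀ ^ ν := Real.rpow_pos_of_pos h0 _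
  have hβ := H.imDiag_nonneg hx₀
  have hα := abs_pos.mpr D.ne_zero
  have hS : 0 ≤ |α| + imDiag V x₀ := by positivity
  set S := |α| + imDiag V x₀ with hSdef
  set τ := 1 + imDiag V x₀ / |α| with hτ
  have hτ1 : 1 ≤ τ := le_add_of_nonneg_right (div_nonneg hβ hα.le)
  have hαS : |α| ≤ S := by linarith
  have hSτ : S = |α| * τ := by
    rw [hτ]
    field_simp
    linarith
  have hsub : U ⊆ Ioi 0 := fun x hx => D.pos_of_mem H hx₀ hx
  set K' := C₁ + 8 * (2 + C₁) + 2 * K with hK'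
  have hKK' : K ≤ K' := by linarith
  have c4 : ∀ i : Fin 2, ∀ j, 1 ≤ j → j ≤ n + 2 → ∀ᵐ x, x ∈ U →
        ‖iteratedDeriv j (fun x => V x i i) x‖ ≤ K' * (x₀ ^ ν) ^ j * S := fun i j h h' => by
    filter_upwards [b4 i j h h'] with x hx hxU
    exact (hx hxU).trans (by gcongr)
  have c5 : ∀ j ≤ n + 1, ∀ᵐ x, x ∈ U →
        ‖iteratedDeriv j (fun x => V x 1 0 - V x 0 1) x‖ ≤ K' * (x₀ ^ ν) ^ (j + 1) := fun j h => by
    filter_upwards [b5 j h] with x hx hxU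
    exact (hx hxU).trans (by gcongr)
  have hsym : ∀ i : Fin 2, SymbolOn U (x₀ ^ ν) n (K * (x₀ ^ ν) * S) (deriv fun x => V x i i) :=
    fun i => by
    refine IsIteratedPrimitive.symbolOn D.isOpen D.convex hsub n (H.primitive_diag i).2
      fun j hj => ?_
    filter_upwards [b4 i (j + 1) (by omega) (by omega)] with x hx hxU
    rw [← iteratedDeriv_succ']
    exact (hx hxU).trans_eq (by ring)
  have imB : ∀ x ∈ U, (V x 1 1).im = imDiag V x := fun x hx => (H.im_eq x (hsub hx)).symm
  have C1S : C₁ * |α| ≤ C₁ * S := by gcongr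
  refine ⟨fun x hx => ⟨?_, ?_⟩, fun x hx => ?_, fun x hx => ?_, ?_, fun hT => ?_⟩
  · refine (Complex.norm_le_abs_re_add_abs_im _).trans ?_
    have e1 : (factorA m V (α + imDiag V x₀ * Complex.I) x).re = α - m - (V x 0 0).re := by
      simp [factorA]
    have e2 : (factorA m V (α + imDiag V x₀ * Complex.I) x).im =
        -(imDiag V x - imDiag V x₀) := by simp [factorA, imDiag]
    rw [e1, e2, abs_neg]
    have := D.abs_re_A_le hx
    have := b2 x hx
    have : (C₁ + K) * S ≤ K' * S := by gcongr; linarith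
    linarith
  · refine (Complex.norm_le_abs_re_add_abs_im _).trans ?_
    have e1 : (factorB m V (α + imDiag V x₀ * Complex.I) x).re = α + m - (V x 1 1).re := by
      simp [factorB]
    have e2 : (factorB m V (α + imDiag V x₀ * Complex.I) x).im =
        -(imDiag V x - imDiag V x₀) := by simp [factorB, imB x hx]
    rw [e1, e2, abs_neg]
    have := D.abs_re_B_le hx
    have := b2 x hx
    have : (C₁ + K) * S ≤ K' * S := by gcongr; linarith
    linarith
  · have e : (↑s * factorA m V (α + imDiag V x₀ * Complex.I) x).re =
        s * (α - m - (V x 0 0).re) := by simp [factorA]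
    rw [e]
    exact (D.upper_A x hx).trans (by gcongr; linarith)
  · have e : (↑s * factorB m V (α + imDiag V x₀ * Complex.I) x).re =
        s * (α + m - (V x 1 1).re) := by simp [factorB]
    rw [e]
    exact (D.upper_B x hx).trans (by gcongr; linarith)
  · refine D.windowData H hx₀ (by linarith) (by linarith) (le_mul_of_one_le_right hP.le hτ1) ?_
      (fun i x hx => ?_) c4 c5
    · rw [← hSdef, hSτ, mul_pow]
      calc (x₀ ^ ν) ^ 2 * (|α| * τ) = |α| * ((x₀ ^ ν) ^ 2 * (τ * 1)) := by ring
        _ ≤ |α| * ((x₀ ^ ν) ^ 2 * (τ * τ)) := by gcongr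
        _ = _ := by ring
    · refine ((hsym i).norm_le hx).trans ?_
      rw [hSτ]
      calc K * x₀ ^ ν * (|α| * τ) = K * |α| * (x₀ ^ ν * τ) := by ring
        _ ≤ _ := by gcongr
  · have hq1 : 1 ≤ √τ := Real.one_le_sqrt.mpr hτ1
    have hq0 : 0 < √τ := by linarith
    have hqq : √τ * √τ = τ := Real.mul_self_sqrt (by linarith)
    refine D.windowData H hx₀ (by linarith) (by linarith) (le_mul_of_one_le_right hP.le hq1) ?_
      (fun i x hx => ?_) c4 c5
    · rw [← hSdef, hSτ, mul_pow, Real.sq_sqrt (by linarith)]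
      exact le_of_eq (by ring)
    have him : |(deriv (fun x => V x i i) x).im| ≤ K * |α| * (x₀ ^ ν * √τ) := by
      have e : (deriv (fun x => V x i i) x).im = deriv (imDiag V) x := by
        have h1 : HasDerivAt (fun x => (V x i i).im) (deriv (fun x => V x i i) x).im x :=
          Complex.imCLM.hasFDerivAt.comp_hasDerivAt x
            (H.differentiableAt_diag i (hsub hx)).hasDerivAt
        rw [← h1.deriv]
        refine Filter.EventuallyEq.deriv_eq ?_
        filter_upwards [Ioi_mem_nhds (hsub hx)] with y hy
        exact H.im_diag_eq hy i
      rw [e, abs_of_pos (H.deriv_pos x (D.le_of_mem H hx₀ hx))]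
      calc deriv (imDiag V) x ≤ K * (x₀ ^ ν * |α|) := (b3 x hx).trans (by gcongr)
        _ = K * |α| * (x₀ ^ ν * 1) := by ring
        _ ≤ _ := by gcongr
    have hre : |(deriv (fun x => V x i i) x).re| ≤
        (8 * (2 + C₁) + K) * |α| * (x₀ ^ ν * √τ) := by
      -- This step length balances |α|/t against x₀^(2ν)|α|τ t; both are then of size |α| x₀^ν √τ.
      -- Since t is at most the half-width, a point at distance t on one side of x lies in U.
      set t := x₀ ^ (-ν) / 2 / √τ with ht
      have hδ : 0 < x₀ ^ (-ν) := Real.rpow_pos_of_pos h0 _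
      have ht0 : 0 < t := by positivity
      have htδ : t ≤ x₀ ^ (-ν) / 2 := div_le_self (by positivity) hq1
      obtain ⟨y, hy, hxy⟩ : ∃ y ∈ U, |x - y| = t := by
        have hm := D.mem_self H hx₀
        rcases le_total x x₀ with h | h
        · refine ⟨x + t, D.convex.ordConnected.out hx
            (D.Icc_subset ⟨by linarith, le_rfl⟩) ⟨by linarith, by linarith⟩, ?_⟩
          rw [sub_add_cancel_left, abs_neg, abs_of_pos ht0]
        · refine ⟨x - t, D.convex.ordConnected.out
            (D.Icc_subset (left_mem_Icc.mpr (by linarith))) hx ⟨by linarith, by linarith⟩, ?_⟩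
          rw [sub_sub_cancel, abs_of_pos ht0]
      have hL := abs_deriv_le_of_abs_le (f := fun z => (V z i i).re - (s * s * if i = 0 then α - m else α + m))
        (f' := fun z => (deriv (fun x => V x i i) z).re)
        (M := C₁ * |α|) (L := K * x₀ ^ ν * S * x₀ ^ ν) D.convex.ordConnected
        (fun z hz => ((Complex.reCLM.hasFDerivAt.comp_hasDerivAt z
          (H.differentiableAt_diag i (hsub hz)).hasDerivAt).sub_const _)) (fun z hz => ?_)
        (fun z hz => ?_) (by positivity) ht0 hx hy hxy
      · refine hL.trans ?_
        have e1 : 2 * (C₁ * |α|) / t = 4 * C₁ * |α| * (x₀ ^ ν * √τ) := by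
          rw [ht, Real.rpow_neg h0.le]
          field_simp
          ring
        have e2 : K * x₀ ^ ν * S * x₀ ^ ν * t = K / 2 * |α| * (x₀ ^ ν * √τ) := by
          have e3 : x₀ ^ (-ν) * x₀ ^ ν = 1 := by rw [← Real.rpow_add h0]; simp
          have e4 : τ / √τ = √τ := Real.div_sqrt
          rw [ht, hSτ]
          calc _ = K / 2 * |α| * x₀ ^ ν * (x₀ ^ (-ν) * x₀ ^ ν) * (τ / √τ) := by ring
            _ = _ := by rw [e3, e4]; ring
        rw [e1, e2, ← add_mul, ← add_mul]
        have e5 : 4 * C₁ + K / 2 ≤ 8 * (2 + C₁) + K := by linarith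
        gcongr
      · have s2 : s * s = 1 := by rcases D.sign with h | h <;> rw [h] <;> norm_num
        rw [s2, one_mul, abs_sub_comm]
        fin_cases i
        · exact D.abs_re_A_le hz
        · exact D.abs_re_B_le hz
      · have h1 := (hsym i).lipschitz D.convex hz hx
        rw [← Complex.sub_re]
        exact (Complex.abs_re_le_norm _).trans h1
    refine (Complex.norm_le_abs_re_add_abs_im _).trans ((add_le_add hre him).trans ?_)
    rw [← add_mul, ← add_mul]
    gcongr
    linarith

/-- Real parts that are comparable to `α` on the open window are so on a neighbourhood of the
closed window. -/
theorem TailBounds.exists_comparisonData {n : ℕ} {ν : ℝ} {V : ℝ → Matrix (Fin 2) (Fin 2) ℂ}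
    {X C : ℝ} (H : TailBounds n ν V X C) {m x₀ α a b : ℝ} (hx₀ : 4 * X ≤ x₀) (hm : 0 ≤ m)
    (hm' : m ≤ imDiag V x₀) (ha : 0 < a) (hb : 0 < b)
    (h : ∀ x ∈ Ioo (x₀ - x₀ ^ (-ν) / 2) (x₀ + x₀ ^ (-ν) / 2),
      0 < (α - m - (V x 0 0).re) * (α + m - (V x 1 1).re) ∧
      a * |α| ≤ |α - m - (V x 0 0).re| ∧ |α - m - (V x 0 0).re| ≤ b * |α| ∧
      a * |α| ≤ |α + m - (V x 1 1).re| ∧ |α + m - (V x 1 1).re| ≤ b * |α|) :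
    ∃ U, ComparisonData m ν V x₀ α (if 0 < α - m - (V x₀ 0 0).re then 1 else -1) U
      (2 / a + 2 * b) := by
  have h0 := H.pos hx₀
  have hδ : 0 < x₀ ^ (-ν) := Real.rpow_pos_of_pos h0 _
  have hδx := rpow_neg_le_self H.neg_one_le (by linarith [H.one_le_X] : 1 ≤ x₀)
  set s : ℝ := if 0 < α - m - (V x₀ 0 0).re then 1 else -1 with hs
  have hs1 : s = 1 ∨ s = -1 := by
    rw [hs]
    split_ifs <;> simp
  set p := x₀ - x₀ ^ (-ν) / 2 with hp
  set q := x₀ + x₀ ^ (-ν) / 2 with hq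
  have hpq : p < q := by linarith
  have hx₀m : x₀ ∈ Ioo p q := ⟨by linarith, by linarith⟩
  have hJ : Icc p q ⊆ Ioi 0 := fun x hx => lt_of_lt_of_le (by linarith) hx.1
  set f : ℝ → ℝ := fun x => s * (α - m - (V x 0 0).re) with hf
  set g : ℝ → ℝ := fun x => s * (α + m - (V x 1 1).re) with hg
  have cf : ContinuousOn f (Ioi 0) := continuousOn_const.mul (continuousOn_const.sub
    (Complex.continuous_re.comp_continuousOn (H.primitive_diag 0).continuousOn))
  have cg : ContinuousOn g (Ioi 0) := continuousOn_const.mul (continuousOn_const.sub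
    (Complex.continuous_re.comp_continuousOn (H.primitive_diag 1).continuousOn))
  have hsub : Ioo p q ⊆ Ioi 0 := Ioo_subset_Icc_self.trans hJ
  have ss : s * s = 1 := by rcases hs1 with h | h <;> rw [h] <;> norm_num
  have hfg : ∀ x, f x * g x = (α - m - (V x 0 0).re) * (α + m - (V x 1 1).re) := fun x => by
    calc f x * g x = s * s * ((α - m - (V x 0 0).re) * (α + m - (V x 1 1).re)) := by
          simp only [hf, hg]; ring
      _ = _ := by rw [ss, one_mul]
  have hf0 : ∀ x ∈ Ioo p q, f x ≠ 0 := fun x hx hx0 => by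
    have := (h x hx).1
    rw [← hfg, hx0, zero_mul] at this
    exact this.false
  have hfx₀ : 0 < f x₀ := by
    have h1 := hf0 x₀ hx₀m
    simp only [hf, hs] at h1 ⊢
    split_ifs with h2
    · simpa using h2
    · rw [if_neg h2] at h1
      have h3 : α - m - (V x₀ 0 0).re ≠ 0 := fun h => h1 (by rw [h, mul_zero])
      have := lt_of_le_of_ne (not_lt.mp h2) h3
      linarith
  -- The product condition forbids zeros, so the sign at the centre persists by the intermediate
  -- value theorem.
  have hfpos : ∀ x ∈ Ioo p q, 0 < f x := fun x hx => by
    by_contra hn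
    obtain ⟨y, hy, hy0⟩ := isPreconnected_Ioo.intermediate_value hx hx₀m (cf.mono hsub)
      ⟨not_lt.mp hn, hfx₀.le⟩
    exact hf0 y hy hy0
  have hgpos : ∀ x ∈ Ioo p q, 0 < g x := fun x hx => by
    have h1 := (h x hx).1
    rw [← hfg] at h1
    exact (pos_iff_pos_of_mul_pos h1).mp (hfpos x hx)
  have habs : ∀ y, |s * y| = |y| := fun y => by
    rcases hs1 with h | h <;> rw [h] <;> simp
  have hα : α ≠ 0 := fun h1 => by
    have h2 := (h x₀ hx₀m).2.2.1
    have h3 : |f x₀| ≤ 0 := by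
      rw [habs]
      simpa [h1] using h2
    linarith [abs_pos.mpr hfx₀.ne']
  have hα0 := abs_pos.mpr hα
  have hcl : closure (Ioo p q) = Icc p q := closure_Ioo hpq.ne
  have bf : ∀ x ∈ Icc p q, a * |α| ≤ f x ∧ f x ≤ b * |α| := fun x hx => by
    have cf' : ContinuousOn f (closure (Ioo p q)) := by
      rw [hcl]
      exact cf.mono hJ
    rw [← hcl] at hx
    have e : ∀ y ∈ Ioo p q, f y = |α - m - (V y 0 0).re| := fun y hy => by
      rw [← habs, ← abs_of_pos (hfpos y hy)]
    exact ⟨le_on_closure (fun y hy => by rw [e y hy]; exact (h y hy).2.1) continuousOn_const cf' hx,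
      le_on_closure (fun y hy => by rw [e y hy]; exact (h y hy).2.2.1) cf' continuousOn_const hx⟩
  have bg : ∀ x ∈ Icc p q, a * |α| ≤ g x ∧ g x ≤ b * |α| := fun x hx => by
    have cf' : ContinuousOn g (closure (Ioo p q)) := by
      rw [hcl]
      exact cg.mono hJ
    rw [← hcl] at hx
    have e : ∀ y ∈ Ioo p q, g y = |α + m - (V y 1 1).re| := fun y hy => by
      rw [← habs, ← abs_of_pos (hgpos y hy)]
    exact ⟨le_on_closure (fun y hy => by rw [e y hy]; exact (h y hy).2.2.2.1) continuousOn_const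
      cf' hx, le_on_closure (fun y hy => by rw [e y hy]; exact (h y hy).2.2.2.2) cf'
      continuousOn_const hx⟩
  -- On the closed window the values lie in [a|α|, b|α|] by continuity; halving and doubling the
  -- constants leaves room for an open neighbourhood, and a thickening of an interval stays convex.
  set I := Ioo (a / 2 * |α|) (2 * b * |α|) with hI
  have hbw : bigWindow ν x₀ ⊆ Ioi 0 := fun z hz => by
    have := (bigWindow_bounds H.neg_one_le (by linarith [H.one_le_X]) hz).1
    exact lt_of_lt_of_le (by linarith) this
  have hob : IsOpen (bigWindow ν x₀) := isOpen_Ioo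
  have hO : IsOpen ((bigWindow ν x₀ ∩ f ⁻¹' I) ∩ (bigWindow ν x₀ ∩ g ⁻¹' I)) :=
    ((cf.mono hbw).isOpen_inter_preimage hob isOpen_Ioo).inter
      ((cg.mono hbw).isOpen_inter_preimage hob isOpen_Ioo)
  have hKO : Icc p q ⊆ (bigWindow ν x₀ ∩ f ⁻¹' I) ∩ (bigWindow ν x₀ ∩ g ⁻¹' I) := fun x hx => by
    have h1 : x ∈ bigWindow ν x₀ := ⟨by linarith [hx.1], by linarith [hx.2]⟩
    have h2 := bf x hx
    have h3 := bg x hx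
    have h4 : 0 < a * |α| := by positivity
    have h5 : 0 < b * |α| := by positivity
    exact ⟨⟨h1, by linarith, by linarith⟩, h1, by linarith, by linarith⟩
  obtain ⟨ε, hε, hεO⟩ := isCompact_Icc.exists_thickening_subset_open hO hKO
  have lo : ∀ t, a / 2 * |α| ≤ t → |α| ≤ (2 / a + 2 * b) * t := fun t ht => by
    have : |α| = 2 / a * (a / 2 * |α|) := by field_simp
    have h0 : 0 ≤ t := le_trans (by positivity) ht
    calc |α| = 2 / a * (a / 2 * |α|) := this
      _ ≤ 2 / a * t := by gcongr
      _ ≤ _ := by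
        rw [add_mul]
        exact le_add_of_nonneg_right (by positivity)
  have up : ∀ t, t ≤ 2 * b * |α| → t ≤ (2 / a + 2 * b) * |α| := fun t ht => by
    refine ht.trans ?_
    rw [add_mul]
    exact le_add_of_nonneg_left (by positivity)
  exact ⟨Metric.thickening ε (Icc p q), Metric.isOpen_thickening, (convex_Icc p q).thickening ε,
    fun x hx => (hεO hx).1.1, Metric.self_subset_thickening hε _, hα, hs1, hm, hm',
    fun x hx => lo _ (hεO hx).1.2.1.le, fun x hx => lo _ (hεO hx).2.2.1.le,
    fun x hx => up _ (hεO hx).1.2.2.le, fun x hx => up _ (hεO hx).2.2.2.le, by positivity⟩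

/-! ### Turning points -/

theorem AdmissiblePotential.eventually_turningPoint {N : ℕ} {ν : ℝ}
    {V : ℝ → Matrix (Fin 2) (Fin 2) ℂ} (h : AdmissiblePotential N ν V) (Y : ℝ) :
    ∀ᶠ β in atTop, Y ≤ turningPoint V β ∧ imDiag V (turningPoint V β) = β := by
  have hc : ContinuousOn (imDiag V) (Ioi 0) :=
    Complex.continuous_im.comp_continuousOn (h.memW_diag 0).1
  filter_upwards [eventually_ge_atTop (imDiag V (max Y 1))] with β hβ
  obtain ⟨y, hy, hyβ⟩ := ((eventually_ge_atTop (max Y 1)).and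
    (h.tendsto.eventually_ge_atTop β)).exists
  have h1 : 0 < max Y 1 := lt_of_lt_of_le one_pos (le_max_right _ _)
  obtain ⟨x, hx, hxβ⟩ := intermediate_value_Icc hy
    (hc.mono fun z hz => lt_of_lt_of_le h1 hz.1) ⟨hβ, hyβ⟩
  have hx0 : x ∈ Ioi (0 : ℝ) := lt_of_lt_of_le h1 hx.1
  have hex : ∃ a ∈ Ioi (0 : ℝ), imDiag V a = β := ⟨x, hx0, hxβ⟩
  have h2 : imDiag V (turningPoint V β) = β := Function.invFunOn_eq hex
  have h3 : turningPoint V β = x :=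
    h.strictMono.injOn (Function.invFunOn_mem hex) hx0 (h2.trans hxβ.symm)
  exact ⟨h3 ▸ (le_max_left _ _).trans hx.1, h2⟩

/-- The large parameter `𝒱'(x_β) x_β^{-2ν}`. -/
noncomputable def growthScale (ν : ℝ) (V : ℝ → Matrix (Fin 2) (Fin 2) ℂ) (β : ℝ) : ℝ :=
  deriv (imDiag V) (turningPoint V β) / (turningPoint V β ^ ν) ^ 2

theorem AdmissiblePotential.exists_growthScale_ge {N : ℕ} {ν : ℝ}
    {V : ℝ → Matrix (Fin 2) (Fin 2) ℂ} (h : AdmissiblePotential N ν V) :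
    ∃ ε > (0 : ℝ), ∃ p > (0 : ℝ), ∃ a > (0 : ℝ), ∀ᶠ β in atTop,
      a * turningPoint V β ^ ε ≤ growthScale ν V β ∧ a * β ^ p ≤ growthScale ν V β := by
  obtain ⟨ε, hε, p, hp, a, ha, x₀, hx₀, hg⟩ := h.growth
  refine ⟨ε, hε, p, hp, a, ha, ?_⟩
  filter_upwards [h.eventually_turningPoint x₀] with β ⟨hβ, hβ'⟩
  have h1 := hg _ hβ
  have h0 : 0 < turningPoint V β := lt_of_lt_of_le hx₀ hβ
  have e : turningPoint V β ^ (2 * ν) = (turningPoint V β ^ ν) ^ 2 := by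
    rw [mul_comm, ← Real.rpow_mul_natCast h0.le]
    norm_num
  have hP : 0 < (turningPoint V β ^ ν) ^ 2 := by positivity
  rw [Real.rpow_add h0, e, hβ'] at h1
  unfold growthScale
  rw [le_div_iff₀ hP, le_div_iff₀ hP]
  constructor
  · linarith [h1.1]
  · linarith [h1.2.2]

theorem AdmissiblePotential.tendsto_growthScale {N : ℕ} {ν : ℝ}
    {V : ℝ → Matrix (Fin 2) (Fin 2) ℂ} (h : AdmissiblePotential N ν V) :
    Tendsto (growthScale ν V) atTop atTop := by
  obtain ⟨ε, -, p, hp, a, ha, hg⟩ := h.exists_growthScale_ge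
  exact tendsto_atTop_mono' _ (hg.mono fun β hβ => hβ.2)
    ((tendsto_rpow_atTop hp).const_mul_atTop ha)

/-! ### Subexponential functions -/

/-- `f` grows slower than every exponential of `Φ`. -/
def Subexponential (Φ f : ℝ → ℝ) : Prop :=
  ∀ η > 0, ∀ᶠ β in atTop, f β ≤ Real.exp (η * Φ β)

namespace Subexponential

variable {Φ f g : ℝ → ℝ}

theorem mono (h : Subexponential Φ g) (hfg : ∀ᶠ β in atTop, f β ≤ g β) : Subexponential Φ f :=
  fun η hη => by
  filter_upwards [h η hη, hfg] with β h1 h2 using h2.trans h1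

theorem mul (hf : Subexponential Φ f) (hg : Subexponential Φ g)
    (h0 : ∀ᶠ β in atTop, 0 ≤ g β) : Subexponential Φ (fun β => f β * g β) := fun η hη => by
  filter_upwards [hf (η / 2) (by positivity), hg (η / 2) (by positivity), h0] with β h1 h2 h3
  calc f β * g β ≤ Real.exp (η / 2 * Φ β) * Real.exp (η / 2 * Φ β) :=
        mul_le_mul h1 h2 h3 (Real.exp_pos _).le
    _ = _ := by rw [← Real.exp_add]; ring_nf

theorem const (hΦ : Tendsto Φ atTop atTop) (c : ℝ) : Subexponential Φ (fun _ => c) :=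
  fun _ hη => (Real.tendsto_exp_atTop.comp (hΦ.const_mul_atTop hη)).eventually_ge_atTop c

theorem add (hΦ : Tendsto Φ atTop atTop) (hf : Subexponential Φ f) (hg : Subexponential Φ g) :
    Subexponential Φ (fun β => f β + g β) := fun η hη => by
  filter_upwards [hf (η / 2) (by positivity), hg (η / 2) (by positivity),
    const hΦ 2 (η / 2) (by positivity)] with β h1 h2 h3
  calc f β + g β ≤ 2 * Real.exp (η / 2 * Φ β) := by linarith
    _ ≤ Real.exp (η / 2 * Φ β) * Real.exp (η / 2 * Φ β) := by gcongr
    _ = _ := by rw [← Real.exp_add]; ring_nf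

theorem pow (hΦ : Tendsto Φ atTop atTop) (hf : Subexponential Φ f)
    (h0 : ∀ᶠ β in atTop, 0 ≤ f β) (k : ℕ) : Subexponential Φ (fun β => f β ^ k) := by
  induction k with
  | zero => simpa using const hΦ 1
  | succ k ih => simpa only [pow_succ] using ih.mul hf h0

theorem rpow_self (hΦ : Tendsto Φ atTop atTop) (s : ℝ) : Subexponential Φ (fun β => Φ β ^ s) :=
  fun η hη => by
  have h := ((isLittleO_rpow_exp_pos_mul_atTop s hη).comp_tendsto hΦ).bound one_pos
  filter_upwards [h] with β h1
  simp only [Function.comp_apply, one_mul, Real.norm_eq_abs, Real.abs_exp] at h1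
  exact (le_abs_self _).trans h1

/-- Powers of a function that is bounded by a power of `Φ`. -/
theorem rpow_of_le (hΦ : Tendsto Φ atTop atTop) {a ε : ℝ} (ha : 0 < a) (hε : 0 < ε)
    (h1 : ∀ᶠ β in atTop, 1 ≤ f β) (h : ∀ᶠ β in atTop, a * f β ^ ε ≤ Φ β) (s : ℝ) :
    Subexponential Φ (fun β => f β ^ s) := by
  rcases le_total s 0 with hs | hs
  · refine (const hΦ 1).mono ?_
    filter_upwards [h1] with β h1 using Real.rpow_le_one_of_one_le_of_nonpos h1 hs
  · have h2 := (const hΦ (a⁻¹ ^ (s / ε))).mul (rpow_self hΦ (s / ε))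
      ((hΦ.eventually_ge_atTop 0).mono fun β hβ => Real.rpow_nonneg hβ _)
    refine h2.mono ?_
    filter_upwards [h1, h, hΦ.eventually_ge_atTop 0] with β h3 h4 h5
    have h6 : 0 ≤ f β := by linarith
    rw [← Real.mul_rpow (inv_pos.mpr ha).le h5]
    have h7 : f β ^ ε ≤ a⁻¹ * Φ β := by
      rw [inv_mul_eq_div, le_div_iff₀ ha]
      linarith
    calc f β ^ s = (f β ^ ε) ^ (s / ε) := by
          rw [← Real.rpow_mul h6, mul_div_cancel₀ _ hε.ne']
      _ ≤ _ := Real.rpow_le_rpow (Real.rpow_nonneg h6 _) h7 (div_nonneg hs hε.le)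

end Subexponential

namespace AdmissiblePotential

variable {N : ℕ} {ν : ℝ} {V : ℝ → Matrix (Fin 2) (Fin 2) ℂ} (h : AdmissiblePotential N ν V)

include h

theorem subexponential_turningPoint (s : ℝ) :
    Subexponential (growthScale ν V) (fun β => turningPoint V β ^ s) := by
  obtain ⟨ε, hε, p, hp, a, ha, hg⟩ := h.exists_growthScale_ge
  exact Subexponential.rpow_of_le h.tendsto_growthScale ha hε
    ((h.eventually_turningPoint 1).mono fun β hβ => hβ.1) (hg.mono fun β hβ => hβ.1) s

theorem subexponential_rpow (s : ℝ) : Subexponential (growthScale ν V) (fun β => β ^ s) := by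
  obtain ⟨ε, hε, p, hp, a, ha, hg⟩ := h.exists_growthScale_ge
  exact Subexponential.rpow_of_le h.tendsto_growthScale ha hp (eventually_ge_atTop 1)
    (hg.mono fun β hβ => hβ.2) s

/-- 𝒱'(x_β) is the growth scale times a power of x_β. -/
theorem subexponential_deriv (s : ℝ) : Subexponential (growthScale ν V)
    (fun β => deriv (imDiag V) (turningPoint V β) ^ s) := by
  refine ((Subexponential.rpow_self h.tendsto_growthScale s).mul
    (h.subexponential_turningPoint (2 * ν * s)) ?_).mono ?_
  · filter_upwards [h.eventually_turningPoint 0] with β hβ using Real.rpow_nonneg hβ.1 _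
  · filter_upwards [h.eventually_turningPoint 1, h.tendsto_growthScale.eventually_ge_atTop 0]
      with β hβ h1
    have h0 : 0 < turningPoint V β := lt_of_lt_of_le one_pos hβ.1
    have hP : 0 < (turningPoint V β ^ ν) ^ 2 := by positivity
    have e : turningPoint V β ^ (2 * ν) = (turningPoint V β ^ ν) ^ 2 := by
      rw [mul_comm, ← Real.rpow_mul_natCast h0.le]
      norm_num
    rw [Real.rpow_mul h0.le, e, ← Real.mul_rpow h1 hP.le, growthScale, div_mul_cancel₀ _ hP.ne']

/-- For either sign of ν the hypotheses contain β^(2/3) x_β^s / 𝒱'(x_β)^t = o(|α|), so 1/|α| is at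
most a product of powers already known to be subexponential. -/
theorem subexponential_inv {α : ℝ → ℝ} (hα : HasLowerGrowth N ν V α)
    (hpos : ∀ᶠ β in atTop, 0 < deriv (imDiag V) (turningPoint V β)) :
    Subexponential (growthScale ν V) (fun β => |α β|⁻¹) := by
  obtain ⟨s, t, hst⟩ : ∃ s t : ℝ, (fun β => β ^ (2 / 3 : ℝ) * turningPoint V β ^ s /
      deriv (imDiag V) (turningPoint V β) ^ t) =o[atTop] fun β => |α β| := by
    rcases le_or_gt ν 0 with hν | hν
    · exact ⟨_, _, hα.1 hν⟩
    · exact ⟨_, _, (hα.2 hν).2⟩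
  refine (((h.subexponential_rpow (-(2 / 3 : ℝ))).mul (h.subexponential_turningPoint (-s)) ?_).mul
    (h.subexponential_deriv t) ?_).mono ?_
  · filter_upwards [h.eventually_turningPoint 0] with β hβ using Real.rpow_nonneg hβ.1 _
  · filter_upwards [hpos] with β hβ using Real.rpow_nonneg hβ.le _
  · filter_upwards [h.eventually_turningPoint 1, hpos, eventually_gt_atTop 0, hst.bound one_pos]
      with β hβ hT hβ0 h1
    have h0 : 0 < turningPoint V β := lt_of_lt_of_le one_pos hβ.1
    have hp : 0 < β ^ (2 / 3 : ℝ) * turningPoint V β ^ s /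
      deriv (imDiag V) (turningPoint V β) ^ t := by positivity
    rw [Real.norm_of_nonneg hp.le, one_mul, Real.norm_eq_abs, abs_abs] at h1
    refine (inv_anti₀ hp h1).trans_eq ?_
    rw [Real.rpow_neg hβ0.le, Real.rpow_neg h0.le, inv_div, div_eq_mul_inv, mul_inv]
    ring

end AdmissiblePotential

/-! ### Growth of `|α|` and the higher transport terms -/

/-- Raise the inequality to the power j and fill up the exponent of w to q using w ≤ z; a single
factor ε is kept from ε^j. -/
theorem pow_mul_le_of_mul_le {u w z r ε : ℝ} {j q : ℕ} (hu : 0 ≤ u) (hw : 0 ≤ w) (hwz : w ≤ z)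
    (hε : 0 ≤ ε) (hε1 : ε ≤ 1) (hr : 0 ≤ r) (hj : 1 ≤ j) (hjq : j ≤ q) (h : u * w ≤ ε * r * z) :
    u ^ j * w ^ q ≤ ε * (z ^ q * r ^ j) := by
  obtain ⟨i, rfl⟩ := Nat.exists_eq_add_of_le hjq
  have hz : 0 ≤ z := hw.trans hwz
  have h1 : (u * w) ^ j ≤ (ε * r * z) ^ j := pow_le_pow_left₀ (by positivity) h j
  have h2 : ε ^ j ≤ ε := pow_le_of_le_one hε hε1 (by omega)
  calc u ^ j * w ^ (j + i) = (u * w) ^ j * w ^ i := by ring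
    _ ≤ (ε * r * z) ^ j * z ^ i := by gcongr
    _ = ε ^ j * (z ^ (j + i) * r ^ j) := by ring
    _ ≤ _ := by gcongr

theorem rpow_two_thirds {B : ℝ} (hB : 0 ≤ B) : ∃ b : ℝ, 0 ≤ b ∧ b ^ 3 = B ∧ B ^ (2 / 3 : ℝ) = b ^ 2 := by
  refine ⟨B ^ (1 / 3 : ℝ), Real.rpow_nonneg hB _, ?_, ?_⟩ <;>
  · rw [← Real.rpow_mul_natCast hB]
    norm_num

theorem rpow_one_div_pow {T : ℝ} (hT : 0 ≤ T) {k : ℕ} (hk : k ≠ 0) : (T ^ (1 / (k : ℝ))) ^ k = T := by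
  rw [one_div, Real.rpow_inv_natCast_pow hT hk]

/-- Here P = x_β^ν, T = 𝒱'(x_β), r = |α|, B = β. When β ≤ |α| the factor 1 + β/|α| is at most 2 and
the first growth condition, raised to the power k + 1, suffices. Otherwise it is at most 2β/|α|, and
the second condition is raised to the power 2k + 3 ≤ 2n + 1. Surplus powers of P and B are harmless,
both being at least 1. -/
theorem mul_symbol_pow_le_of_pos {n : ℕ} {P T r B ε ε' : ℝ} (hn : 1 ≤ n) (hP : 1 ≤ P) (hT : 1 ≤ T)
    (hr : 0 < r) (hB : 1 ≤ B) (hε' : 0 < ε') (hε'1 : ε' ≤ 1) (hεε' : 2 ^ (n + 1) * ε' ≤ ε)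
    (h₁ : P ^ 3 / T ^ (1 / (n : ℝ)) ≤ ε' * r)
    (h₂ : B ^ (2 / 3 : ℝ) * P / T ^ (1 / (((2 * n + 1 : ℕ)) : ℝ)) ≤ ε' * r) {k : ℕ} (hk : k < n) :
    P * (P * (1 + B / r)) ^ (k + 2) ≤ ε * (T * r ^ (k + 1)) := by
  have hP0 : 0 < P := by linarith
  have h2k : (2 : ℝ) ^ (k + 2) ≤ 2 ^ (n + 1) := pow_le_pow_right₀ (by norm_num) (by omega)
  have hz : ∀ j : ℕ, 1 ≤ T ^ (1 / (j : ℝ)) := fun j =>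
    Real.one_le_rpow hT (by positivity)
  rcases le_total B r with hBr | hBr
  · have hτ : 1 + B / r ≤ 2 := by
      have : B / r ≤ 1 := (div_le_one hr).mpr hBr
      linarith
    set z := T ^ (1 / (n : ℝ)) with hzdef
    have hz1 : 1 ≤ z := hz n
    have hzn : z ^ n = T := rpow_one_div_pow (by linarith) (by omega)
    rw [div_le_iff₀ (by linarith)] at h₁
    have h3 := pow_mul_le_of_mul_le (u := P ^ 3) (w := 1) (z := z) (j := k + 1) (q := n) (r := r)
      (by positivity) zero_le_one hz1 hε'.le hε'1 hr.le (by omega) (by omega) (by linarith)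
    rw [one_pow, mul_one, hzn] at h3
    have h4 : P ^ (k + 3) ≤ (P ^ 3) ^ (k + 1) := by
      rw [← pow_mul]
      exact pow_le_pow_right₀ hP (by omega)
    calc P * (P * (1 + B / r)) ^ (k + 2) ≤ P * (P * 2) ^ (k + 2) := by gcongr
      _ = 2 ^ (k + 2) * P ^ (k + 3) := by ring
      _ ≤ 2 ^ (n + 1) * (ε' * (T * r ^ (k + 1))) := by
        gcongr
        exact h4.trans h3
      _ = (2 ^ (n + 1) * ε') * (T * r ^ (k + 1)) := by ring
      _ ≤ _ := by gcongr
  · have hτ : 1 + B / r ≤ 2 * (B / r) := by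
      have : 1 ≤ B / r := (one_le_div hr).mpr hBr
      linarith
    obtain ⟨b, hb0, hb3, hb2⟩ := rpow_two_thirds (by linarith : 0 ≤ B)
    have hb1 : 1 ≤ b := by
      by_contra hb
      have := pow_lt_one₀ hb0 (not_le.mp hb) (by norm_num : 3 ≠ 0)
      linarith
    set z := T ^ (1 / (((2 * n + 1 : ℕ)) : ℝ)) with hzdef
    have hz1 : 1 ≤ z := hz _
    have hzn : z ^ (2 * n + 1) = T := rpow_one_div_pow (by linarith) (by omega)
    rw [div_le_iff₀ (by linarith), hb2] at h₂
    have h3 := pow_mul_le_of_mul_le (u := b ^ 2 * P) (w := 1) (z := z) (j := 2 * k + 3)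
      (q := 2 * n + 1) (r := r)
      (by positivity) zero_le_one hz1 hε'.le hε'1 hr.le (by omega) (by omega) (by linarith)
    rw [one_pow, mul_one, hzn] at h3
    have h4 : B ^ (k + 2) * P ^ (k + 3) ≤ (b ^ 2 * P) ^ (2 * k + 3) := by
      rw [← hb3, mul_pow, ← pow_mul, ← pow_mul]
      exact mul_le_mul (pow_le_pow_right₀ hb1 (by omega)) (pow_le_pow_right₀ hP (by omega))
        (by positivity) (by positivity)
    calc P * (P * (1 + B / r)) ^ (k + 2) ≤ P * (P * (2 * (B / r))) ^ (k + 2) := by gcongr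
      _ = 2 ^ (k + 2) * (B ^ (k + 2) * P ^ (k + 3)) / r ^ (k + 2) := by
        rw [mul_pow, mul_pow, div_pow]
        ring
      _ ≤ 2 ^ (n + 1) * (ε' * (T * r ^ (2 * k + 3))) / r ^ (k + 2) := by
        gcongr ?_ * ?_ / _
        exact h4.trans h3
      _ = (2 ^ (n + 1) * ε') * (T * r ^ (k + 1)) := by
        have : r ^ (2 * k + 3) = r ^ (k + 1) * r ^ (k + 2) := by ring
        rw [this]
        field_simp
      _ ≤ _ := by gcongr

/-- With P = x_β^ν ≤ 1 surplus powers of P no longer help, so the exponent in the growth condition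
is split as h·w with h = √P and w^(2n+1) = h³. Either T ≥ h³ and the argument by powers closes, or T
≤ h³. In the second case the condition forces r ≥ B^(2/3) h, hence T ≤ P r, and the smaller scale
with the square root becomes available. -/
theorem mul_symbol_pow_le_of_nonpos {n : ℕ} {h P T r B ε ε' w : ℝ} (hh : 0 < h)
    (hhP : h ^ 2 = P) (hP : P ≤ 1) (hT : 0 < T) (hr : 0 < r) (hB : 1 ≤ B) (hε' : 0 < ε')
    (hε'1 : ε' ≤ 1) (hεε' : 2 ^ (n + 1) * ε' ≤ ε) (hΦ : 2 ^ (n + 1) * P ^ 2 ≤ ε * T) (hw : 0 < w)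
    (hw' : w ^ (2 * n + 1) = h ^ 3)
    (h₂ : B ^ (2 / 3 : ℝ) * (h * w) / T ^ (1 / (((2 * n + 1 : ℕ)) : ℝ)) ≤ ε' * r) :
    (∀ k < n, P * (P * (1 + B / r)) ^ (k + 2) ≤ ε * (T * r ^ (k + 1))) ∨
    (T ≤ P * r ∧ ∀ k < n, P * (P * √(1 + B / r)) ^ (k + 2) ≤ ε * (T * r ^ (k + 1))) := by
  have hP0 : 0 < P := by rw [← hhP]; positivity
  have h2k : ∀ k < n, (2 : ℝ) ^ (k + 2) ≤ 2 ^ (n + 1) := fun k hk =>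
    pow_le_pow_right₀ (by norm_num) (by omega)
  obtain ⟨b, hb0, hb3, hb2⟩ := rpow_two_thirds (by linarith : 0 ≤ B)
  have hb1 : 1 ≤ b := by
    by_contra hb
    have := pow_lt_one₀ hb0 (not_le.mp hb) (by norm_num : 3 ≠ 0)
    linarith
  have hε : 0 ≤ ε := le_trans (by positivity) hεε'
  set z := T ^ (1 / (((2 * n + 1 : ℕ)) : ℝ)) with hzdef
  have hz0 : 0 < z := Real.rpow_pos_of_pos hT _
  have hzn : z ^ (2 * n + 1) = T := rpow_one_div_pow hT.le (by omega)
  rw [div_le_iff₀ hz0, hb2] at h₂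
  -- For β ≤ |α| both candidate scales are at most 2P, and largeness of T/P² alone is enough.
  have far : B ≤ r → ∀ k < n, ∀ t, 0 ≤ t → t ≤ 2 → P * (P * t) ^ (k + 2) ≤ ε * (T * r ^ (k + 1)) :=
    fun hBr k hk t ht0 ht => by
      have h4 : P ^ (k + 3) ≤ P ^ 2 := pow_le_pow_of_le_one hP0.le hP (by omega)
      have h5 : 1 ≤ r ^ (k + 1) := one_le_pow₀ (hB.trans hBr)
      calc P * (P * t) ^ (k + 2) ≤ P * (P * 2) ^ (k + 2) := by gcongr
        _ = 2 ^ (k + 2) * P ^ (k + 3) := by ring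
        _ ≤ 2 ^ (n + 1) * P ^ 2 := by gcongr ?_ * ?_; exact h2k k hk
        _ ≤ ε * T := hΦ
        _ ≤ ε * (T * r ^ (k + 1)) := by
          gcongr
          exact le_mul_of_one_le_right hT.le h5
  have hτ2 : B ≤ r → 1 + B / r ≤ 2 := fun hBr => by
    have : B / r ≤ 1 := (div_le_one hr).mpr hBr
    linarith
  have hτ1 : 1 ≤ 1 + B / r := le_add_of_nonneg_right (by positivity)
  have hτ : r ≤ B → 1 + B / r ≤ 2 * (B / r) := fun hBr => by
    have : 1 ≤ B / r := (one_le_div hr).mpr hBr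
    linarith
  rcases le_total w z with hwz | hwz
  · left
    intro k hk
    rcases le_total B r with hBr | hBr
    · exact far hBr k hk _ (by linarith) (hτ2 hBr)
    have h3 := pow_mul_le_of_mul_le (u := b ^ 2 * h) (w := w) (z := z) (j := 2 * k + 3)
      (q := 2 * n + 1) (r := r)
      (by positivity) hw.le hwz hε'.le hε'1 hr.le (by omega) (by omega) (by linarith)
    rw [hw', hzn] at h3
    have h4 : B ^ (k + 2) * P ^ (k + 3) ≤ (b ^ 2 * h) ^ (2 * k + 3) * h ^ 3 := by
      have e : (b ^ 2 * h) ^ (2 * k + 3) * h ^ 3 = b ^ (4 * k + 6) * h ^ (2 * (k + 3)) := by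
        rw [mul_pow, ← pow_mul]
        ring
      rw [e, ← hb3, ← hhP, ← pow_mul, ← pow_mul]
      gcongr ?_ * _
      exact pow_le_pow_right₀ hb1 (by omega)
    calc P * (P * (1 + B / r)) ^ (k + 2) ≤ P * (P * (2 * (B / r))) ^ (k + 2) := by
          gcongr
          exact hτ hBr
      _ = 2 ^ (k + 2) * (B ^ (k + 2) * P ^ (k + 3)) / r ^ (k + 2) := by
        rw [mul_pow, mul_pow, div_pow]
        ring
      _ ≤ 2 ^ (n + 1) * (ε' * (T * r ^ (2 * k + 3))) / r ^ (k + 2) := by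
        gcongr ?_ * ?_ / _
        · exact h2k k hk
        · exact h4.trans h3
      _ = (2 ^ (n + 1) * ε') * (T * r ^ (k + 1)) := by
        have : r ^ (2 * k + 3) = r ^ (k + 1) * r ^ (k + 2) := by ring
        rw [this]
        field_simp
      _ ≤ _ := by gcongr
  · right
    have hTh : T ≤ h ^ 3 := by
      rw [← hzn, ← hw']
      exact pow_le_pow_left₀ hz0.le hwz _
    have hr1 : b ^ 2 * h ≤ r := by
      refine le_of_mul_le_mul_right ?_ hz0
      calc b ^ 2 * h * z ≤ b ^ 2 * h * w := by gcongr
        _ ≤ ε' * r * z := by linarith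
        _ ≤ 1 * r * z := by gcongr
        _ = _ := by ring
    have hh1 : h ≤ 1 := by
      by_contra hc
      nlinarith [not_le.mp hc]
    refine ⟨?_, fun k hk => ?_⟩
    · calc T ≤ h ^ 3 := hTh
        _ = P * (1 * h) := by rw [← hhP]; ring
        _ ≤ P * (b ^ 2 * h) := by
          gcongr
          exact one_le_pow₀ hb1
        _ ≤ _ := by gcongr
    have hs1 : 1 ≤ √(1 + B / r) := Real.one_le_sqrt.mpr hτ1
    have hss : √(1 + B / r) ^ 2 = 1 + B / r := Real.sq_sqrt (by linarith)
    set σ := √(1 + B / r)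
    rcases le_total B r with hBr | hBr
    · refine far hBr k hk _ (by linarith) ?_
      have := hτ2 hBr
      nlinarith
    -- Two of the k + 2 factors are estimated through (Pσ)² ≤ 2P²B/r and this bound, the other k
    -- through Pσ ≤ 2r.
    have hPB : P * b ^ 3 ≤ r ^ 2 := by
      calc P * b ^ 3 ≤ P * b ^ 4 :=
            mul_le_mul_of_nonneg_left (pow_le_pow_right₀ hb1 (by norm_num)) hP0.le
        _ = (b ^ 2 * h) ^ 2 := by rw [← hhP]; ring
        _ ≤ _ := by gcongr
    have hsq : (P * σ) ^ 2 ≤ 2 * P ^ 2 * B / r := by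
      rw [mul_pow, hss]
      calc P ^ 2 * (1 + B / r) ≤ P ^ 2 * (2 * (B / r)) := by
            gcongr
            exact hτ hBr
        _ = _ := by ring
    have hμr : P * σ ≤ 2 * r := by
      refine (sq_le_sq₀ (by positivity) (by positivity)).mp ?_
      refine hsq.trans ?_
      rw [div_le_iff₀ hr]
      have h6 : P ^ 2 * B ≤ r ^ 3 := by
        calc P ^ 2 * B = h * (h ^ 3 * b ^ 3) := by rw [← hhP, ← hb3]; ring
          _ ≤ 1 * (h ^ 3 * b ^ 6) := by
            have := pow_le_pow_right₀ hb1 (by norm_num : 3 ≤ 6)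
            gcongr
          _ = (b ^ 2 * h) ^ 3 := by ring
          _ ≤ _ := by gcongr
      nlinarith [pow_pos hr 3]
    calc P * (P * σ) ^ (k + 2) = P * ((P * σ) ^ k * (P * σ) ^ 2) := by ring
      _ ≤ P * ((2 * r) ^ k * (2 * P ^ 2 * B / r)) := by gcongr
      _ = 2 ^ (k + 1) * P ^ 2 * (P * b ^ 3) * r ^ k / r := by rw [← hb3]; ring
      _ ≤ 2 ^ (n + 1) * P ^ 2 * r ^ 2 * r ^ k / r := by
        have : (2 : ℝ) ^ (k + 1) ≤ 2 ^ (n + 1) := pow_le_pow_right₀ (by norm_num) (by omega)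
        gcongr
      _ ≤ ε * T * r ^ 2 * r ^ k / r := by gcongr
      _ = _ := by
        field_simp
        ring

/-- The higher transport terms are negligible with respect to the large parameter. -/
theorem HasLowerGrowth.eventually_symbol_pow_le {n : ℕ} {ν : ℝ}
    {V : ℝ → Matrix (Fin 2) (Fin 2) ℂ} {α : ℝ → ℝ} (hα : HasLowerGrowth (n + 1) ν V α)
    (hV : AdmissiblePotential (n + 1) ν V) (hn : 1 ≤ n) (hα0 : ∀ᶠ β in atTop, α β ≠ 0) {ε : ℝ} (hε : 0 < ε) :
    ∀ᶠ β in atTop,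
      (∀ k < n, (turningPoint V β ^ ν)⁻¹ * ((turningPoint V β ^ ν * (1 + β / |α β|)) ^ (k + 2) /
        |α β| ^ (k + 1)) ≤ ε * growthScale ν V β) ∨
      (deriv (imDiag V) (turningPoint V β) ≤ turningPoint V β ^ ν * |α β| ∧
      ∀ k < n, (turningPoint V β ^ ν)⁻¹ * ((turningPoint V β ^ ν * √(1 + β / |α β|)) ^ (k + 2) /
        |α β| ^ (k + 1)) ≤ ε * growthScale ν V β) := by
  set ε' := min 1 (ε / 2 ^ (n + 1)) with hε'def
  have hε' : 0 < ε' := by positivity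
  have hε'1 : ε' ≤ 1 := min_le_left _ _
  have hεε' : 2 ^ (n + 1) * ε' ≤ ε := by
    have := min_le_right 1 (ε / 2 ^ (n + 1))
    rw [le_div_iff₀ (by positivity)] at this
    linarith
  -- The desired inequality after clearing denominators, with growth scale T/P².
  have conv : ∀ {P T r μ : ℝ} {k : ℕ}, 0 < P → 0 < r →
      P * μ ^ (k + 2) ≤ ε * (T * r ^ (k + 1)) → P⁻¹ * (μ ^ (k + 2) / r ^ (k + 1)) ≤ ε * (T / P ^ 2) :=
    fun {P T r μ k} hP hr h => by
      rw [← mul_div_assoc, ← mul_div_assoc, div_le_div_iff₀ (by positivity) (by positivity)]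
      calc P⁻¹ * μ ^ (k + 2) * P ^ 2 = P * μ ^ (k + 2) := by field_simp
        _ ≤ _ := h
        _ = _ := by ring
  have hq : 2 * (((n + 1 : ℕ)) : ℝ) - 1 = ((2 * n + 1 : ℕ) : ℝ) := by
    push_cast
    ring
  have hΦ := hV.tendsto_growthScale.eventually_ge_atTop (max 1 (2 ^ (n + 1) / ε))
  rcases le_or_gt ν 0 with hν | hν
  · have h1 := (hα.1 hν).bound hε'
    filter_upwards [h1, hα0, hV.eventually_turningPoint 1, hΦ, eventually_ge_atTop 1]
      with β h1 hα0 ⟨hx, _⟩ hΦ hβ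
    have hx0 : 0 < turningPoint V β := lt_of_lt_of_le one_pos hx
    have hP0 : 0 < turningPoint V β ^ ν := Real.rpow_pos_of_pos hx0 _
    have hr := abs_pos.mpr hα0
    unfold growthScale at hΦ ⊢
    set x := turningPoint V β
    set T := deriv (imDiag V) x
    rw [le_div_iff₀ (by positivity)] at hΦ
    have hT : 0 < T := lt_of_lt_of_le (by positivity) hΦ
    rw [hq, Real.norm_of_nonneg (by positivity), Real.norm_of_nonneg (abs_nonneg _)] at h1
    -- With N = n + 1 the exponent is (n+2)/(2n+1) = 1/2 + 3/(2(2n+1)), which yields the splitting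
    -- into h and w.
    have e1 : x ^ ((((n + 1 : ℕ) : ℝ) + 1) / ((2 * n + 1 : ℕ) : ℝ) * ν) =
        x ^ (ν / 2) * x ^ (3 * ν / (2 * ((2 * n + 1 : ℕ) : ℝ))) := by
      rw [← Real.rpow_add hx0]
      congr 1
      push_cast
      field_simp
      ring
    rw [e1] at h1
    have := mul_symbol_pow_le_of_nonpos (n := n) (P := x ^ ν) (h := x ^ (ν / 2)) (ε := ε)
      (Real.rpow_pos_of_pos hx0 _)
      (by rw [← Real.rpow_mul_natCast hx0.le]; norm_num)
      (Real.rpow_le_one_of_one_le_of_nonpos hx hν) hT hr hβ hε' hε'1 hεε' ?_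
      (Real.rpow_pos_of_pos hx0 _) ?_ h1
    · rcases this with h | ⟨h, h'⟩
      · exact Or.inl fun k hk => conv hP0 hr (h k hk)
      · exact Or.inr ⟨h, fun k hk => conv hP0 hr (h' k hk)⟩
    · have := (mul_le_mul_of_nonneg_right (le_max_right 1 (2 ^ (n + 1) / ε))
        (by positivity : 0 ≤ (x ^ ν) ^ 2)).trans hΦ
      rw [div_mul_eq_mul_div, div_le_iff₀ hε] at this
      linarith
    · rw [← Real.rpow_mul_natCast hx0.le, ← Real.rpow_mul_natCast hx0.le]
      congr 1
      push_cast
      field_simp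
  · have h1 := (hα.2 hν).1.bound hε'
    have h2 := (hα.2 hν).2.bound hε'
    filter_upwards [h1, h2, hα0, hV.eventually_turningPoint 1, hΦ, eventually_ge_atTop 1]
      with β h1 h2 hα0 ⟨hx, _⟩ hΦ hβ
    have hx0 : 0 < turningPoint V β := lt_of_lt_of_le one_pos hx
    have hP1 : 1 ≤ turningPoint V β ^ ν := Real.one_le_rpow hx hν.le
    have hP0 : 0 < turningPoint V β ^ ν := Real.rpow_pos_of_pos hx0 _
    have hr := abs_pos.mpr hα0
    unfold growthScale at hΦ ⊢
    set x := turningPoint V β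
    set T := deriv (imDiag V) x
    rw [le_div_iff₀ (by positivity)] at hΦ
    have hT : 1 ≤ T := by
      have h3 : (1 : ℝ) ≤ (x ^ ν) ^ 2 := one_le_pow₀ hP1
      have h4 : (1 : ℝ) ≤ max 1 (2 ^ (n + 1) / ε) := le_max_left _ _
      nlinarith
    rw [Real.norm_of_nonneg (by positivity), Real.norm_of_nonneg (abs_nonneg _)] at h1
    rw [hq, Real.norm_of_nonneg (by positivity), Real.norm_of_nonneg (abs_nonneg _)] at h2
    have e1 : x ^ (3 * ν) = (x ^ ν) ^ 3 := by
      rw [mul_comm, ← Real.rpow_mul_natCast hx0.le]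
      norm_num
    have e2 : (((n + 1 : ℕ)) : ℝ) - 1 = n := by push_cast; ring
    rw [e1, e2] at h1
    exact Or.inl fun k hk => conv hP0 hr
      (mul_symbol_pow_le_of_pos hn hP1 hT hr hβ hε' hε'1 hεε' h1 h2 hk)

/-! ### The estimate for the pseudomode at a fixed turning point -/

namespace WindowData

variable {m : ℝ} {V : ℝ → Matrix (Fin 2) (Fin 2) ℂ} {xb : ℝ} {lam s : ℂ} {n : ℕ}
    {U : Set ℝ} {μ r C₀ C : ℝ} (W : WindowData m V xb lam s n U μ r C₀)

include W

theorem norm_phaseDeriv_zero_le {Λ : ℝ}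
    (hΛ : ∀ x ∈ U, ‖factorA m V lam x‖ ≤ Λ ∧ ‖factorB m V lam x‖ ≤ Λ) {x : ℝ} (hx : x ∈ U) :
    ‖phaseDeriv m V xb lam s 0 x‖ ≤ Λ := by
  have h := W.norm_phaseDeriv_zero_sq x
  obtain ⟨h1, h2⟩ := hΛ x hx
  have hΛ0 : 0 ≤ Λ := (norm_nonneg _).trans h1
  refine (sq_le_sq₀ (norm_nonneg _) hΛ0).mp ?_
  rw [h, sq]
  exact mul_le_mul h1 h2 (norm_nonneg _) hΛ0

/-- The terms with derivatives of the cut-off function. -/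
theorem norm_cutoffTerm_le (hC : 0 ≤ C) (hκ : SymbolOn U μ n (C * μ) (logDerivK m V xb lam))
    (hP : ∀ k i, k + i ≤ n →
      SymbolOn U μ i (C * (μ ^ (k + 1) / r ^ k)) (phaseDeriv m V xb lam s (k + 1)))
    {Λ : ℝ} (hΛ : ∀ x ∈ U, ‖factorA m V lam x‖ ≤ Λ ∧ ‖factorB m V lam x‖ ≤ Λ) {ξ : ℝ → ℝ}
    {M₁ M₂ x : ℝ} (hx : x ∈ U) (h₁ : |deriv ξ x| ≤ M₁) (h₂ : |iteratedDeriv 2 ξ x| ≤ M₂) :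
    ‖cutoffTerm m V xb lam s n ξ x‖ ≤
      C₀ / r * (M₂ + 2 * M₁ * (Λ + ∑ k ∈ Finset.range (n + 1), C * (μ ^ (k + 1) / r ^ k)) +
        C * μ * M₁) * ‖k1 V xb x * Complex.exp (-phase m V xb lam s (n + 1) x)‖ := by
  have hr := W.r_pos
  have hμ := W.mu_nonneg
  have hΛ0 : 0 ≤ Λ := (norm_nonneg _).trans (hΛ x hx).1
  have hM₁ : 0 ≤ M₁ := (abs_nonneg _).trans h₁
  have hM₂ : 0 ≤ M₂ := (abs_nonneg _).trans h₂
  have hS : ‖∑ k ∈ Finset.range (n + 2), phaseDeriv m V xb lam s k x‖ ≤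
      Λ + ∑ k ∈ Finset.range (n + 1), C * (μ ^ (k + 1) / r ^ k) := by
    rw [Finset.sum_range_succ', add_comm]
    refine (norm_add_le _ _).trans (add_le_add (W.norm_phaseDeriv_zero_le hΛ hx) ?_)
    refine norm_sum_le_of_le _ fun k hk => ?_
    exact (hP k 0 (by have := Finset.mem_range.mp hk; omega)).norm_le hx
  set B₁ := Λ + ∑ k ∈ Finset.range (n + 1), C * (μ ^ (k + 1) / r ^ k)
  have hb := W.norm_inv_B_le hx
  have hk := hκ.norm_le hx
  unfold cutoffTerm
  have e : k1 V xb x * (factorB m V lam x)⁻¹ * Complex.exp (-phase m V xb lam s (n + 1) x) =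
      (factorB m V lam x)⁻¹ * (k1 V xb x * Complex.exp (-phase m V xb lam s (n + 1) x)) := by ring
  rw [e, norm_mul, norm_mul, mul_right_comm]
  refine mul_le_mul_of_nonneg_right (mul_le_mul hb ?_ (norm_nonneg _) ?_) (norm_nonneg _)
  · refine (norm_add_le _ _).trans (add_le_add ((norm_sub_le _ _).trans (add_le_add ?_ ?_)) ?_)
    · simpa using h₂
    · rw [norm_mul, norm_mul, Complex.norm_real, Real.norm_eq_abs, Complex.norm_ofNat]
      gcongr
    · rw [norm_mul, Complex.norm_real, Real.norm_eq_abs]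
      gcongr
  · exact div_nonneg W.const_nonneg hr.le

/-- Derivatives of ξ live where the modulus of k₁e^{-P} is at most R e^{-F_i}, whereas Ψ is at least
w₀ on a small central interval. The hypotheses `h₁`, `h₂` let the surplus e^{(1-c)F_i} absorb the
amplitude G, the prefactors and the ratio of interval lengths, leaving e^{-cF_i}. -/
theorem quasimode_bound (hC : 0 ≤ C) (hκ : SymbolOn U μ n (C * μ) (logDerivK m V xb lam))
    (hP : ∀ k i, k + i ≤ n →
      SymbolOn U μ i (C * (μ ^ (k + 1) / r ^ k)) (phaseDeriv m V xb lam s (k + 1)))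
    {Λ : ℝ} (hΛ : ∀ x ∈ U, ‖factorA m V lam x‖ ≤ Λ ∧ ‖factorB m V lam x‖ ≤ Λ) {ξ : ℝ → ℝ}
    (hξ : ContDiff ℝ ∞ ξ) (hξ0 : ∀ x, 0 ≤ ξ x) {δ M : ℝ} (hδ : 0 < δ)
    (hU : Icc (xb - δ) (xb + δ) ⊆ U) (hξ1 : ∀ x ∈ Ioo (xb - δ / 2) (xb + δ / 2), ξ x = 1)
    (hoff : ∀ x ∉ Ioo (xb - δ) (xb + δ), ξ x = 0)
    (hξd : ∀ j ∈ Finset.Icc 1 2, ∀ x, |iteratedDeriv j ξ x| ≤ M * δ⁻¹ ^ j)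
    {F₁ F₂ R η w₀ c G : ℝ} (hη : 0 < η) (hη' : η < 1 / 2)
    (hw₁ : ∀ x ∈ Icc (xb - δ) (xb - δ / 2),
      ‖k1 V xb x * Complex.exp (-phase m V xb lam s (n + 1) x)‖ ≤ R * Real.exp (-F₁))
    (hw₂ : ∀ x ∈ Icc (xb + δ / 2) (xb + δ),
      ‖k1 V xb x * Complex.exp (-phase m V xb lam s (n + 1) x)‖ ≤ R * Real.exp (-F₂))
    (hw : ∀ x ∈ Icc (xb - η * δ) (xb + η * δ),
      w₀ ≤ ‖k1 V xb x * Complex.exp (-phase m V xb lam s (n + 1) x)‖) (hw₀ : 0 < w₀)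
    (hR : 0 ≤ R)
    (hG : C₀ / r * (M * δ⁻¹ ^ 2 + 2 * (M * δ⁻¹) *
      (Λ + ∑ k ∈ Finset.range (n + 1), C * (μ ^ (k + 1) / r ^ k)) + C * μ * (M * δ⁻¹)) ≤ G)
    (h₁ : G * R * √(1 / (4 * η)) ≤ w₀ * Real.exp ((1 - c) * F₁))
    (h₂ : G * R * √(1 / (4 * η)) ≤ w₀ * Real.exp ((1 - c) * F₂)) :
    ∃ hL : MemLp (mode m V xb lam s (n + 1) ξ) 2 (volume.restrict (Ioi (0 : ℝ))),
    ∃ hD : hL.toLp _ ∈ (diracOp m V).domain, hL.toLp _ ≠ 0 ∧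
      ‖diracOp m V ⟨hL.toLp _, hD⟩ - lam • hL.toLp _‖ / ‖hL.toLp _‖ ≤
        Real.exp (-c * F₁) + Real.exp (-c * F₂) + C₀ * ((n + 1) ^ 2 * C ^ 2 + C + C ^ 2) *
          ∑ i ∈ Finset.range (n + 1), μ ^ (n + 1 + i + 1) / r ^ (n + 1 + i) := by
  have hr := W.r_pos
  have hμ := W.mu_nonneg
  have hC₀ := W.const_nonneg
  have hxb : xb ∈ Ioo (xb - δ / 2) (xb + δ / 2) := ⟨by linarith, by linarith⟩
  have hΛ0 : 0 ≤ Λ := (norm_nonneg _).trans (hΛ xb W.mem).1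
  have hd1 : ∀ x, |deriv ξ x| ≤ M * δ⁻¹ := fun x => by
    have := hξd 1 (by simp) x
    rwa [iteratedDeriv_one, pow_one] at this
  have hd2 : ∀ x, |iteratedDeriv 2 ξ x| ≤ M * δ⁻¹ ^ 2 := fun x => hξd 2 (by simp) x
  have hM : 0 ≤ M * δ⁻¹ := (abs_nonneg _).trans (hd1 0)
  have hM2 : 0 ≤ M * δ⁻¹ ^ 2 := (abs_nonneg _).trans (hd2 0)
  have hsum : 0 ≤ ∑ k ∈ Finset.range (n + 1), C * (μ ^ (k + 1) / r ^ k) :=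
    Finset.sum_nonneg fun k _ => by positivity
  have hG0 : 0 ≤ G := le_trans (by positivity) hG
  obtain ⟨g, hL, hg, himg, hpt⟩ := W.exists_isDiracImage hC hκ hP hξ hξ0
    (p := xb - δ) (q := xb + δ) (by linarith) hU hoff
  obtain ⟨hD, hval⟩ := diracOp_apply hL hg himg
  set Kc := C₀ * ((n + 1) ^ 2 * C ^ 2 + C + C ^ 2) *
          ∑ i ∈ Finset.range (n + 1), μ ^ (n + 1 + i + 1) / r ^ (n + 1 + i) with hKc
  have hKc0 : 0 ≤ Kc := mul_nonneg (by positivity) (Finset.sum_nonneg fun k _ => by positivity)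
  have hcutG : ∀ x ∈ U, ‖cutoffTerm m V xb lam s n ξ x‖ ≤
      G * ‖k1 V xb x * Complex.exp (-phase m V xb lam s (n + 1) x)‖ := fun x hx =>
    (W.norm_cutoffTerm_le hC hκ hP hΛ hx (hd1 x) (hd2 x)).trans (by gcongr)
  have hcut : ∀ x ∈ Icc (xb - δ) (xb + δ), ‖cutoffTerm m V xb lam s n ξ x‖ ≤
      (Icc (xb - δ) (xb - δ / 2)).indicator (fun _ => G * (R * Real.exp (-F₁))) x +
      (Icc (xb + δ / 2) (xb + δ)).indicator (fun _ => G * (R * Real.exp (-F₂))) x := by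
    intro x hx
    have n1 : 0 ≤ (Icc (xb - δ) (xb - δ / 2)).indicator (fun _ => G * (R * Real.exp (-F₁))) x :=
      indicator_nonneg (fun _ _ => by positivity) x
    have n2 : 0 ≤ (Icc (xb + δ / 2) (xb + δ)).indicator (fun _ => G * (R * Real.exp (-F₂))) x :=
      indicator_nonneg (fun _ _ => by positivity) x
    by_cases ha : x ≤ xb - δ / 2
    · have hm : x ∈ Icc (xb - δ) (xb - δ / 2) := ⟨hx.1, ha⟩
      rw [indicator_of_mem hm]
      have := (hcutG x (hU hx)).trans (mul_le_mul_of_nonneg_left (hw₁ x hm) hG0)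
      linarith
    by_cases hb : xb + δ / 2 ≤ x
    · have hm : x ∈ Icc (xb + δ / 2) (xb + δ) := ⟨hb, hx.2⟩
      rw [indicator_of_mem hm]
      have := (hcutG x (hU hx)).trans (mul_le_mul_of_nonneg_left (hw₂ x hm) hG0)
      linarith
    have hm : x ∈ Ioo (xb - δ / 2) (xb + δ / 2) := ⟨not_le.mp ha, not_le.mp hb⟩
    have hev : ξ =ᶠ[𝓝 x] fun _ => 1 := by
      filter_upwards [isOpen_Ioo.mem_nhds hm] with y hy using hξ1 y hy
    have z1 : deriv ξ x = 0 := by rw [hev.deriv_eq]; simp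
    have z2 : iteratedDeriv 2 ξ x = 0 := by rw [hev.iteratedDeriv_eq]; simp [iteratedDeriv_const]
    have : cutoffTerm m V xb lam s n ξ x = 0 := by simp [cutoffTerm, z1, z2]
    rw [this, norm_zero]
    exact add_nonneg n1 n2
  have hlow : ∀ x ∈ Icc (xb - η * δ) (xb + η * δ), w₀ ≤ ‖mode m V xb lam s (n + 1) ξ x‖ := by
    intro x hx
    refine (hw x hx).trans ?_
    have hm : ξ x = 1 := hξ1 x ⟨by nlinarith [hx.1], by nlinarith [hx.2]⟩
    have h3 := PiLp.norm_apply_le (mode m V xb lam s (n + 1) ξ x) 0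
    refine le_of_eq_of_le ?_ h3
    simp [mode, modeU, hm]
  have hc0 : 0 < xb - η * δ := by
    have h4 : xb - δ ∈ U := hU ⟨le_rfl, by linarith⟩
    have h5 : 0 < xb - δ := W.subset h4
    nlinarith
  have hsq : √(1 / (4 * η)) ^ 2 = 1 / (4 * η) := Real.sq_sqrt (by positivity)
  -- Each outer interval has length δ/2 and the central one 2ηδ, whence the ratio 1/(4η).
  have hlen : δ / 2 ≤ √(1 / (4 * η)) ^ 2 * ((xb + η * δ) - (xb - η * δ)) := by
    rw [hsq]
    apply le_of_eq
    field_simp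
    ring
  obtain ⟨hne, hbd⟩ := norm_sub_smul_le_of_pointwise hL hg (K := Kc) (lam := lam)
    (cut := cutoffTerm m V xb lam s n ξ) (p := xb - δ) (q := xb + δ)
    (a₁ := xb - δ) (b₁ := xb - δ / 2) (a₂ := xb + δ / 2) (b₂ := xb + δ)
    (c := xb - η * δ) (d := xb + η * δ) (w₀ := w₀) (L := √(1 / (4 * η))) hKc0
    (Q₁ := G * (R * Real.exp (-F₁))) (Q₂ := G * (R * Real.exp (-F₂)))
    (by positivity) (by positivity) (by linarith) (by linarith) hc0
    (by have := mul_pos hη hδ; linarith) hw₀ (Real.sqrt_nonneg _)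
    (by linarith) (by linarith) hpt hcut hlow
  refine ⟨hL, hD, hne, ?_⟩
  rw [hval]
  refine hbd.trans (add_le_add_left ?_ _)
  rw [div_le_iff₀ hw₀]
  have key : ∀ F, G * R * √(1 / (4 * η)) ≤ w₀ * Real.exp ((1 - c) * F) →
      G * (R * Real.exp (-F)) * √(1 / (4 * η)) ≤ Real.exp (-c * F) * w₀ := fun F hF => by
    calc G * (R * Real.exp (-F)) * √(1 / (4 * η)) = G * R * √(1 / (4 * η)) * Real.exp (-F) := by ring
      _ ≤ w₀ * Real.exp ((1 - c) * F) * Real.exp (-F) := by gcongr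
      _ = _ := by
        rw [mul_assoc, ← Real.exp_add, mul_comm]
        congr 2
        ring
  linarith [key F₁ h₁, key F₂ h₂]

end WindowData

/-! ### Size of F and of the off-diagonal weight in terms of the growth scale -/

namespace TailBounds

variable {n : ℕ} {ν : ℝ} {V : ℝ → Matrix (Fin 2) (Fin 2) ℂ} {X C : ℝ} (H : TailBounds n ν V X C)

include H

/-- `F` at the endpoints of the inner window. -/
theorem growthScale_le_Fint {β : ℝ} (hx₀ : 4 * X ≤ turningPoint V β)
    (hβ : imDiag V (turningPoint V β) = β) :
    (32 * Real.exp (2 * C * 4 ^ |ν|))⁻¹ * growthScale ν V β ≤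
      Fint V β (turningPoint V β - width ν V β / 2) ∧
    (32 * Real.exp (2 * C * 4 ^ |ν|))⁻¹ * growthScale ν V β ≤
      Fint V β (turningPoint V β + width ν V β / 2) := by
  have h0 := H.pos hx₀
  have hδ : 0 < turningPoint V β ^ (-ν) := Real.rpow_pos_of_pos h0 _
  unfold Fint width growthScale
  set x₀ := turningPoint V β
  have e : ∀ y, (y - x₀) ^ 2 = (x₀ ^ (-ν) / 2 / 2) ^ 2 →
      (32 * Real.exp (2 * C * 4 ^ |ν|))⁻¹ * (deriv (imDiag V) x₀ / (x₀ ^ ν) ^ 2) =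
      (Real.exp (2 * C * 4 ^ |ν|))⁻¹ * deriv (imDiag V) x₀ * ((y - x₀) ^ 2 / 2) := fun y hy => by
    rw [hy, Real.rpow_neg h0.le]
    have := (Real.rpow_pos_of_pos h0 ν).ne'
    field_simp
    norm_num
  constructor
  · rw [e (x₀ - x₀ ^ (-ν) / 2 / 2) (by ring)]
    have := (H.integral_imDiag_sub_bounds hx₀ (x := x₀ - x₀ ^ (-ν) / 2 / 2)
      ⟨by linarith, by linarith⟩).1
    rwa [hβ] at this
  · rw [e (x₀ + x₀ ^ (-ν) / 2 / 2) (by ring)]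
    have := (H.integral_imDiag_sub_bounds hx₀ (x := x₀ + x₀ ^ (-ν) / 2 / 2)
      ⟨by linarith, by linarith⟩).1
    rwa [hβ] at this

theorem tendsto_kappa {N : ℕ} (h : AdmissiblePotential N ν V) {c : ℝ} (hc : 0 < c) :
    Tendsto (fun β => kappa ν V β c) atTop (𝓝 0) := by
  set d := (32 * Real.exp (2 * C * 4 ^ |ν|))⁻¹ with hd
  have hd0 : 0 < d := by positivity
  have h1 : Tendsto (fun β => 2 * Real.exp (-(c * d * growthScale ν V β))) atTop (𝓝 0) := by
    have := (Real.tendsto_exp_neg_atTop_nhds_zero.comp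
      (h.tendsto_growthScale.const_mul_atTop (mul_pos hc hd0))).const_mul 2
    simpa using this
  refine squeeze_zero' (Eventually.of_forall fun β => by unfold kappa; positivity) ?_ h1
  filter_upwards [h.eventually_turningPoint (4 * X)] with β hβ
  obtain ⟨h2, h3⟩ := H.growthScale_le_Fint hβ.1 hβ.2
  unfold kappa
  rw [two_mul]
  refine add_le_add (Real.exp_le_exp.mpr ?_) (Real.exp_le_exp.mpr ?_)
  · nlinarith
  · nlinarith

/-- The integrand is o(x^(-ν) 𝒱') and the interval has length at most x_β^(-ν), so the integral is
o(𝒱'(x_β) x_β^(-2ν)). -/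
theorem eventually_offDiag_integral_le {N : ℕ} (h : AdmissiblePotential N ν V) {ε : ℝ}
    (hε : 0 < ε) : ∀ᶠ β in atTop, ∀ x ∈ bigWindow ν (turningPoint V β),
      |∫ t in turningPoint V β..x, ((V t 0 1).im + (V t 1 0).im)| ≤ ε * growthScale ν V β := by
  set E := Real.exp (2 * C * 4 ^ |ν|) with hE
  have hE0 : 0 < E := Real.exp_pos _
  have hQ : (0 : ℝ) < 4 ^ |ν| := by positivity
  obtain ⟨Y, hY⟩ := eventually_atTop.mp
    (h.offDiag.bound (by positivity : 0 < ε / (4 ^ |ν| * E)))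
  filter_upwards [h.eventually_turningPoint (4 * X), h.eventually_turningPoint (4 * Y)]
    with β h1 h2 x hx
  have hx₀ := h1.1
  have h0 := H.pos hx₀
  have hP : 0 < turningPoint V β ^ ν := Real.rpow_pos_of_pos h0 _
  unfold growthScale
  set x₀ := turningPoint V β
  have hs := mem_bigWindow_self (ν := ν) h0
  have hT := H.deriv_pos x₀ (by linarith [H.one_le_X])
  have hb : ∀ t ∈ uIoc x₀ x, ‖(V t 0 1).im + (V t 1 0).im‖ ≤
      ε / (4 ^ |ν| * E) * ((4 ^ |ν| * (x₀ ^ ν)⁻¹) * (E * deriv (imDiag V) x₀)) := fun t ht => by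
    have ht' : t ∈ bigWindow ν x₀ :=
      (convex_Ioo _ _).ordConnected.uIcc_subset hs hx (uIoc_subset_uIcc ht)
    have hb := bigWindow_bounds H.neg_one_le (by linarith [H.one_le_X]) ht'
    have ht0 : 0 < t := by linarith [hb.1]
    refine (hY t (by linarith [hb.1, h2.1])).trans ?_
    have h3 := H.deriv_imDiag_le hx₀ ht' hs
    have h4 := H.deriv_pos t (H.le_of_mem_bigWindow hx₀ ht')
    have h5 := rpow_le_of_mem_Icc (s := -ν) h0 hb.1 hb.2
    rw [abs_neg, Real.rpow_neg h0.le] at h5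
    rw [Real.norm_of_nonneg (mul_nonneg (Real.rpow_nonneg ht0.le _) h4.le)]
    gcongr
  have h6 := intervalIntegral.norm_integral_le_of_norm_le_const hb
  have h7 : |x - x₀| ≤ (x₀ ^ ν)⁻¹ := by
    have := abs_sub_le_of_mem_bigWindow hx
    rw [Real.rpow_neg h0.le] at this
    have : 0 < (x₀ ^ ν)⁻¹ := inv_pos.mpr hP
    linarith
  refine h6.trans ((mul_le_mul_of_nonneg_left h7 (by positivity)).trans_eq ?_)
  field_simp

end TailBounds

/-! ### The estimate at a fixed turning point in terms of the growth scale -/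

namespace ComparisonData

variable {n : ℕ} {m ν : ℝ} {V : ℝ → Matrix (Fin 2) (Fin 2) ℂ} {X C : ℝ} {x₀ α s : ℝ} {U : Set ℝ}
    {C₁ : ℝ} (D : ComparisonData m ν V x₀ α s U C₁) (H : TailBounds n ν V X C) (hx₀ : 4 * X ≤ x₀)

include D H hx₀

/-- The scale μ remains a parameter, so that either of the two scales can be used for the modulus.
-/
theorem weight_bounds {K B μ ε Φ : ℝ} (hB : 0 ≤ B)
    (hΛ : ∀ x ∈ U, ‖factorA m V (α + imDiag V x₀ * Complex.I) x‖ ≤ K * (|α| + imDiag V x₀) ∧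
        ‖factorB m V (α + imDiag V x₀ * Complex.I) x‖ ≤ K * (|α| + imDiag V x₀))
    (hre : ∀ x ∈ U, (s * factorA m V (α + imDiag V x₀ * Complex.I) x).re ≤ K * |α|)
    (hre' : ∀ x ∈ U, (s * factorB m V (α + imDiag V x₀ * Complex.I) x).re ≤ K * |α|)
    (W : WindowData m V x₀ (α + imDiag V x₀ * Complex.I) s n U μ |α| K)
    (hP : ∀ k i, k + i ≤ n → SymbolOn U μ i (B * (μ ^ (k + 1) / |α| ^ k))
      (phaseDeriv m V x₀ (α + imDiag V x₀ * Complex.I) s (k + 1)))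
    (hoff : ∀ x ∈ bigWindow ν x₀, |∫ t in x₀..x, ((V t 0 1).im + (V t 1 0).im)| ≤ ε * Φ)
    (htr : ∀ k < n, (x₀ ^ ν)⁻¹ * (μ ^ (k + 2) / |α| ^ (k + 1)) ≤ ε * Φ) {x : ℝ} (hx : x ∈ U) :
    ‖k1 V x₀ x * Complex.exp (-phase m V x₀ (α + imDiag V x₀ * Complex.I) s (n + 1) x)‖ ^ 2 ≤
      (K ^ 2 * (1 + imDiag V x₀ / |α|)) ^ 2 * Real.exp ((1 + 2 * (n * B)) * (ε * Φ) -
        2 * ∫ t in x₀..x, (imDiag V t - imDiag V x₀)) ∧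
    Real.exp (-((1 + 2 * (n * B)) * (ε * Φ)) -
        2 * (K ^ 2 * ∫ t in x₀..x, (imDiag V t - imDiag V x₀))) ≤
      (K ^ 2 * (1 + imDiag V x₀ / |α|)) ^ 2 *
        ‖k1 V x₀ x * Complex.exp (-phase m V x₀ (α + imDiag V x₀ * Complex.I) s (n + 1) x)‖ ^ 2 := by
  have h0 := H.pos hx₀
  have hα := abs_pos.mpr D.ne_zero
  have h1 := W.weight_bounds hP (β := imDiag V x₀) (by simp) hΛ hre hre'
    (fun t ht h => H.strictMono.monotoneOn h0 (D.pos_of_mem H hx₀ ht) h)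
    (fun t ht h => H.strictMono.monotoneOn (D.pos_of_mem H hx₀ ht) h0 h) hx
    (hoff x (D.subset hx)) (e₂ := B * (ε * Φ)) (fun k hk => by
      have h7 : |x - x₀| ≤ (x₀ ^ ν)⁻¹ := by
        have := abs_sub_le_of_mem_bigWindow (D.subset hx)
        rw [Real.rpow_neg h0.le] at this
        have : 0 < (x₀ ^ ν)⁻¹ := inv_pos.mpr (Real.rpow_pos_of_pos h0 _)
        linarith
      have hμ := W.mu_nonneg
      calc B * (μ ^ (k + 2) / |α| ^ (k + 1)) * |x - x₀| ≤
            B * (μ ^ (k + 2) / |α| ^ (k + 1)) * (x₀ ^ ν)⁻¹ := by gcongr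
        _ = B * ((x₀ ^ ν)⁻¹ * (μ ^ (k + 2) / |α| ^ (k + 1))) := by ring
        _ ≤ _ := mul_le_mul_of_nonneg_left (htr k hk) hB)
  have e1 : K * (|α| + imDiag V x₀) * K / |α| = K ^ 2 * (1 + imDiag V x₀ / |α|) := by field_simp
  have e2 : ε * Φ + 2 * (n * (B * (ε * Φ))) = (1 + 2 * (n * B)) * (ε * Φ) := by ring
  rwa [e1, e2] at h1

/-- The modulus bounds `hweight` are a hypothesis because they may come from the smaller scale,
while the remainder and the cut-off terms use the scale that produces σ^{(N)}. -/
theorem quasimode_bound {K B ε η c M : ℝ} (hB : 0 ≤ B) (hK : 1 ≤ K)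
    (hΛ : ∀ x ∈ U, ‖factorA m V (α + imDiag V x₀ * Complex.I) x‖ ≤ K * (|α| + imDiag V x₀) ∧
        ‖factorB m V (α + imDiag V x₀ * Complex.I) x‖ ≤ K * (|α| + imDiag V x₀))
    (W : WindowData m V x₀ (α + imDiag V x₀ * Complex.I) s n U
      (x₀ ^ ν * (1 + imDiag V x₀ / |α|)) |α| K)
    (hκ : SymbolOn U (x₀ ^ ν * (1 + imDiag V x₀ / |α|)) n (B * (x₀ ^ ν * (1 + imDiag V x₀ / |α|)))
      (logDerivK m V x₀ (α + imDiag V x₀ * Complex.I)))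
    (hP : ∀ k i, k + i ≤ n → SymbolOn U (x₀ ^ ν * (1 + imDiag V x₀ / |α|)) i
      (B * ((x₀ ^ ν * (1 + imDiag V x₀ / |α|)) ^ (k + 1) / |α| ^ k))
      (phaseDeriv m V x₀ (α + imDiag V x₀ * Complex.I) s (k + 1)))
    (hweight : ∀ x ∈ U,
      ‖k1 V x₀ x * Complex.exp (-phase m V x₀ (α + imDiag V x₀ * Complex.I) s (n + 1) x)‖ ^ 2 ≤
        (K ^ 2 * (1 + imDiag V x₀ / |α|)) ^ 2 * Real.exp ((1 + 2 * (n * B)) *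
          (ε * (deriv (imDiag V) x₀ / (x₀ ^ ν) ^ 2)) -
          2 * ∫ t in x₀..x, (imDiag V t - imDiag V x₀)) ∧
      Real.exp (-((1 + 2 * (n * B)) * (ε * (deriv (imDiag V) x₀ / (x₀ ^ ν) ^ 2))) -
          2 * (K ^ 2 * ∫ t in x₀..x, (imDiag V t - imDiag V x₀))) ≤
        (K ^ 2 * (1 + imDiag V x₀ / |α|)) ^ 2 *
        ‖k1 V x₀ x * Complex.exp (-phase m V x₀ (α + imDiag V x₀ * Complex.I) s (n + 1) x)‖ ^ 2)
    {ξ : ℝ → ℝ} (hξ : ContDiff ℝ ∞ ξ) (hξ0 : ∀ x, 0 ≤ ξ x)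
    (hξ1 : ∀ x ∈ Ioo (x₀ - x₀ ^ (-ν) / 2 / 2) (x₀ + x₀ ^ (-ν) / 2 / 2), ξ x = 1)
    (hξoff : ∀ x ∉ Ioo (x₀ - x₀ ^ (-ν) / 2) (x₀ + x₀ ^ (-ν) / 2), ξ x = 0)
    (hξd : ∀ j ∈ Finset.Icc 1 2, ∀ x, |iteratedDeriv j ξ x| ≤ M * (x₀ ^ (-ν) / 2)⁻¹ ^ j)
    (hη : 0 < η) (hη' : η < 1 / 2) (hηε : Real.exp (2 * C * 4 ^ |ν|) * K ^ 2 * η ≤ ε)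
    {F₁ F₂ : ℝ} (hF₁ : F₁ = ∫ t in x₀..x₀ - x₀ ^ (-ν) / 2 / 2, (imDiag V t - imDiag V x₀))
    (hF₂ : F₂ = ∫ t in x₀..x₀ + x₀ ^ (-ν) / 2 / 2, (imDiag V t - imDiag V x₀))
    (hεF₁ : (5 / 2 + 2 * (n * B)) * (ε * (deriv (imDiag V) x₀ / (x₀ ^ ν) ^ 2)) ≤ (1 - c) * F₁)
    (hεF₂ : (5 / 2 + 2 * (n * B)) * (ε * (deriv (imDiag V) x₀ / (x₀ ^ ν) ^ 2)) ≤ (1 - c) * F₂)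
    (hG : K * (M * (2 * x₀ ^ ν) ^ 2 * |α|⁻¹ + 2 * (M * (2 * x₀ ^ ν)) *
      (K * (1 + imDiag V x₀ / |α|) + ∑ k ∈ Finset.range (n + 1),
        B * ((x₀ ^ ν * (1 + imDiag V x₀ / |α|)) ^ (k + 1) * |α|⁻¹ ^ (k + 1))) +
      B * (x₀ ^ ν * (1 + imDiag V x₀ / |α|)) * (M * (2 * x₀ ^ ν)) * |α|⁻¹) *
      (K ^ 2 * (1 + imDiag V x₀ / |α|)) ^ 2 * √(1 / (4 * η)) ≤
        Real.exp (ε * (deriv (imDiag V) x₀ / (x₀ ^ ν) ^ 2))) :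
    ∃ hL : MemLp (mode m V x₀ (α + imDiag V x₀ * Complex.I) s (n + 1) ξ) 2
      (volume.restrict (Ioi (0 : ℝ))),
    ∃ hD : hL.toLp _ ∈ (diracOp m V).domain, hL.toLp _ ≠ 0 ∧
      ‖diracOp m V ⟨hL.toLp _, hD⟩ - ((α : ℂ) + imDiag V x₀ * Complex.I) • hL.toLp _‖ /
        ‖hL.toLp _‖ ≤ Real.exp (-c * F₁) + Real.exp (-c * F₂) +
          K * ((n + 1) ^ 2 * B ^ 2 + B + B ^ 2) * ∑ i ∈ Finset.range (n + 1),
          (x₀ ^ ν * (1 + imDiag V x₀ / |α|)) ^ (n + 1 + i + 1) / |α| ^ (n + 1 + i) := by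
  have h0 := H.pos hx₀
  have hα := abs_pos.mpr D.ne_zero
  have hp : 0 < x₀ ^ ν := Real.rpow_pos_of_pos h0 _
  have hδ : 0 < x₀ ^ (-ν) := Real.rpow_pos_of_pos h0 _
  have hβ := H.imDiag_nonneg hx₀
  have hT := H.deriv_pos x₀ (by linarith [H.one_le_X])
  have hU := D.Icc_subset
  have hδP : x₀ ^ (-ν) = (x₀ ^ ν)⁻¹ := Real.rpow_neg h0.le ν
  set τ := 1 + imDiag V x₀ / |α| with hτ
  have hτ0 : 0 < τ := by positivity
  set Φ := deriv (imDiag V) x₀ / (x₀ ^ ν) ^ 2 with hΦ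
  have hΦ0 : 0 ≤ Φ := by positivity
  set ρ := K ^ 2 * τ with hρ
  have hρ0 : 0 < ρ := by positivity
  set e := (1 + 2 * (n * B)) * (ε * Φ) with he
  set L := √(1 / (4 * η)) with hL
  set w : ℝ → ℝ := fun x =>
    ‖k1 V x₀ x * Complex.exp (-phase m V x₀ (α + imDiag V x₀ * Complex.I) s (n + 1) x)‖ with hw
  set E := Real.exp (2 * C * 4 ^ |ν|)
  have hs := mem_bigWindow_self (ν := ν) h0
  have hup : ∀ x ∈ U, ∀ F, F ≤ ∫ t in x₀..x, (imDiag V t - imDiag V x₀) →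
      w x ≤ ρ * Real.exp (e / 2) * Real.exp (-F) := fun x hx F hF => by
    refine (sq_le_sq₀ (norm_nonneg _) (by positivity)).mp ((hweight x hx).1.trans ?_)
    have e3 : (ρ * Real.exp (e / 2) * Real.exp (-F)) ^ 2 = ρ ^ 2 * Real.exp (e - 2 * F) := by
      rw [mul_assoc, ← Real.exp_add, mul_pow, ← Real.exp_nat_mul]
      push_cast
      ring_nf
    rw [e3]
    refine mul_le_mul_of_nonneg_left (Real.exp_le_exp.mpr ?_) (by positivity)
    linarith
  have hlow : ∀ x ∈ Icc (x₀ - η * (x₀ ^ (-ν) / 2)) (x₀ + η * (x₀ ^ (-ν) / 2)),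
      ρ⁻¹ * Real.exp (-(e + ε * Φ) / 2) ≤ w x := fun x hx => by
    have hxU : x ∈ U := hU ⟨by nlinarith [hx.1], by nlinarith [hx.2]⟩
    have hF := (H.integral_imDiag_sub_bounds hx₀ (D.subset hxU)).2
    have h2 := (hweight x hxU).2
    have h3 : |x - x₀| ≤ η * (x₀ ^ (-ν) / 2) := by
      rw [abs_le]
      constructor <;> linarith [hx.1, hx.2]
    have h4 : (x - x₀) ^ 2 ≤ (η * (x₀ ^ (-ν) / 2)) ^ 2 := by
      rw [← sq_abs]
      exact pow_le_pow_left₀ (abs_nonneg _) h3 2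
    -- Near the centre F is at most quadratic, so the smallness of η makes even the upper bound K²F
    -- for Re ∫p_0 negligible compared with εΦ.
    have h5 : 2 * (K ^ 2 * ∫ t in x₀..x, (imDiag V t - imDiag V x₀)) ≤ ε * Φ := by
      calc 2 * (K ^ 2 * ∫ t in x₀..x, (imDiag V t - imDiag V x₀)) ≤
            2 * (K ^ 2 * (E * deriv (imDiag V) x₀ * ((x - x₀) ^ 2 / 2))) := by gcongr
        _ ≤ 2 * (K ^ 2 * (E * deriv (imDiag V) x₀ * ((η * (x₀ ^ (-ν) / 2)) ^ 2 / 2))) := by gcongr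
        _ = E * K ^ 2 * η * (η / 4) * Φ := by
          rw [hδP, hΦ]
          field_simp
          ring
        _ ≤ E * K ^ 2 * η * 1 * Φ := by
          gcongr
          linarith
        _ ≤ ε * Φ := by
          rw [mul_one]
          gcongr
    refine (sq_le_sq₀ (by positivity) (norm_nonneg _)).mp ?_
    rw [mul_pow, inv_pow, inv_mul_le_iff₀ (by positivity), ← Real.exp_nat_mul]
    refine (Real.exp_le_exp.mpr ?_).trans h2
    push_cast
    linarith
  have hsum0 : 0 ≤ ∑ k ∈ Finset.range (n + 1), B * ((x₀ ^ ν * τ) ^ (k + 1) * |α|⁻¹ ^ (k + 1)) :=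
    Finset.sum_nonneg fun k _ => by positivity
  set G := K * (M * (2 * x₀ ^ ν) ^ 2 * |α|⁻¹ + 2 * (M * (2 * x₀ ^ ν)) *
      (K * τ + ∑ k ∈ Finset.range (n + 1), B * ((x₀ ^ ν * τ) ^ (k + 1) * |α|⁻¹ ^ (k + 1))) +
      B * (x₀ ^ ν * τ) * (M * (2 * x₀ ^ ν)) * |α|⁻¹) with hGdef
  have hδi : (x₀ ^ (-ν) / 2)⁻¹ = 2 * x₀ ^ ν := by
    rw [hδP]
    field_simp
  -- Bookkeeping of exponents: the amplitude costs εΦ, the upper bound for the modulus e/2 and the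
  -- lower bound (e + εΦ)/2, where e = (1 + 2nB)εΦ. The total is (5/2 + 2nB)εΦ.
  have hfin : ∀ F, (5 / 2 + 2 * (n * B)) * (ε * Φ) ≤ (1 - c) * F →
      G * (ρ * Real.exp (e / 2)) * L ≤ ρ⁻¹ * Real.exp (-(e + ε * Φ) / 2) * Real.exp ((1 - c) * F) :=
    fun F hF => by
    have h3 : G * (ρ * Real.exp (e / 2)) * L = ρ⁻¹ * (G * ρ ^ 2 * L) * Real.exp (e / 2) := by
      field_simp
    rw [h3]
    calc ρ⁻¹ * (G * ρ ^ 2 * L) * Real.exp (e / 2) ≤ ρ⁻¹ * Real.exp (ε * Φ) * Real.exp (e / 2) := by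
          gcongr
      _ = ρ⁻¹ * Real.exp (ε * Φ + e / 2) := by rw [mul_assoc, ← Real.exp_add]
      _ ≤ ρ⁻¹ * Real.exp (-(e + ε * Φ) / 2 + (1 - c) * F) := by
          refine mul_le_mul_of_nonneg_left (Real.exp_le_exp.mpr ?_) (inv_pos.mpr hρ0).le
          rw [he]
          linarith
      _ = _ := by rw [mul_assoc, ← Real.exp_add]
  refine W.quasimode_bound hB hκ hP hΛ hξ hξ0 (half_pos hδ) hU hξ1 hξoff hξd (R := ρ * Real.exp (e / 2))
    (G := G) hη hη' (fun x hx => hup x (hU ⟨hx.1, by linarith [hx.2]⟩) F₁ ?_)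
    (fun x hx => hup x (hU ⟨by linarith [hx.1], hx.2⟩) F₂ ?_) hlow (by positivity) (by positivity)
    (le_of_eq ?_) (hfin F₁ hεF₁) (hfin F₂ hεF₂)
  · rw [hF₁]
    exact H.integral_imDiag_sub_mono hx₀ ⟨by linarith, by linarith⟩
      ⟨by linarith [hx.1], by linarith [hx.2]⟩ (Or.inr ⟨hx.2, by linarith⟩)
  · rw [hF₂]
    exact H.integral_imDiag_sub_mono hx₀ ⟨by linarith, by linarith⟩
      ⟨by linarith [hx.1], by linarith [hx.2]⟩ (Or.inl ⟨by linarith, hx.1⟩)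
  · rw [hδi, hGdef]
    have e1 : ∑ k ∈ Finset.range (n + 1), B * ((x₀ ^ ν * τ) ^ (k + 1) * |α|⁻¹ ^ (k + 1)) =
        |α|⁻¹ * ∑ k ∈ Finset.range (n + 1), B * ((x₀ ^ ν * τ) ^ (k + 1) / |α| ^ k) := by
      rw [Finset.mul_sum]
      refine Finset.sum_congr rfl fun k _ => ?_
      rw [div_eq_mul_inv, inv_pow, pow_succ |α| k, mul_inv]
      ring
    have e2 : |α| + imDiag V x₀ = |α| * τ := by
      rw [hτ]
      field_simp
    have e3 : |α|⁻¹ * |α| = 1 := inv_mul_cancel₀ hα.ne'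
    rw [e1, e2, div_eq_mul_inv]
    generalize ∑ k ∈ Finset.range (n + 1), B * ((x₀ ^ ν * τ) ^ (k + 1) / |α| ^ k) = S
    linear_combination (2 * (M * (2 * x₀ ^ ν)) * K ^ 2 * τ) * e3

end ComparisonData

/-- A subexponential function that is eventually nonnegative. -/
structure NonnegSubexponential (Φ f : ℝ → ℝ) : Prop where
  subexponential : Subexponential Φ f
  nonneg : ∀ᶠ β in atTop, 0 ≤ f β

namespace NonnegSubexponential

variable {Φ f g : ℝ → ℝ}

theorem mul (hf : NonnegSubexponential Φ f) (hg : NonnegSubexponential Φ g) :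
    NonnegSubexponential Φ (fun β => f β * g β) :=
  ⟨hf.1.mul hg.1 hg.2, by filter_upwards [hf.2, hg.2] with β h1 h2 using mul_nonneg h1 h2⟩

theorem const (hΦ : Tendsto Φ atTop atTop) {c : ℝ} (hc : 0 ≤ c) :
    NonnegSubexponential Φ (fun _ => c) :=
  ⟨Subexponential.const hΦ c, Eventually.of_forall fun _ => hc⟩

theorem add (hΦ : Tendsto Φ atTop atTop) (hf : NonnegSubexponential Φ f)
    (hg : NonnegSubexponential Φ g) : NonnegSubexponential Φ (fun β => f β + g β) :=
  ⟨hf.1.add hΦ hg.1, by filter_upwards [hf.2, hg.2] with β h1 h2 using add_nonneg h1 h2⟩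

theorem pow (hΦ : Tendsto Φ atTop atTop) (hf : NonnegSubexponential Φ f) (k : ℕ) :
    NonnegSubexponential Φ (fun β => f β ^ k) :=
  ⟨hf.1.pow hΦ hf.2 k, hf.2.mono fun _ h => pow_nonneg h k⟩

theorem sum (hΦ : Tendsto Φ atTop atTop) {f : ℕ → ℝ → ℝ} (n : ℕ)
    (hf : ∀ k, NonnegSubexponential Φ (f k)) :
    NonnegSubexponential Φ (fun β => ∑ k ∈ Finset.range n, f k β) := by
  induction n with
  | zero => simpa using const hΦ le_rfl
  | succ n ih => simpa only [Finset.sum_range_succ] using ih.add hΦ (hf n)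

end NonnegSubexponential

/-- The amplitude is a polynomial with nonnegative coefficients in x_β^ν, 1 + β/|α| and 1/|α|, and
this class is closed under sums and products. -/
theorem nonnegSubexponential_amplitude {Φ P τ ρ : ℝ → ℝ} (hΦ : Tendsto Φ atTop atTop)
    (hP : NonnegSubexponential Φ P) (hτ : NonnegSubexponential Φ τ)
    (hρ : NonnegSubexponential Φ ρ) {K M B L : ℝ} (hK : 0 ≤ K) (hM : 0 ≤ M) (hB : 0 ≤ B)
    (hL : 0 ≤ L) (n : ℕ) : NonnegSubexponential Φ (fun β =>
      K * (M * (2 * P β) ^ 2 * ρ β + 2 * (M * (2 * P β)) * (K * τ β + ∑ k ∈ Finset.range n,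
        B * ((P β * τ β) ^ (k + 1) * ρ β ^ (k + 1))) + B * (P β * τ β) * (M * (2 * P β)) * ρ β) *
      (K ^ 2 * τ β) ^ 2 * L) := by
  have c : ∀ {c : ℝ}, 0 ≤ c → NonnegSubexponential Φ (fun _ => c) := fun hc => .const hΦ hc
  have h2P := (c zero_le_two).mul hP
  have hMP := (c hM).mul h2P
  have hμ := hP.mul hτ
  have hS := NonnegSubexponential.sum hΦ n fun k =>
    (c hB).mul ((hμ.pow hΦ (k + 1)).mul (hρ.pow hΦ (k + 1)))
  have h1 := ((c hM).mul (h2P.pow hΦ 2)).mul hρ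
  have h2 := ((c zero_le_two).mul hMP).mul (((c hK).mul hτ).add hΦ hS)
  have h3 := (((c hB).mul hμ).mul hMP).mul hρ
  exact ((((c hK).mul ((h1.add hΦ h2).add hΦ h3))).mul
    (((c (sq_nonneg K)).mul hτ).pow hΦ 2)).mul (c hL)

end DiracPseudomode

/-! ### The main theorem -/

open DiracPseudomode

theorem mainTheorem4 (m : ℝ) (hm : 0 ≤ m) (V : ℝ → Matrix (Fin 2) (Fin 2) ℂ)
    (N : ℕ) (hN : 2 ≤ N) (ν : ℝ) (hν : -1 ≤ ν) (hV : AdmissiblePotential N ν V) :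
    (∀ c ∈ Ioo (0 : ℝ) 1, Tendsto (fun β => kappa ν V β c) atTop (𝓝 0)) ∧
    ∀ a b : ℝ, 0 < a → 0 < b → ∃ C > 0,
      ∀ α : ℝ → ℝ, IsComparable m ν V a b α → HasLowerGrowth N ν V α →
      ∀ ξ : ℝ → ℝ → ℝ, IsCutoffFamily ν V ξ →
      ∀ c ∈ Ioo (0 : ℝ) 1, ∃ β₀ > 0, ∀ β > β₀,
        ∃ hL : MemLp (pseudomode m V N (ξ β) (α β) β) 2 (volume.restrict (Ioi (0 : ℝ))),
        ∃ hD : hL.toLp _ ∈ (diracOp m V).domain,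
          hL.toLp _ ≠ 0 ∧
          ‖diracOp m V ⟨hL.toLp _, hD⟩ - ((α β : ℂ) + β * Complex.I) • hL.toLp _‖ / ‖hL.toLp _‖
            ≤ kappa ν V β c + C * sigma N ν V (α β) β := by
  obtain ⟨n, rfl⟩ : ∃ n, N = n + 1 := ⟨N - 1, by omega⟩
  have hn : 1 ≤ n := by omega
  obtain ⟨X, C₀, H⟩ := hV.exists_tailBounds hn hν
  refine ⟨fun c hc => H.tendsto_kappa hV hc.1, fun a b ha hb => ?_⟩
  obtain ⟨K, hK1, hK⟩ := H.exists_windowData (C₁ := 2 / a + 2 * b) (by positivity)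
  obtain ⟨B, hB1, hB⟩ := WindowData.exists_symbolOn n K (by linarith)
  have hB0 : 0 ≤ B := by linarith
  -- K and B are fixed before α, ξ and c are introduced, so the constant is uniform in them; these
  -- affect only the threshold β₀.
  refine ⟨K * ((n + 1) ^ 2 * B ^ 2 + B + B ^ 2), by positivity,
    fun α hα hgrow ξ ⟨M, hξ⟩ c hc => ?_⟩
  set E := Real.exp (2 * C₀ * 4 ^ |ν|) with hE
  have hE0 : 0 < E := Real.exp_pos _
  have hc1 : 0 < 1 - c := by linarith [hc.2]
  -- F is at least the growth scale divided by 32E, so with this ε the total loss (5/2 + 2nB)εΦ is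
  -- at most (1 - c)F.
  set ε := (1 - c) / (32 * E * (5 / 2 + 2 * (n * B))) with hε
  have hε0 : 0 < ε := by positivity
  set η := min (1 / 4) (ε / (E * K ^ 2)) with hη
  have hη0 : 0 < η := by positivity
  have hη1 : η < 1 / 2 := lt_of_le_of_lt (min_le_left _ _) (by norm_num)
  have hη2 : E * K ^ 2 * η ≤ ε := by
    have := min_le_right (1 / 4) (ε / (E * K ^ 2))
    rw [le_div_iff₀ (by positivity)] at this
    linarith
  have hΦ := hV.tendsto_growthScale
  have hcomp : ∀ᶠ β in atTop, ∃ U, ComparisonData m ν V (turningPoint V β) (α β)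
      (if 0 < α β - m - (V (turningPoint V β) 0 0).re then 1 else -1) U (2 / a + 2 * b) := by
    filter_upwards [hα, hV.eventually_turningPoint (4 * X), eventually_ge_atTop m]
      with β h1 h2 h3
    exact H.exists_comparisonData h2.1 hm (h2.2.symm ▸ h3) ha hb h1
  have hα0 : ∀ᶠ β in atTop, α β ≠ 0 := hcomp.mono fun β ⟨U, D⟩ => D.ne_zero
  have hT : ∀ᶠ β in atTop, 0 < deriv (imDiag V) (turningPoint V β) :=
    (hV.eventually_turningPoint X).mono fun β hβ => H.deriv_pos _ hβ.1
  have sP : NonnegSubexponential (growthScale ν V) (fun β => turningPoint V β ^ ν) :=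
    ⟨hV.subexponential_turningPoint ν,
      (hV.eventually_turningPoint 0).mono fun β hβ => Real.rpow_nonneg hβ.1 _⟩
  have sr : NonnegSubexponential (growthScale ν V) (fun β => |α β|⁻¹) :=
    ⟨hV.subexponential_inv hgrow hT, Eventually.of_forall fun β => inv_nonneg.mpr (abs_nonneg _)⟩
  have sβ : NonnegSubexponential (growthScale ν V) (fun β => β) :=
    ⟨by simpa using hV.subexponential_rpow 1, eventually_ge_atTop 0⟩
  have sτ : NonnegSubexponential (growthScale ν V) (fun β => 1 + β / |α β|) := by
    simpa only [div_eq_mul_inv] using (NonnegSubexponential.const hΦ zero_le_one).add hΦ (sβ.mul sr)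
  -- Replacing M by |M| weakens the cut-off bounds and makes all coefficients of the amplitude
  -- nonnegative.
  have hamp := (nonnegSubexponential_amplitude hΦ sP sτ sr (by linarith : 0 ≤ K) (abs_nonneg M)
    hB0 (Real.sqrt_nonneg (1 / (4 * η))) (n + 1)).1 ε hε0
  have hev := hcomp.and (hξ.and (hamp.and ((hV.eventually_turningPoint (4 * X)).and
    ((H.eventually_offDiag_integral_le hV hε0).and
      (hgrow.eventually_symbol_pow_le hV hn hα0 hε0)))))
  obtain ⟨β₁, hβ₁⟩ := eventually_atTop.mp (hev.and (hΦ.eventually_ge_atTop 0))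
  refine ⟨max β₁ 1, lt_of_lt_of_le one_pos (le_max_right _ _), fun β hβ => ?_⟩
  obtain ⟨⟨⟨U, D⟩, ⟨hξ1, -, -, hξ2, hξ3, hξ4, hξ5⟩, hG, ⟨hx₀, hxβ⟩, hoff, htr⟩, hΦ0⟩ :=
    hβ₁ β ((le_max_left _ _).trans hβ.le)
  obtain ⟨k1', k2', k3', W, W'⟩ := hK hx₀ D
  obtain ⟨hκ, hP⟩ := hB W
  have hF := H.growthScale_le_Fint hx₀ hxβ
  have hεF : ∀ F, (32 * E)⁻¹ * growthScale ν V β ≤ F →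
      (5 / 2 + 2 * (n * B)) * (ε * growthScale ν V β) ≤ (1 - c) * F := fun F hF' => by
    calc (5 / 2 + 2 * (n * B)) * (ε * growthScale ν V β) =
          (1 - c) * ((32 * E)⁻¹ * growthScale ν V β) := by
          rw [hε]
          field_simp
      _ ≤ _ := by gcongr
  have key := D.quasimode_bound H hx₀ (M := |M|) (ξ := ξ β) hB0 hK1 k1' W hκ hP
    (fun x hx => by
      -- Either scale may control the modulus; the second alternative brings the bound on 𝒱'(x_β)
      -- that the smaller scale requires.
      rcases htr with htr | ⟨hTr, htr⟩
      · exact D.weight_bounds H hx₀ hB0 k1' k2' k3' W hP hoff (by rw [hxβ]; exact htr) hx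
      · exact D.weight_bounds H hx₀ hB0 k1' k2' k3' (W' hTr) (hB (W' hTr)).2 hoff
          (by rw [hxβ]; exact htr) hx)
    hξ1 (fun x => (hξ2 x).1) hξ3 hξ4
    (fun j hj x => (hξ5 j hj x).trans (mul_le_mul_of_nonneg_right (le_abs_self M)
      (pow_nonneg (inv_nonneg.mpr (div_nonneg (Real.rpow_nonneg (H.pos hx₀).le _) zero_le_two)) j)))
    hη0 hη1 hη2 rfl rfl (c := c) (by rw [hxβ]; exact hεF _ hF.1) (by rw [hxβ]; exact hεF _ hF.2)
    (by rw [hxβ]; exact hG)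
  have hs : (((if 0 < α β - m - (V (turningPoint V β) 0 0).re then 1 else -1 : ℝ)) : ℂ) =
      if 0 < α β - m - (V (turningPoint V β) 0 0).re then 1 else -1 := by
    split_ifs <;> simp
  rw [hxβ, hs] at key
  -- Collecting μ^(N+i+1)/|α|^(N+i) with N = n + 1 and μ = x_β^ν(1 + β/|α|) reproduces σ^{(N)} term
  -- by term.
  have hsig : ∑ i ∈ Finset.range (n + 1), (turningPoint V β ^ ν * (1 + β / |α β|)) ^
      (n + 1 + i + 1) / |α β| ^ (n + 1 + i) = sigma (n + 1) ν V (α β) β := by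
    unfold sigma
    refine Finset.sum_congr rfl fun i _ => ?_
    have e : (((n + 1 : ℕ) : ℝ) + i + 1) * ν = ν * ((n + 1 + i + 1 : ℕ) : ℝ) := by
      push_cast
      ring
    rw [e, Real.rpow_mul_natCast (H.pos hx₀).le, mul_pow]
    ring
  rw [hsig] at key
  exact key
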